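/- Let $n\ge 0$ and $\hbar_0>0$, and let $(x,\xi,t,\tau)$ be the standard coordinates on $T^*(\mathbb R^n\times S^1)$, $S^1=\mathbb R/2\pi\mathbb Z$. Call a smooth function $b(x,\xi,t,\tau)$, $2\pi$-periodic in $t$, a symbol if for some $M$ each of its derivatives is bounded by a constant times $(1+|x|+|\xi|+|\tau|)^M$. Let $a(x,\xi,t,\tau,\hbar)$, $0<\hbar<\hbar_0$, be smooth in $(x,\xi,t,\tau)$ and $2\pi$-periodic in $t$, with an asymptotic expansion $a\sim\sum_{k\ge 0}\hbar^k a_k$: the $a_k(x,\xi,t,\tau)$ are symbols, and for every $K\ge 0$ there is an $M$ such that each $(x,\xi,t,\tau)$-derivative of $a-\sum_{k<K}\hbar^k a_k$ is bounded by a constant, independent of $\hbar$, times $\hbar^K(1+|x|+|\xi|+|\tau|)^M$. Let $A=A_\hbar$ be the semiclassical pseudodifferential operator on $\mathbb R^n\times S^1$ with total Weyl symbol $a$, that is, $$(A_\hbar u)(x,t)=\frac1{(2\pi\hbar)^{n+1}}\int e^{\frac i\hbar(\langle x-y,\xi\rangle+(t-s)\tau)}\,a\Big(\frac{x+y}2,\xi,\frac{t+s}2,\tau,\hbar\Big)u(y,s)\,dy\,ds\,d\xi\,d\tau$$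 (an oscillatory integral over $\mathbb R^{2n+2}$) for smooth $u$, $2\pi$-periodic in $t$ and Schwartz in $x$. For $\mu=(\mu_1,\dots,\mu_{n+1})\in\mathbb N^n\times\mathbb Z$ let $$H_\mu(x,t)=\hbar^{-n/4}h_{\mu_1}(x_1/\sqrt\hbar)\cdots h_{\mu_n}(x_n/\sqrt\hbar)\,e^{i\mu_{n+1}t},$$ where $h_j$ is the $j$-th normalized Hermite function, and let $|\mu|$ be the Euclidean length of $\mu$. Then the following are equivalent: (i) $a$ vanishes to infinite order at $p=\tau=0$ (where $p_i=x_i^2+\xi_i^2$), that is, every $a_k$ vanishes together with all its derivatives at all points $(x,\xi,t,\tau)=(0,0,t,0)$; (ii) $\|AH_\mu\|_{L^2(\mathbb R^n\times S^1)}=O(|\mu\hbar|^\infty)$, that is, for every $N\in\mathbb N$ there are $C$ and $\delta>0$ such that $\|A_\hbar H_\mu\|_{L^2(\mathbb R^n\times S^1)}\le C\,(|\mu|\hbar)^N$ for all $0<\hbar<\hbar_0$ and all $\mu\neq 0$ with $|\mu|\hbar\le\delta$. Moreover, if (i) holds, then for $\mu=0$ one has $\|A_\hbar H_0\|_{L^2(\mathbb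 R^n\times S^1)}=O(\hbar^N)$ as $\hbar\to 0$, for every $N$. -/

import Mathlib

open MeasureTheory
open scoped ContDiff

/-- The cotangent bundle `T^*(ℝⁿ × S¹)` with coordinates `(x, ξ, t, τ)`; functions on it are
functions of these real variables that are `2π`-periodic in `t`. -/
abbrev Phase (n : ℕ) : Type :=
  EuclideanSpace ℝ (Fin n) × EuclideanSpace ℝ (Fin n) × ℝ × ℝ

/-- The weight `1 + |x| + |ξ| + |τ|` at a point `(x, ξ, t, τ)`. -/
noncomputable def phaseWeight {n : ℕ} (z : Phase n) : ℝ :=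
  1 + ‖z.1‖ + ‖z.2.1‖ + |z.2.2.2|

/-- `b` is `2π`-periodic in the variable `t`. -/
def PeriodicInT {n : ℕ} (b : Phase n → ℂ) : Prop :=
  ∀ (x ξ : EuclideanSpace ℝ (Fin n)) (t τ : ℝ),
    b (x, ξ, t + 2 * Real.pi, τ) = b (x, ξ, t, τ)

/-- `b` is a symbol on `T^*(ℝⁿ × S¹)`: a smooth function, all of whose derivatives are bounded by
constants times one fixed power of the weight. This contains the class `S(1)` and the classes
`S^m_{1,0}` of every order, as well as all polynomials in `x, ξ, τ`. -/
structure IsSymbol {n : ℕ} (b : Phase n → ℂ) : Prop where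
  smooth : ContDiff ℝ ∞ b
  periodic : PeriodicInT b
  growth : ∃ M : ℕ, ∀ j : ℕ, ∃ C : ℝ, ∀ z : Phase n,
    ‖iteratedFDeriv ℝ j b z‖ ≤ C * phaseWeight z ^ M

/-- `a ħ`, `0 < ħ < ħ₀`, is a (total) semiclassical symbol with asymptotic expansion
`a ħ ∼ ∑ₖ ħᵏ c k`: the remainder after `K` terms is `ħ ^ K` times a family of symbols which is
bounded uniformly in `ħ`. -/
structure IsSemiclassicalSymbol {n : ℕ} (ħ₀ : ℝ) (a : ℝ → Phase n → ℂ)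
    (c : ℕ → Phase n → ℂ) : Prop where
  smooth : ∀ ħ ∈ Set.Ioo 0 ħ₀, ContDiff ℝ ∞ (a ħ)
  periodic : ∀ ħ ∈ Set.Ioo 0 ħ₀, PeriodicInT (a ħ)
  coeff : ∀ k : ℕ, IsSymbol (c k)
  expansion : ∀ K : ℕ, ∃ M : ℕ, ∀ j : ℕ, ∃ C : ℝ, ∀ ħ ∈ Set.Ioo 0 ħ₀, ∀ z : Phase n,
    ‖iteratedFDeriv ℝ j
        (fun w => a ħ w - ∑ k ∈ Finset.range K, ((ħ ^ k : ℝ) : ℂ) * c k w) z‖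
      ≤ C * ħ ^ K * phaseWeight z ^ M

/-- The total symbol with expansion `∑ₖ ħᵏ c k` vanishes to infinite order at `p = τ = 0`, that is
on the circle `x = ξ = 0`, `τ = 0`: there every `c k` vanishes with all its derivatives. -/
def VanishesToInfiniteOrder {n : ℕ} (c : ℕ → Phase n → ℂ) : Prop :=
  ∀ (k j : ℕ) (t : ℝ), iteratedFDeriv ℝ j (c k) (0, 0, t, 0) = 0

/-- The semiclassical Weyl quantization on `ℝⁿ`:
`(2πħ)⁻ⁿ ∫∫ exp (i ⟨x - y, ξ⟩ / ħ) b ((x + y) / 2, ξ) v y dy dξ`.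
For a symbol `b` and a Schwartz function `v` the iterated integral converges absolutely at each
of its two stages. -/
noncomputable def weylRn {n : ℕ} (ħ : ℝ)
    (b : EuclideanSpace ℝ (Fin n) → EuclideanSpace ℝ (Fin n) → ℂ)
    (v : EuclideanSpace ℝ (Fin n) → ℂ) (x : EuclideanSpace ℝ (Fin n)) : ℂ :=
  ((((2 * Real.pi * ħ) ^ n)⁻¹ : ℝ) : ℂ) *
    ∫ ξ : EuclideanSpace ℝ (Fin n), ∫ y : EuclideanSpace ℝ (Fin n),
      Complex.exp (Complex.I * ((inner ℝ (x - y) ξ / ħ : ℝ) : ℂ)) *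
        b ((1 / 2 : ℝ) • (x + y)) ξ * v y

/-- The semiclassical Weyl quantization on `ℝⁿ × S¹`, on functions `u (x, t)` that are smooth,
`2π`-periodic in `t` and Schwartz in `x`. In the `t` variable it is the usual oscillatory integral
`(2πħ)⁻¹ ∫∫ exp (i s τ / ħ) b (t - s / 2, τ) u (t - s) ds dτ` over `s, τ ∈ ℝ`; since
`s ↦ b (t - s / 2, τ) u (t - s)` has period `4π`, the integral over `s` is a sum of Dirac masses at
`τ = ħ l / 2`, `l ∈ ℤ`, weighted by Fourier coefficients. Thus `e^{ikt} f(τ)` sends `e^{imt}` to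
`f (ħ (m + k / 2)) e^{i(m + k)t}`. -/
noncomputable def weylOp {n : ℕ} (ħ : ℝ) (b : Phase n → ℂ)
    (u : EuclideanSpace ℝ (Fin n) × ℝ → ℂ) (z : EuclideanSpace ℝ (Fin n) × ℝ) : ℂ :=
  ∑' l : ℤ, (((4 * Real.pi)⁻¹ : ℝ) : ℂ) *
    ∫ s in (-(2 * Real.pi))..(2 * Real.pi),
      Complex.exp (Complex.I * (((l : ℝ) * s / 2 : ℝ) : ℂ)) *
        weylRn ħ (fun y ξ => b (y, ξ, z.2 - s / 2, ħ * (l : ℝ) / 2))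
          (fun y => u (y, z.2 - s)) z.1

/-- The `j`-th normalized Hermite function on `ℝ`,
`(j! √π)^{-1/2} He_j(√2 r) exp (-r² / 2)`, where `He_j` is the `j`-th (probabilists') Hermite
polynomial. -/
noncomputable def hermiteFun (j : ℕ) (r : ℝ) : ℝ :=
  (Real.sqrt ((j.factorial : ℝ) * Real.sqrt Real.pi))⁻¹ *
    Polynomial.aeval (Real.sqrt 2 * r) (Polynomial.hermite j) * Real.exp (-(r ^ 2) / 2)

/-- The basis function
`H_{μ,m} (x, t) = ħ^{-n/4} h_{μ₁}(x₁ / √ħ) ⋯ h_{μₙ}(xₙ / √ħ) e^{imt}` of `L²(ℝⁿ × S¹)`,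
for `μ ∈ ℕⁿ` and `m ∈ ℤ`. -/
noncomputable def hermiteBasis {n : ℕ} (ħ : ℝ) (μ : Fin n → ℕ) (m : ℤ)
    (z : EuclideanSpace ℝ (Fin n) × ℝ) : ℂ :=
  ((ħ ^ (-(n : ℝ) / 4) * ∏ i, hermiteFun (μ i) (z.1 i / Real.sqrt ħ) : ℝ) : ℂ) *
    Complex.exp (Complex.I * (((m : ℝ) * z.2 : ℝ) : ℂ))

/-- The Euclidean length `|(μ, m)|` of a multi-index. -/
noncomputable def indexNorm {n : ℕ} (μ : Fin n → ℕ) (m : ℤ) : ℝ :=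
  Real.sqrt ((∑ i, (μ i : ℝ) ^ 2) + (m : ℝ) ^ 2)

/-- The norm of `L²(ℝⁿ × S¹, dx dt)`, with values in `[0, ∞]`, of a function which is
`2π`-periodic in `t`. -/
noncomputable def normL2 {n : ℕ} (f : EuclideanSpace ℝ (Fin n) × ℝ → ℂ) : ENNReal :=
  eLpNorm f 2
    ((volume : Measure (EuclideanSpace ℝ (Fin n))).prod
      ((volume : Measure ℝ).restrict (Set.Ioc 0 (2 * Real.pi))))

/-- `‖A H_{μ,m}‖ = O(|(μ, m) ħ|^∞)` as `|(μ, m) ħ| → 0`, `(μ, m) ≠ 0`, for the family of operators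
`A` with Weyl symbols `a ħ`, `0 < ħ < ħ₀`; the constants are uniform in `ħ`, `μ` and `m`. -/
def HermiteDecay {n : ℕ} (ħ₀ : ℝ) (a : ℝ → Phase n → ℂ) : Prop :=
  ∀ N : ℕ, ∃ C : ℝ, ∃ δ : ℝ, 0 < δ ∧
    ∀ ħ ∈ Set.Ioo 0 ħ₀, ∀ (μ : Fin n → ℕ) (m : ℤ),
      0 < indexNorm μ m → indexNorm μ m * ħ ≤ δ →
        normL2 (weylOp ħ (a ħ) (hermiteBasis ħ μ m))
          ≤ ENNReal.ofReal (C * (indexNorm μ m * ħ) ^ N)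

/-- `‖A H_0‖ = O(ħ^∞)` as `ħ → 0`, for the index `(μ, m) = 0`. -/
def GroundStateDecay {n : ℕ} (ħ₀ : ℝ) (a : ℝ → Phase n → ℂ) : Prop :=
  ∀ N : ℕ, ∃ C : ℝ, ∃ δ : ℝ, 0 < δ ∧
    ∀ ħ ∈ Set.Ioo 0 ħ₀, ħ ≤ δ →
      normL2 (weylOp ħ (a ħ) (hermiteBasis ħ (fun _ : Fin n => 0) 0))
        ≤ ENNReal.ofReal (C * ħ ^ N)

open scoped SchwartzMap LineDeriv
open Filter Topology
open scoped NNReal ENNReal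

/-! Both directions rest on the dilation (x, ξ, t, τ) ↦ (r x, r ξ, t, r² τ). It conjugates the
quantization with parameter ħ into the one with parameter ħ / r², by a unitary map that carries the
Hermite basis for ħ to the Hermite basis for ħ / r² (`normL2_weylOp_dilation`).

Flatness implies decay. Put E = |μ| ħ and r = √E. A nonzero index has length at least one, so the
new parameter ħ / E is at most one, and the rescaled basis function has bounded energy (ħ / E) |μ|.
The rescaled symbol is E^N times a family bounded in a class of polynomially growing symbols:
Taylor's formula transversally to the circle gives this for the flat coefficients, and ħ^N ≤ E^N
gives it for the remainder (`IsSemiclassicalSymbol.dilation_decay`). What is left is a uniform bound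
for quantizations of bounded families of symbols on basis functions of bounded energy
(`PhaseSymbol.normL2_weylOp_bounded`). Growing symbols do not act boundedly on L², but at bounded
energy the ladder relations let positions and semiclassical momenta act with bounded coefficients. A
symbol of order -(n+1) in ξ has a kernel dominated by a convolution kernel times a polynomial
weight, which the Hermite functions absorb. Higher orders are reduced to this one by moving factors
ξ_j onto the Hermite function as derivatives (`UniformSymbol.weylBounded`). In the angle the
operator splits into Fourier modes, which decay rapidly by integration by parts. The index zero is
treated in the same way with E = ħ.

Decay implies flatness. Give ħ weight two and each of x, ξ, τ weight one, and suppose that all terms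
of weight below L vanish on the circle (`VanishesBelow`). Take ħ = ε² and dilate by ε, which
normalizes the semiclassical parameter to one. Let the frequency m grow like s / ε, so that τ ≈ ħ m
≈ ε s is as small as the dilated x and ξ. Then |(μ, m)| ħ = O(ε), and decay of order L + 1 still
gives O(ε) after division by ε^L. The rescaled symbols converge to a polynomial `leadingForm` in (x,
ξ, s), assembled from the Taylor terms of weight L. In the limit all Fourier coefficients in t of
its quantization applied to any Hermite function vanish
(`IsSemiclassicalSymbol.leadingForm_fourier`). A polynomial symbol annihilating all Hermite
functions is zero (`WeylNull.eq_zero`): commutators with the coordinates lower its degree in ξ until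
a multiplication operator remains, which is tested on the Gaussian. The summands of the leading form
have distinct degrees and so vanish separately for s > 0. Polarization on this open half-space then
kills the derivatives of weight L, and induction on L concludes. Transversal flatness at every angle
finally gives vanishing of all derivatives (`PhaseSymbol.flat_of_transversal`). -/

/-! ### Uniform families of symbols. -/

lemma norm_iteratedFDeriv_comp_affine_smul_le {V V' F : Type*} [NormedAddCommGroup V]
    [NormedSpace ℝ V] [NormedAddCommGroup V'] [NormedSpace ℝ V'] [NormedAddCommGroup F]
    [NormedSpace ℝ F] {f : V → F} (hf : ContDiff ℝ ∞ f) {c : ℝ} (hc : 0 ≤ c) (A : V' →L[ℝ] V)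
    (a : V) (j : ℕ) (z : V') :
    ‖iteratedFDeriv ℝ j (fun z => c • f (a + A z)) z‖ ≤
      c * (‖iteratedFDeriv ℝ j f (a + A z)‖ * ‖A‖ ^ j) := by
  have hs : ContDiff ℝ ∞ (fun z => f (a + z)) := hf.comp (contDiff_const.add contDiff_id)
  have hs' : ContDiff ℝ ∞ (fun z => f (a + A z)) := hs.comp A.contDiff
  have h1 : iteratedFDeriv ℝ j (fun z => f (a + A z)) z =
      (iteratedFDeriv ℝ j (fun z => f (a + z)) (A z)).compContinuousLinearMap fun _ => A :=
    A.iteratedFDeriv_comp_right hs z (mod_cast le_top)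
  have h3 : iteratedFDeriv ℝ j (fun z => c • f (a + A z)) z =
      c • iteratedFDeriv ℝ j (fun z => f (a + A z)) z :=
    iteratedFDeriv_const_smul_apply (a := c) (f := fun z => f (a + A z))
      (hs'.of_le (mod_cast le_top)).contDiffAt
  rw [h3, norm_smul, Real.norm_of_nonneg hc, h1, iteratedFDeriv_comp_add_left]
  have h2 := ContinuousMultilinearMap.norm_compContinuousLinearMap_le
    (iteratedFDeriv ℝ j f (a + A z)) fun _ => A
  rw [Finset.prod_const, Finset.card_univ, Fintype.card_fin] at h2
  exact mul_le_mul_of_nonneg_left h2 hc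

/-- A family of smooth functions all of whose derivatives are bounded by constants, uniform in the
family, times a fixed weight. -/
structure UniformSymbol {ι V F : Type*} [NormedAddCommGroup V] [NormedSpace ℝ V]
    [NormedAddCommGroup F] [NormedSpace ℝ F] (w : V → ℝ) (b : ι → V → F) : Prop where
  nonneg : ∀ z, 0 ≤ w z
  smooth : ∀ i, ContDiff ℝ ∞ (b i)
  bound : ∀ j : ℕ, ∃ C : ℝ, 0 ≤ C ∧ ∀ i z, ‖iteratedFDeriv ℝ j (b i) z‖ ≤ C * w z

namespace UniformSymbol

variable {ι κ V V' F : Type*} [NormedAddCommGroup V] [NormedSpace ℝ V]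
  [NormedAddCommGroup V'] [NormedSpace ℝ V']
  [NormedAddCommGroup F] [NormedSpace ℝ F] {w w' : V → ℝ} {b b' : ι → V → F}

lemma of_bound (hw : ∀ z, 0 ≤ w z) (hs : ∀ i, ContDiff ℝ ∞ (b i))
    (h : ∀ j : ℕ, ∃ C : ℝ, ∀ i z, ‖iteratedFDeriv ℝ j (b i) z‖ ≤ C * w z) :
    UniformSymbol w b := by
  refine ⟨hw, hs, fun j => ?_⟩
  obtain ⟨C, hC⟩ := h j
  exact ⟨|C|, abs_nonneg _, fun i z => (hC i z).trans
    (mul_le_mul_of_nonneg_right (le_abs_self C) (hw z))⟩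

lemma mono (h : UniformSymbol w b) (C : ℝ) (hw' : ∀ z, 0 ≤ w' z) (hC : ∀ z, w z ≤ C * w' z) :
    UniformSymbol w' b := by
  refine of_bound hw' h.smooth fun j => ?_
  obtain ⟨D, hD0, hD⟩ := h.bound j
  refine ⟨D * C, fun i z => (hD i z).trans ?_⟩
  rw [mul_assoc]
  exact mul_le_mul_of_nonneg_left (hC z) hD0

lemma reindex (h : UniformSymbol w b) (f : κ → ι) : UniformSymbol w (fun k => b (f k)) :=
  ⟨h.nonneg, fun k => h.smooth (f k), fun j =>
    let ⟨C, h0, hC⟩ := h.bound j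
    ⟨C, h0, fun k z => hC (f k) z⟩⟩

lemma add (h : UniformSymbol w b) (h' : UniformSymbol w b') :
    UniformSymbol w (fun i z => b i z + b' i z) := by
  refine of_bound h.nonneg (fun i => (h.smooth i).add (h'.smooth i)) fun j => ?_
  obtain ⟨C, -, hC⟩ := h.bound j
  obtain ⟨C', -, hC'⟩ := h'.bound j
  refine ⟨C + C', fun i z => ?_⟩
  have : iteratedFDeriv ℝ j (fun z => b i z + b' i z) z
      = iteratedFDeriv ℝ j (b i) z + iteratedFDeriv ℝ j (b' i) z :=
    iteratedFDeriv_add_apply ((h.smooth i).of_le (mod_cast le_top)).contDiffAt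
      ((h'.smooth i).of_le (mod_cast le_top)).contDiffAt
  rw [this, add_mul]
  exact (norm_add_le _ _).trans (add_le_add (hC i z) (hC' i z))

lemma const_smul {𝕜 : Type*} [NontriviallyNormedField 𝕜] [NormedAlgebra ℝ 𝕜] [NormedSpace 𝕜 F]
    [IsScalarTower ℝ 𝕜 F] (h : UniformSymbol w b) (c : ι → 𝕜) (B : ℝ) (hc : ∀ i, ‖c i‖ ≤ B) :
    UniformSymbol w (fun i z => c i • b i z) := by
  have : SMulCommClass ℝ 𝕜 F := IsScalarTower.to_smulCommClass
  refine of_bound h.nonneg (fun i => (h.smooth i).const_smul (c i)) fun j => ?_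
  obtain ⟨C, h0, hC⟩ := h.bound j
  refine ⟨B * C, fun i z => ?_⟩
  have : iteratedFDeriv ℝ j (fun z => c i • b i z) z = c i • iteratedFDeriv ℝ j (b i) z :=
    iteratedFDeriv_const_smul_apply ((h.smooth i).of_le (mod_cast le_top)).contDiffAt
  rw [this, norm_smul, mul_assoc]
  exact mul_le_mul (hc i) (hC i z) (norm_nonneg _) ((norm_nonneg _).trans (hc i))

lemma zero (hw : ∀ z, 0 ≤ w z) : UniformSymbol w (fun (_ : ι) (_ : V) => (0 : F)) :=
  of_bound hw (fun _ => contDiff_const) fun j => ⟨0, fun i z => by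
    rw [iteratedFDeriv_fun_zero]; simp⟩

lemma sum {σ : Type*} (s : Finset σ) (b : σ → ι → V → F) (hw : ∀ z, 0 ≤ w z)
    (h : ∀ a ∈ s, UniformSymbol w (b a)) :
    UniformSymbol w (fun i z => ∑ a ∈ s, b a i z) := by
  classical
  induction s using Finset.induction_on with
  | empty => simpa using zero hw
  | insert a s ha ih =>
    simp only [Finset.sum_insert ha]
    exact (h a (by simp)).add (ih fun c hc => h c (by simp [hc]))

lemma mul {A : Type*} [NormedRing A] [NormedAlgebra ℝ A] {b b' : ι → V → A}
    (h : UniformSymbol w b) (h' : UniformSymbol w' b') :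
    UniformSymbol (fun z => w z * w' z) (fun i z => b i z * b' i z) := by
  refine of_bound (fun z => mul_nonneg (h.nonneg z) (h'.nonneg z))
    (fun i => (h.smooth i).mul (h'.smooth i)) fun j => ?_
  choose C hC0 hC using h.bound
  choose C' hC0' hC' using h'.bound
  refine ⟨∑ i ∈ Finset.range (j + 1), (j.choose i : ℝ) * C i * C' (j - i), fun i z => ?_⟩
  refine (norm_iteratedFDeriv_mul_le (h.smooth i) (h'.smooth i) z (n := j)
    (mod_cast le_top)).trans ?_
  rw [Finset.sum_mul]
  refine Finset.sum_le_sum fun k _ => ?_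
  calc (j.choose k : ℝ) * ‖iteratedFDeriv ℝ k (b i) z‖ * ‖iteratedFDeriv ℝ (j - k) (b' i) z‖
      ≤ (j.choose k : ℝ) * (C k * w z) * (C' (j - k) * w' z) := by
        have := hC0 k; have := h.nonneg z
        gcongr
        · exact hC k i z
        · exact hC' (j - k) i z
    _ = _ := by ring

lemma fderiv_apply (h : UniformSymbol w b) (e : V) :
    UniformSymbol w (fun i z => fderiv ℝ (b i) z e) := by
  have hs : ∀ i, ContDiff ℝ ∞ (fderiv ℝ (b i)) := fun i =>
    (h.smooth i).fderiv_right (by simp)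
  refine of_bound h.nonneg (fun i => (hs i).clm_apply contDiff_const) fun j => ?_
  obtain ⟨C, h0, hC⟩ := h.bound (j + 1)
  refine ⟨‖e‖ * C, fun i z => ?_⟩
  refine (norm_iteratedFDeriv_clm_apply_const (hs i).contDiffAt (n := j)
    (mod_cast le_top)).trans ?_
  rw [norm_iteratedFDeriv_fderiv, mul_assoc]
  exact mul_le_mul_of_nonneg_left (hC i z) (norm_nonneg _)

/-- The chain rule costs a factor ‖A i‖ ^ j, so a common bound on the linear parts keeps the
constants uniform. The scalars c i allow a different normalization of the weight for each member,
which slicing at large parameters and Taylor-type rescaling require. -/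
lemma comp_affine_smul (h : UniformSymbol w b) (c : ι → ℝ) (hc : ∀ i, 0 ≤ c i)
    (A : ι → V' →L[ℝ] V) (a : ι → V) (B : ℝ)
    (hA : ∀ i, ‖A i‖ ≤ B) {w' : V' → ℝ} (C : ℝ) (hw' : ∀ z, 0 ≤ w' z)
    (hC : ∀ i z, c i * w (a i + A i z) ≤ C * w' z) :
    UniformSymbol w' (fun i z => c i • b i (a i + A i z)) := by
  have hs : ∀ i, ContDiff ℝ ∞ (fun z => b i (a i + z)) := fun i =>
    (h.smooth i).comp (contDiff_const.add contDiff_id)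
  have hs' : ∀ i, ContDiff ℝ ∞ (fun z => b i (a i + A i z)) := fun i =>
    (hs i).comp (A i).contDiff
  refine of_bound hw' (fun i => (hs' i).const_smul (c i)) fun j => ?_
  obtain ⟨D, h0, hD⟩ := h.bound j
  refine ⟨D * C * B ^ j, fun i z => ?_⟩
  have hB : 0 ≤ B := (norm_nonneg _).trans (hA i)
  calc _ ≤ c i * ((D * w (a i + A i z)) * B ^ j) := by
        refine (norm_iteratedFDeriv_comp_affine_smul_le (h.smooth i) (hc i) (A i) (a i) j z).trans
          (mul_le_mul_of_nonneg_left ?_ (hc i))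
        refine mul_le_mul (hD i _) ?_ (by positivity) (mul_nonneg h0 (h.nonneg _))
        exact pow_le_pow_left₀ (norm_nonneg _) (hA i) j
    _ = D * B ^ j * (c i * w (a i + A i z)) := by ring
    _ ≤ D * B ^ j * (C * w' z) := mul_le_mul_of_nonneg_left (hC i z) (by positivity)
    _ = _ := by ring

lemma comp_affine (h : UniformSymbol w b) (A : ι → V' →L[ℝ] V) (a : ι → V) (B : ℝ)
    (hA : ∀ i, ‖A i‖ ≤ B) {w' : V' → ℝ} (C : ℝ) (hw' : ∀ z, 0 ≤ w' z)
    (hC : ∀ i z, w (a i + A i z) ≤ C * w' z) :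
    UniformSymbol w' (fun i z => b i (a i + A i z)) := by
  simpa using h.comp_affine_smul (fun _ => 1) (fun _ => zero_le_one) A a B hA C hw'
    (fun i z => by rw [one_mul]; exact hC i z)

lemma norm_le (h : UniformSymbol w b) : ∃ C : ℝ, 0 ≤ C ∧ ∀ i z, ‖b i z‖ ≤ C * w z := by
  obtain ⟨C, h0, hC⟩ := h.bound 0
  exact ⟨C, h0, fun i z => by simpa using hC i z⟩

lemma hasTemperateGrowth (h : UniformSymbol w b) (M : ℕ) (C : ℝ)
    (hM : ∀ z, w z ≤ C * (1 + ‖z‖) ^ M) (i : ι) : (b i).HasTemperateGrowth := by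
  refine ⟨h.smooth i, fun j => ?_⟩
  obtain ⟨D, h0, hD⟩ := h.bound j
  refine ⟨M, D * C, fun z => (hD i z).trans ?_⟩
  rw [mul_assoc]
  exact mul_le_mul_of_nonneg_left (hM z) h0

end UniformSymbol

/-! ### Derivatives of (1 + |x|²)⁻¹. -/

section Bracket

variable {H : Type*} [NormedAddCommGroup H] [InnerProductSpace ℝ H]

lemma contDiff_inv_one_add_norm_sq : ContDiff ℝ ∞ (fun x : H => (1 + ‖x‖ ^ 2)⁻¹) :=
  (contDiff_const.add (contDiff_norm_sq ℝ)).inv fun x => by positivity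

/-- The original function is kept as a factor, and the other factor is linear in (1 + |x|²)⁻¹ x.
This form closes the induction on the order of derivatives. -/
lemma fderiv_inv_one_add_norm_sq (x : H) :
    fderiv ℝ (fun x : H => (1 + ‖x‖ ^ 2)⁻¹) x =
      (1 + ‖x‖ ^ 2)⁻¹ • ((-2 : ℝ) • innerSL ℝ ((1 + ‖x‖ ^ 2)⁻¹ • x)) := by
  have h1 : HasFDerivAt (fun x : H => 1 + ‖x‖ ^ 2) (2 • innerSL ℝ x) x :=
    ((hasStrictFDerivAt_norm_sq x).hasFDerivAt).const_add 1
  have h2 := (hasDerivAt_inv (x := 1 + ‖x‖ ^ 2) (by positivity)).comp_hasFDerivAt x h1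
  have h3 : HasFDerivAt (fun x : H => (1 + ‖x‖ ^ 2)⁻¹) _ x := h2
  rw [h3.fderiv]
  ext y
  simp
  field_simp

lemma norm_iteratedFDeriv_id_le (j : ℕ) (x : H) :
    ‖iteratedFDeriv ℝ j (fun x : H => x) x‖ ≤ 1 + ‖x‖ := by
  match j with
  | 0 => simp
  | 1 =>
    rw [← norm_iteratedFDeriv_fderiv (n := 0), norm_iteratedFDeriv_zero]
    have : fderiv ℝ (fun x : H => x) x = ContinuousLinearMap.id ℝ H := fderiv_fun_id
    rw [this]
    have := ContinuousLinearMap.norm_id_le (𝕜 := ℝ) (E := H)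
    have := norm_nonneg x
    linarith
  | k + 2 =>
    rw [← norm_iteratedFDeriv_fderiv]
    have : fderiv ℝ (fun x : H => x) = fun _ => ContinuousLinearMap.id ℝ H := by
      ext1 x; exact fderiv_fun_id
    rw [this, iteratedFDeriv_succ_const]
    simp; positivity

/-- With p the function itself, ∇p = p q where q = -2 ⟨p x, ·⟩. Since p (1 + |x|) is bounded,
Leibniz bounds the derivatives of p x, hence those of q, by the orders already treated. A second use
of Leibniz on p q gives one more order with the factor p intact. -/
lemma norm_iteratedFDeriv_inv_one_add_norm_sq_le (n : ℕ) :
    ∃ C : ℝ, 0 ≤ C ∧ ∀ j ≤ n, ∀ x : H,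
      ‖iteratedFDeriv ℝ j (fun x : H => (1 + ‖x‖ ^ 2)⁻¹) x‖ ≤ C * (1 + ‖x‖ ^ 2)⁻¹ := by
  induction n with
  | zero =>
    refine ⟨1, zero_le_one, fun j hj x => ?_⟩
    obtain rfl : j = 0 := by omega
    rw [norm_iteratedFDeriv_zero, one_mul, Real.norm_of_nonneg (by positivity)]
  | succ n ih =>
    obtain ⟨C, hC0, hC⟩ := ih
    set p : H → ℝ := fun x => (1 + ‖x‖ ^ 2)⁻¹ with hp
    have hps : ContDiff ℝ ∞ p := contDiff_inv_one_add_norm_sq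
    have hp0 : ∀ x, 0 < p x := fun x => by simp only [hp]; positivity
    have hp1 : ∀ x, p x * (1 + ‖x‖) ≤ 2 := fun x => by
      simp only [hp]
      rw [inv_mul_le_iff₀ (by positivity)]
      nlinarith [sq_nonneg (‖x‖ - 1)]
    have hpx : ContDiff ℝ ∞ (fun x : H => p x • x) := hps.smul contDiff_id
    have hleib : ∀ j ≤ n, ∀ x : H, ‖iteratedFDeriv ℝ j (fun x : H => p x • x) x‖
        ≤ 2 ^ j * C * 2 := by
      intro j hj x
      refine (norm_iteratedFDeriv_smul_le hps contDiff_id x (n := j) (mod_cast le_top)).trans ?_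
      calc _ ≤ ∑ i ∈ Finset.range (j + 1), (j.choose i : ℝ) * (C * 2) := by
            refine Finset.sum_le_sum fun i hi => ?_
            have hi' : i ≤ n := by have := Finset.mem_range.1 hi; omega
            rw [mul_assoc]
            refine mul_le_mul_of_nonneg_left ?_ (by positivity)
            calc _ ≤ (C * p x) * (1 + ‖x‖) :=
                  mul_le_mul (hC i hi' x) (norm_iteratedFDeriv_id_le _ x) (norm_nonneg _)
                    (mul_nonneg hC0 (hp0 x).le)
              _ ≤ _ := by rw [mul_assoc]; exact mul_le_mul_of_nonneg_left (hp1 x) hC0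
        _ = _ := by
            rw [← Finset.sum_mul, ← Nat.cast_sum, Nat.sum_range_choose]; push_cast; ring
    let q : H → (H →L[ℝ] ℝ) := fun x => (-2 : ℝ) • innerSL ℝ (p x • x)
    let Λ : H →L[ℝ] (H →L[ℝ] ℝ) := (-2 : ℝ) • (innerSL ℝ : H →L[ℝ] H →L[ℝ] ℝ)
    have hqs : ContDiff ℝ ∞ q := Λ.contDiff.comp hpx
    have hq : ∀ j ≤ n, ∀ x : H, ‖iteratedFDeriv ℝ j q x‖ ≤ ‖Λ‖ * (2 ^ n * C * 2) := by
      intro j hj x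
      refine (Λ.norm_iteratedFDeriv_comp_left (f := fun x : H => p x • x) hpx.contDiffAt
        (n := j) (mod_cast le_top)).trans ?_
      refine mul_le_mul_of_nonneg_left ((hleib j hj x).trans ?_) (norm_nonneg _)
      gcongr
      norm_num
    have hfd : fderiv ℝ p = fun x => p x • q x := by
      ext1 x; exact fderiv_inv_one_add_norm_sq x
    refine ⟨max C (2 ^ n * (C * (‖Λ‖ * (2 ^ n * C * 2)))), le_max_of_le_left hC0,
      fun j hj x => ?_⟩
    rcases Nat.lt_or_ge j (n + 1) with hj' | hj'
    · exact (hC j (by omega) x).trans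
        (mul_le_mul_of_nonneg_right (le_max_left _ _) (hp0 x).le)
    · obtain rfl : j = n + 1 := by omega
      rw [← norm_iteratedFDeriv_fderiv, hfd]
      refine (norm_iteratedFDeriv_smul_le hps hqs x (n := n) (mod_cast le_top)).trans ?_
      calc _ ≤ ∑ i ∈ Finset.range (n + 1),
              (n.choose i : ℝ) * ((C * p x) * (‖Λ‖ * (2 ^ n * C * 2))) := by
            refine Finset.sum_le_sum fun i hi => ?_
            have hi' : i ≤ n := by have := Finset.mem_range.1 hi; omega
            rw [mul_assoc]
            refine mul_le_mul_of_nonneg_left ?_ (by positivity)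
            exact mul_le_mul (hC i hi' x) (hq _ (by omega) x) (norm_nonneg _)
                    (mul_nonneg hC0 (hp0 x).le)
        _ = 2 ^ n * (C * (‖Λ‖ * (2 ^ n * C * 2))) * p x := by
            rw [← Finset.sum_mul, ← Nat.cast_sum, Nat.sum_range_choose]; push_cast; ring
        _ ≤ _ := mul_le_mul_of_nonneg_right (le_max_right _ _) (hp0 x).le

lemma uniformSymbol_inv_one_add_norm_sq {ι : Type*} :
    UniformSymbol (fun x : H => (1 + ‖x‖ ^ 2)⁻¹)
      (fun (_ : ι) (x : H) => (((1 + ‖x‖ ^ 2)⁻¹ : ℝ) : ℂ)) := by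
  refine UniformSymbol.of_bound (fun z => by positivity)
    (fun _ => Complex.ofRealCLM.contDiff.comp contDiff_inv_one_add_norm_sq) fun j => ?_
  obtain ⟨C, -, hC⟩ := norm_iteratedFDeriv_inv_one_add_norm_sq_le (H := H) j
  refine ⟨‖Complex.ofRealCLM‖ * C, fun _ x => ?_⟩
  refine (Complex.ofRealCLM.norm_iteratedFDeriv_comp_left (f := fun x : H => (1 + ‖x‖ ^ 2)⁻¹)
    contDiff_inv_one_add_norm_sq.contDiffAt (n := j) (mod_cast le_top)).trans ?_
  rw [mul_assoc]
  exact mul_le_mul_of_nonneg_left (hC j le_rfl x) (norm_nonneg _)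

lemma uniformSymbol_clm {ι : Type*} (Λ : H →L[ℝ] ℂ) :
    UniformSymbol (fun x : H => 1 + ‖x‖) (fun (_ : ι) (x : H) => Λ x) := by
  refine UniformSymbol.of_bound (fun z => by positivity) (fun _ => Λ.contDiff) fun j => ?_
  refine ⟨‖Λ‖, fun _ x => ?_⟩
  refine (Λ.norm_iteratedFDeriv_comp_left (f := fun x : H => x)
    contDiff_id.contDiffAt (n := j) (N := ∞) (mod_cast le_top)).trans ?_
  exact mul_le_mul_of_nonneg_left (norm_iteratedFDeriv_id_le j x) (norm_nonneg _)

end Bracket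

/-! ### Weyl quantization on ℝⁿ: algebra and integration by parts. -/

/-- Euclidean space `ℝⁿ`. -/
abbrev Euc (n : ℕ) : Type := EuclideanSpace ℝ (Fin n)

/-- The weight `(1 + |x|) ^ M (1 + |ξ|) ^ L` on `T^*ℝⁿ`. -/
noncomputable def pairWeight {n : ℕ} (M : ℕ) (L : ℤ) (z : Euc n × Euc n) : ℝ :=
  (1 + ‖z.1‖) ^ M * (1 + ‖z.2‖) ^ L

/-- The semiclassical Weyl quantization of a function on `T^*ℝⁿ`. -/
noncomputable def weylPair {n : ℕ} (h : ℝ) (b : Euc n × Euc n → ℂ) (v : Euc n → ℂ) (x : Euc n) : ℂ :=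
  weylRn h (fun y ξ => b (y, ξ)) v x

/-- The inner integral in the definition of the Weyl quantization. -/
noncomputable def weylInner {n : ℕ} (h : ℝ) (b : Euc n × Euc n → ℂ) (v : Euc n → ℂ)
    (x ξ : Euc n) : ℂ :=
  ∫ y : Euc n, Complex.exp (Complex.I * ((inner ℝ (x - y) ξ / h : ℝ) : ℂ)) *
    b ((1 / 2 : ℝ) • (x + y), ξ) * v y

section
variable {n : ℕ}

lemma weylPair_eq (h : ℝ) (b : Euc n × Euc n → ℂ) (v : Euc n → ℂ) (x : Euc n) :
    weylPair h b v x = ((((2 * Real.pi * h) ^ n)⁻¹ : ℝ) : ℂ) * ∫ ξ, weylInner h b v x ξ := rfl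

lemma pairWeight_nonneg (M : ℕ) (L : ℤ) (z : Euc n × Euc n) : 0 ≤ pairWeight M L z := by
  unfold pairWeight; positivity

lemma pairWeight_le (M : ℕ) (L : ℤ) (z : Euc n × Euc n) :
    pairWeight M L z ≤ (1 + ‖z‖) ^ (M + L.toNat) := by
  unfold pairWeight
  rw [pow_add]
  have h1 : ‖z.1‖ ≤ ‖z‖ := norm_fst_le z
  have h2 : ‖z.2‖ ≤ ‖z‖ := norm_snd_le z
  have h3 : (1 + ‖z.2‖) ^ L ≤ (1 + ‖z‖) ^ L.toNat := by
    calc (1 + ‖z.2‖) ^ L ≤ (1 + ‖z.2‖) ^ (L.toNat : ℤ) :=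
          zpow_le_zpow_right₀ (by linarith [norm_nonneg z.2]) (Int.self_le_toNat L)
      _ = (1 + ‖z.2‖) ^ L.toNat := zpow_natCast _ _
      _ ≤ _ := by gcongr
  gcongr

lemma UniformSymbol.pair_temperate {ι : Type*} {M : ℕ} {L : ℤ} {b : ι → Euc n × Euc n → ℂ}
    (h : UniformSymbol (pairWeight M L) b) (i : ι) : (b i).HasTemperateGrowth :=
  h.hasTemperateGrowth (M + L.toNat) 1 (fun z => by rw [one_mul]; exact pairWeight_le M L z) i

lemma midpoint_slice_temperate {b : Euc n × Euc n → ℂ} (hb : b.HasTemperateGrowth) (x ξ : Euc n) :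
    (fun y : Euc n => b ((1 / 2 : ℝ) • (x + y), ξ)).HasTemperateGrowth := by
  have h1 : (fun y : Euc n => ((1 / 2 : ℝ) • (x + y), ξ)) = fun y =>
      ((1 / 2 : ℝ) • x, ξ) + ((1 / 2 : ℝ) • ContinuousLinearMap.inl ℝ (Euc n) (Euc n)) y := by
    ext1 y
    simp [smul_add]
  have h2 : (fun y : Euc n => ((1 / 2 : ℝ) • (x + y), ξ)).HasTemperateGrowth := by
    rw [h1]; fun_prop
  exact hb.comp h2

/-- The Schwartz function `y ↦ b ((x + y) / 2, ξ) v y`. -/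
noncomputable def midpointSlice (b : Euc n × Euc n → ℂ) (v : 𝓢(Euc n, ℂ)) (x ξ : Euc n) :
    𝓢(Euc n, ℂ) :=
  SchwartzMap.smulLeftCLM ℂ (fun y : Euc n => b ((1 / 2 : ℝ) • (x + y), ξ)) v

lemma midpointSlice_apply {b : Euc n × Euc n → ℂ} (hb : b.HasTemperateGrowth) (v : 𝓢(Euc n, ℂ))
    (x ξ y : Euc n) : midpointSlice b v x ξ y = b ((1 / 2 : ℝ) • (x + y), ξ) * v y := by
  rw [midpointSlice, SchwartzMap.smulLeftCLM_apply_apply (midpoint_slice_temperate hb x ξ),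
    smul_eq_mul]

lemma norm_phase (h : ℝ) (x y ξ : Euc n) :
    ‖Complex.exp (Complex.I * ((inner ℝ (x - y) ξ / h : ℝ) : ℂ))‖ = 1 := by
  rw [mul_comm, Complex.norm_exp_ofReal_mul_I]

lemma continuous_phase (h : ℝ) (x ξ : Euc n) : Continuous fun y : Euc n =>
    Complex.exp (Complex.I * ((inner ℝ (x - y) ξ / h : ℝ) : ℂ)) := by fun_prop

lemma integrable_phase_mul (h : ℝ) (x ξ : Euc n) (φ : 𝓢(Euc n, ℂ)) :
    Integrable fun y => Complex.exp (Complex.I * ((inner ℝ (x - y) ξ / h : ℝ) : ℂ)) * φ y := by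
  refine (φ.integrable (μ := volume)).mono
    ((continuous_phase h x ξ).mul φ.continuous).aestronglyMeasurable
    (Filter.Eventually.of_forall fun y => ?_)
  rw [norm_mul, norm_phase, one_mul]

lemma weylInner_eq {b : Euc n × Euc n → ℂ} (hb : b.HasTemperateGrowth) (h : ℝ)
    (v : 𝓢(Euc n, ℂ)) (x ξ : Euc n) :
    weylInner h b v x ξ = ∫ y, Complex.exp (Complex.I * ((inner ℝ (x - y) ξ / h : ℝ) : ℂ)) *
      midpointSlice b v x ξ y := by
  simp only [weylInner, midpointSlice_apply hb, mul_assoc]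

lemma weylInner_integrable {b : Euc n × Euc n → ℂ} (hb : b.HasTemperateGrowth) (h : ℝ)
    (v : 𝓢(Euc n, ℂ)) (x ξ : Euc n) :
    Integrable fun y : Euc n => Complex.exp (Complex.I * ((inner ℝ (x - y) ξ / h : ℝ) : ℂ)) *
      b ((1 / 2 : ℝ) • (x + y), ξ) * v y := by
  simpa only [midpointSlice_apply hb, mul_assoc] using
    integrable_phase_mul h x ξ (midpointSlice b v x ξ)

lemma weylInner_add_left {b b' : Euc n × Euc n → ℂ} (hb : b.HasTemperateGrowth)
    (hb' : b'.HasTemperateGrowth) (h : ℝ) (v : 𝓢(Euc n, ℂ)) (x ξ : Euc n) :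
    weylInner h (fun z => b z + b' z) v x ξ = weylInner h b v x ξ + weylInner h b' v x ξ := by
  unfold weylInner
  rw [← integral_add (weylInner_integrable hb h v x ξ) (weylInner_integrable hb' h v x ξ)]
  congr 1 with y
  ring

lemma weylInner_add_right {b : Euc n × Euc n → ℂ} (hb : b.HasTemperateGrowth)
    (h : ℝ) (v v' : 𝓢(Euc n, ℂ)) (x ξ : Euc n) :
    weylInner h b (fun y => v y + v' y) x ξ = weylInner h b v x ξ + weylInner h b v' x ξ := by
  unfold weylInner
  rw [← integral_add (weylInner_integrable hb h v x ξ) (weylInner_integrable hb h v' x ξ)]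
  congr 1 with y
  ring

lemma weylInner_smul_left (c : ℂ) (b : Euc n × Euc n → ℂ) (h : ℝ) (v : Euc n → ℂ) (x ξ : Euc n) :
    weylInner h (fun z => c * b z) v x ξ = c * weylInner h b v x ξ := by
  unfold weylInner
  rw [← integral_const_mul]
  congr 1 with y
  ring

lemma weylInner_smul_right (c : ℂ) (b : Euc n × Euc n → ℂ) (h : ℝ) (v : Euc n → ℂ) (x ξ : Euc n) :
    weylInner h b (fun y => c * v y) x ξ = c * weylInner h b v x ξ := by
  unfold weylInner
  rw [← integral_const_mul]
  congr 1 with y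
  ring

lemma hasFDerivAt_midpointSlice {b : Euc n × Euc n → ℂ} (hb : b.HasTemperateGrowth)
    (v : 𝓢(Euc n, ℂ)) (x ξ y e : Euc n) :
    fderiv ℝ (midpointSlice b v x ξ) y e =
      (1 / 2 : ℂ) * (fderiv ℝ b ((1 / 2 : ℝ) • (x + y), ξ) (e, 0) * v y) +
        b ((1 / 2 : ℝ) • (x + y), ξ) * (∂_{e} v) y := by
  have h0 : (midpointSlice b v x ξ : Euc n → ℂ) =
      fun y => b ((1 / 2 : ℝ) • (x + y), ξ) * v y := by
    ext1 y; exact midpointSlice_apply hb v x ξ y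
  have h0' : HasFDerivAt (fun y : Euc n => x + y) (ContinuousLinearMap.id ℝ (Euc n)) y :=
    (hasFDerivAt_id y).const_add x
  have h1 : HasFDerivAt (fun y : Euc n => ((1 / 2 : ℝ) • (x + y), ξ))
      (((1 / 2 : ℝ) • ContinuousLinearMap.id ℝ (Euc n)).prod 0) y :=
    (h0'.const_smul (1 / 2 : ℝ)).prodMk (hasFDerivAt_const ξ y)
  have h2 : HasFDerivAt b (fderiv ℝ b ((1 / 2 : ℝ) • (x + y), ξ)) ((1 / 2 : ℝ) • (x + y), ξ) :=
    (hb.1.differentiable (by simp) _).hasFDerivAt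
  have h2' : HasFDerivAt (fun y : Euc n => b ((1 / 2 : ℝ) • (x + y), ξ)) _ y := h2.comp y h1
  have hv : HasFDerivAt v (fderiv ℝ v y) y := v.differentiableAt.hasFDerivAt
  have h3 := h2'.mul hv
  have h4 := (show fderiv ℝ (midpointSlice b v x ξ) y =
    fderiv ℝ (fun y => b ((1 / 2 : ℝ) • (x + y), ξ) * v y) y by rw [h0]).trans h3.fderiv
  rw [h4, SchwartzMap.lineDerivOp_apply_eq_fderiv]
  have h5 : (((1 / 2 : ℝ) • e, (0 : Euc n)) : Euc n × Euc n) = (1 / 2 : ℝ) • (e, 0) := by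
    simp
  simp only [add_apply, smul_apply,
    ContinuousLinearMap.comp_apply, ContinuousLinearMap.prod_apply, ContinuousLinearMap.id_apply,
    zero_apply, h5, map_smul, smul_eq_mul, Complex.real_smul]
  push_cast
  ring

lemma HasTemperateGrowth.fderiv_apply {V : Type*} [NormedAddCommGroup V] [NormedSpace ℝ V]
    {b : V → ℂ} (hb : b.HasTemperateGrowth) (e : V) :
    (fun z => fderiv ℝ b z e).HasTemperateGrowth := by
  refine ⟨(hb.1.fderiv_right (by simp)).clm_apply contDiff_const, fun j => ?_⟩
  obtain ⟨k, C, hC⟩ := hb.2 (j + 1)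
  refine ⟨k, ‖e‖ * C, fun z => ?_⟩
  refine (norm_iteratedFDeriv_clm_apply_const (hb.1.fderiv_right (m := ∞)
    (by simp)).contDiffAt (n := j) (mod_cast le_top)).trans ?_
  rw [norm_iteratedFDeriv_fderiv, mul_assoc]
  exact mul_le_mul_of_nonneg_left (hC z) (norm_nonneg _)

/-- Integration by parts in the inner integral. -/
lemma inner_mul_weylInner {b : Euc n × Euc n → ℂ} (hb : b.HasTemperateGrowth) {h : ℝ} (hh : h ≠ 0)
    (v : 𝓢(Euc n, ℂ)) (x ξ e : Euc n) :
    ((inner ℝ e ξ : ℝ) : ℂ) * weylInner h b v x ξ =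
      -(Complex.I * h) * weylInner h b (∂_{e} v : 𝓢(Euc n, ℂ)) x ξ -
        (Complex.I * h / 2) * weylInner h (fun z => fderiv ℝ b z (e, 0)) v x ξ := by
  have hb' := HasTemperateGrowth.fderiv_apply hb (e, 0)
  have hfe' : ∀ y, HasFDerivAt (fun y : Euc n =>
      Complex.exp (Complex.I * ((inner ℝ (x - y) ξ / h : ℝ) : ℂ)))
      (Complex.exp (Complex.I * ((inner ℝ (x - y) ξ / h : ℝ) : ℂ)) •
        (Complex.I • (Complex.ofRealCLM.comp (h⁻¹ • (-(innerSL ℝ ξ)))))) y := by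
    intro y
    have h1 : HasFDerivAt (fun y : Euc n => inner ℝ (x - y) ξ / h)
        (h⁻¹ • (-(innerSL ℝ ξ))) y := by
      have : (fun y : Euc n => inner ℝ (x - y) ξ / h) =
          fun y => h⁻¹ • (innerSL ℝ ξ (x - y)) := by
        ext1 y; rw [innerSL_apply_apply, real_inner_comm, smul_eq_mul]; ring
      rw [this]
      have h2 : HasFDerivAt (fun y : Euc n => x - y) (-ContinuousLinearMap.id ℝ (Euc n)) y :=
        (hasFDerivAt_id y).const_sub x
      have h3 : HasFDerivAt (fun y : Euc n => innerSL ℝ ξ (x - y)) (-(innerSL ℝ ξ)) y := by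
        exact (((innerSL ℝ ξ).hasFDerivAt (x := x - y)).comp y h2).congr_fderiv (by ext; simp)
      exact h3.const_smul h⁻¹
    exact ((Complex.ofRealCLM.hasFDerivAt.comp y h1).const_mul Complex.I).cexp
  have hfe : ∀ y, fderiv ℝ (fun y : Euc n =>
      Complex.exp (Complex.I * ((inner ℝ (x - y) ξ / h : ℝ) : ℂ))) y e =
      -(Complex.I * (inner ℝ e ξ : ℝ) / h) *
        Complex.exp (Complex.I * ((inner ℝ (x - y) ξ / h : ℝ) : ℂ)) := by
    intro y
    rw [(hfe' y).fderiv]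
    simp only [smul_apply, ContinuousLinearMap.comp_apply,
      neg_apply, innerSL_apply_apply, Complex.ofRealCLM_apply,
      smul_eq_mul, real_inner_comm e ξ]
    push_cast
    ring
  -- Differentiating the phase along e produces -i ⟨e, ξ⟩ / h, so the momentum factor is traded for
  -- a derivative of y ↦ b ((x + y) / 2, ξ) v y. The midpoint is the source of the extra 1/2 in
  -- front of the derivative of b.
  have key := integral_mul_fderiv_eq_neg_fderiv_mul_of_integrable (μ := (volume : Measure (Euc n)))
    (f := fun y : Euc n => Complex.exp (Complex.I * ((inner ℝ (x - y) ξ / h : ℝ) : ℂ)))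
    (g := midpointSlice b v x ξ) (v := e)
    (by
      simp only [hfe, mul_assoc]
      exact (integrable_phase_mul h x ξ _).const_mul _)
    (by
      simpa only [SchwartzMap.lineDerivOp_apply_eq_fderiv] using
        integrable_phase_mul h x ξ (∂_{e} (midpointSlice b v x ξ)))
    (integrable_phase_mul h x ξ _)
    (fun y _ => (hfe' y).differentiableAt) (fun y _ => (midpointSlice b v x ξ).differentiableAt)
  simp only [hfe, mul_assoc] at key
  rw [integral_const_mul, ← weylInner_eq hb] at key
  have lhs : (∫ y, Complex.exp (Complex.I * ((inner ℝ (x - y) ξ / h : ℝ) : ℂ)) *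
      fderiv ℝ (midpointSlice b v x ξ) y e) =
      (1 / 2 : ℂ) * weylInner h (fun z => fderiv ℝ b z (e, 0)) v x ξ +
        weylInner h b (∂_{e} v : 𝓢(Euc n, ℂ)) x ξ := by
    unfold weylInner
    rw [← integral_const_mul, ← integral_add ((weylInner_integrable hb' h v x ξ).const_mul _)
      (weylInner_integrable hb h _ x ξ)]
    congr 1 with y
    rw [hasFDerivAt_midpointSlice hb]
    ring
  rw [lhs] at key
  have hh' : (h : ℂ) ≠ 0 := by exact_mod_cast hh
  have hI : Complex.I * Complex.I = -1 := Complex.I_mul_I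
  field_simp at key
  linear_combination (Complex.I / 2) * key + ((inner ℝ e ξ : ℝ) : ℂ) * weylInner h b v x ξ * hI

end

/-! ### Convergence of the quantization integrals. -/

section
variable {n : ℕ}

lemma integrable_one_add_norm_pow_mul (v : 𝓢(Euc n, ℂ)) (M : ℕ) :
    Integrable fun y : Euc n => (1 + ‖y‖) ^ M * ‖v y‖ := by
  have : (fun y : Euc n => (1 + ‖y‖) ^ M * ‖v y‖) =
      fun y => ∑ k ∈ Finset.range (M + 1), (M.choose k : ℝ) * (‖y‖ ^ k * ‖v y‖) := by
    ext1 y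
    rw [add_comm, add_pow, Finset.sum_mul]
    refine Finset.sum_congr rfl fun k _ => ?_
    rw [one_pow]; ring
  rw [this]
  exact integrable_finsetSum _ fun k _ => (v.integrable_pow_mul volume k).const_mul _

lemma one_add_norm_midpoint_le (x y : Euc n) :
    1 + ‖(1 / 2 : ℝ) • (x + y)‖ ≤ (1 + ‖x‖) * (1 + ‖y‖) := by
  have h1 : ‖(1 / 2 : ℝ) • (x + y)‖ ≤ 1 / 2 * (‖x‖ + ‖y‖) := by
    rw [norm_smul, Real.norm_of_nonneg (by norm_num)]
    exact mul_le_mul_of_nonneg_left (norm_add_le _ _) (by norm_num)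
  nlinarith [norm_nonneg x, norm_nonneg y, mul_nonneg (norm_nonneg x) (norm_nonneg y)]

lemma pairWeight_midpoint_le (M : ℕ) (L : ℤ) (x y ξ : Euc n) :
    pairWeight M L ((1 / 2 : ℝ) • (x + y), ξ) ≤
      (1 + ‖x‖) ^ M * (1 + ‖y‖) ^ M * (1 + ‖ξ‖) ^ L := by
  unfold pairWeight
  rw [← mul_pow]
  have := one_add_norm_midpoint_le x y
  gcongr

lemma norm_integrand_le {ι : Type*} {M : ℕ} {L : ℤ} {b : ι → Euc n × Euc n → ℂ} {C : ℝ}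
    (hC0 : 0 ≤ C) (hC : ∀ i z, ‖b i z‖ ≤ C * pairWeight M L z) (v : Euc n → ℂ) (h : ℝ) (i : ι)
    (x ξ y : Euc n) :
    ‖Complex.exp (Complex.I * ((inner ℝ (x - y) ξ / h : ℝ) : ℂ)) *
      b i ((1 / 2 : ℝ) • (x + y), ξ) * v y‖ ≤
      (C * (1 + ‖x‖) ^ M * (1 + ‖ξ‖) ^ L) * ((1 + ‖y‖) ^ M * ‖v y‖) := by
  rw [norm_mul, norm_mul, norm_phase, one_mul]
  calc ‖b i ((1 / 2 : ℝ) • (x + y), ξ)‖ * ‖v y‖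
      ≤ (C * ((1 + ‖x‖) ^ M * (1 + ‖y‖) ^ M * (1 + ‖ξ‖) ^ L)) * ‖v y‖ := by
        refine mul_le_mul_of_nonneg_right ((hC i _).trans ?_) (norm_nonneg _)
        exact mul_le_mul_of_nonneg_left (pairWeight_midpoint_le M L x y ξ) hC0
    _ = _ := by ring

lemma weylInner_le {ι : Type*} {M : ℕ} {L : ℤ} {b : ι → Euc n × Euc n → ℂ}
    (hb : UniformSymbol (pairWeight M L) b) (v : 𝓢(Euc n, ℂ)) (h : ℝ) (x : Euc n) :
    ∃ C : ℝ, 0 ≤ C ∧ ∀ i ξ, ‖weylInner h (b i) v x ξ‖ ≤ C * (1 + ‖ξ‖) ^ L := by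
  obtain ⟨C, hC0, hC⟩ := hb.norm_le
  refine ⟨C * (1 + ‖x‖) ^ M * ∫ y : Euc n, (1 + ‖y‖) ^ M * ‖v y‖, ?_, fun i ξ => ?_⟩
  · have : 0 ≤ ∫ y : Euc n, (1 + ‖y‖) ^ M * ‖v y‖ := integral_nonneg fun y => by positivity
    positivity
  · refine (norm_integral_le_integral_norm _).trans ?_
    refine (integral_mono (weylInner_integrable (hb.pair_temperate i) h v x ξ).norm
      ((integrable_one_add_norm_pow_mul v M).const_mul
        (C * (1 + ‖x‖) ^ M * (1 + ‖ξ‖) ^ L))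
      (fun y => norm_integrand_le hC0 hC v h i x ξ y)).trans (le_of_eq ?_)
    rw [integral_const_mul]
    ring

lemma one_add_norm_le_sum (ξ : Euc n) :
    1 + ‖ξ‖ ≤ 1 + ∑ j, |inner ℝ (EuclideanSpace.single j (1 : ℝ)) ξ| := by
  have h1 : ξ = ∑ j, (inner ℝ (EuclideanSpace.single j (1 : ℝ)) ξ) •
      (EuclideanSpace.single j (1 : ℝ) : Euc n) := by
    ext i
    simp [EuclideanSpace.inner_single_left, Pi.single_apply]
  have h2 : ‖ξ‖ ≤ ∑ j, |inner ℝ (EuclideanSpace.single j (1 : ℝ)) ξ| := by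
    conv_lhs => rw [h1]
    refine (norm_sum_le _ _).trans (Finset.sum_le_sum fun j _ => ?_)
    rw [norm_smul]
    simp
  linarith

/-- Rapid decay of the inner integral of the Weyl quantization, uniformly in a family. -/
lemma weylInner_decay_aux {ι : Type*} {M : ℕ} {L : ℤ} {h : ℝ} (hh : h ≠ 0) (x : Euc n) (K : ℕ) :
    ∀ (b : ι → Euc n × Euc n → ℂ) (_ : UniformSymbol (pairWeight M L) b) (v : 𝓢(Euc n, ℂ)),
    ∃ C : ℝ, 0 ≤ C ∧ ∀ i ξ,
      (1 + ‖ξ‖) ^ K * ‖weylInner h (b i) v x ξ‖ ≤ C * (1 + ‖ξ‖) ^ L := by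
  induction K with
  | zero => intro b hb v; simpa using weylInner_le hb v h x
  | succ K ih =>
    intro b hb v
    let e : Fin n → Euc n := fun j => EuclideanSpace.single j (1 : ℝ)
    obtain ⟨C, hC0, hC⟩ := ih b hb v
    -- One more power of ξ costs one derivative of v or of b in position. This is why the induction
    -- quantifies over b and v; the weight does not change.
    have h1 := fun j => ih b hb (∂_{e j} v)
    have h2 := fun j => ih _ (hb.fderiv_apply (e j, (0 : Euc n))) v
    choose C1 hC10 hC1 using h1
    choose C2 hC20 hC2 using h2
    refine ⟨C + ∑ j, |h| * (C1 j + C2 j), ?_, fun i ξ => ?_⟩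
    · exact add_nonneg hC0 (Finset.sum_nonneg fun j _ =>
        mul_nonneg (abs_nonneg _) (add_nonneg (hC10 j) (hC20 j)))
    · set F := weylInner h (b i) v x ξ with hF
      have hP : 0 ≤ (1 + ‖ξ‖) ^ K := by positivity
      have key : ∀ j, (1 + ‖ξ‖) ^ K * (|inner ℝ (e j) ξ| * ‖F‖) ≤
          |h| * (C1 j + C2 j) * (1 + ‖ξ‖) ^ L := by
        intro j
        have h3 := inner_mul_weylInner (hb.pair_temperate i) hh v x ξ (e j)
        have h4 : |inner ℝ (e j) ξ| * ‖F‖ ≤ |h| * ‖weylInner h (b i) (∂_{e j} v : 𝓢(Euc n, ℂ)) x ξ‖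
            + |h| * ‖weylInner h (fun z => fderiv ℝ (b i) z (e j, 0)) v x ξ‖ := by
          have : ‖((inner ℝ (e j) ξ : ℝ) : ℂ) * F‖ = |inner ℝ (e j) ξ| * ‖F‖ := by
            rw [norm_mul, Complex.norm_real, Real.norm_eq_abs]
          rw [← this, h3]
          refine (norm_sub_le _ _).trans ?_
          rw [norm_mul, norm_mul, norm_neg, norm_div, norm_mul, Complex.norm_I,
            Complex.norm_real, Real.norm_eq_abs, one_mul, Complex.norm_ofNat]
          have : |h| / 2 ≤ |h| := by linarith [abs_nonneg h]
          gcongr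
        have h5 := hC1 j i ξ
        have h6 := hC2 j i ξ
        calc _ ≤ (1 + ‖ξ‖) ^ K * (|h| * ‖weylInner h (b i) (∂_{e j} v : 𝓢(Euc n, ℂ)) x ξ‖
            + |h| * ‖weylInner h (fun z => fderiv ℝ (b i) z (e j, 0)) v x ξ‖) :=
              mul_le_mul_of_nonneg_left h4 hP
          _ = |h| * ((1 + ‖ξ‖) ^ K * ‖weylInner h (b i) (∂_{e j} v : 𝓢(Euc n, ℂ)) x ξ‖ +
              (1 + ‖ξ‖) ^ K * ‖weylInner h (fun z => fderiv ℝ (b i) z (e j, 0)) v x ξ‖) := by ring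
          _ ≤ |h| * (C1 j * (1 + ‖ξ‖) ^ L + C2 j * (1 + ‖ξ‖) ^ L) :=
              mul_le_mul_of_nonneg_left (add_le_add h5 h6) (abs_nonneg _)
          _ = _ := by ring
      calc (1 + ‖ξ‖) ^ (K + 1) * ‖F‖ = (1 + ‖ξ‖) ^ K * ((1 + ‖ξ‖) * ‖F‖) := by ring
        _ ≤ (1 + ‖ξ‖) ^ K * ((1 + ∑ j, |inner ℝ (e j) ξ|) * ‖F‖) := by
            have := one_add_norm_le_sum ξ
            gcongr
        _ = (1 + ‖ξ‖) ^ K * ‖F‖ + ∑ j, (1 + ‖ξ‖) ^ K * (|inner ℝ (e j) ξ| * ‖F‖) := by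
            rw [add_mul, Finset.sum_mul, mul_add, Finset.mul_sum, one_mul]
        _ ≤ C * (1 + ‖ξ‖) ^ L + ∑ j, |h| * (C1 j + C2 j) * (1 + ‖ξ‖) ^ L :=
            add_le_add (hC i ξ) (Finset.sum_le_sum fun j _ => key j)
        _ = _ := by rw [add_mul, Finset.sum_mul]

/-- The order L is absorbed by asking for `L.toNat` further powers of decay. Hence the outer
integral converges absolutely for symbols of any order, with bounds uniform in the family. -/
lemma weylInner_decay {ι : Type*} {M : ℕ} {L : ℤ} {h : ℝ} (hh : h ≠ 0)
    {b : ι → Euc n × Euc n → ℂ} (hb : UniformSymbol (pairWeight M L) b) (v : 𝓢(Euc n, ℂ))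
    (x : Euc n) (K : ℕ) :
    ∃ C : ℝ, 0 ≤ C ∧ ∀ i ξ, ‖weylInner h (b i) v x ξ‖ ≤ C * (1 + ‖ξ‖) ^ (-(K : ℤ)) := by
  obtain ⟨C, hC0, hC⟩ := weylInner_decay_aux hh x (K + L.toNat) b hb v
  refine ⟨C, hC0, fun i ξ => ?_⟩
  have h1 : (0 : ℝ) < 1 + ‖ξ‖ := by positivity
  have h2 := hC i ξ
  have h3 : (1 + ‖ξ‖) ^ L ≤ (1 + ‖ξ‖) ^ L.toNat := by
    rw [← zpow_natCast]
    exact zpow_le_zpow_right₀ (by linarith [norm_nonneg ξ]) (Int.self_le_toNat L)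
  rw [zpow_neg, zpow_natCast, ← div_eq_mul_inv, le_div_iff₀ (by positivity)]
  have h4 : (1 + ‖ξ‖) ^ L.toNat * (‖weylInner h (b i) v x ξ‖ * (1 + ‖ξ‖) ^ K) ≤
      (1 + ‖ξ‖) ^ L.toNat * C := by
    calc _ = (1 + ‖ξ‖) ^ (K + L.toNat) * ‖weylInner h (b i) v x ξ‖ := by rw [pow_add]; ring
      _ ≤ C * (1 + ‖ξ‖) ^ L := h2
      _ ≤ C * (1 + ‖ξ‖) ^ L.toNat := mul_le_mul_of_nonneg_left h3 hC0
      _ = _ := mul_comm _ _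
  exact le_of_mul_le_mul_left h4 (by positivity)

lemma integrable_one_add_norm_zpow :
    Integrable fun ξ : Euc n => (1 + ‖ξ‖) ^ (-((n + 1 : ℕ) : ℤ)) := by
  have := integrable_one_add_norm (E := Euc n) (μ := volume) (r := (n : ℝ) + 1) (by simp)
  refine this.congr (Filter.Eventually.of_forall fun ξ => ?_)
  simp only
  rw [← Real.rpow_intCast]
  push_cast
  rfl

lemma continuous_integrand {T : Type*} [TopologicalSpace T] {b : T → Euc n × Euc n → ℂ}
    (hb : Continuous (Function.uncurry b)) {v : Euc n → ℂ} (hv : Continuous v) (h : ℝ) :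
    Continuous fun p : ((T × Euc n) × Euc n) × Euc n =>
      Complex.exp (Complex.I * ((inner ℝ (p.1.1.2 - p.2) p.1.2 / h : ℝ) : ℂ)) *
        b p.1.1.1 ((1 / 2 : ℝ) • (p.1.1.2 + p.2), p.1.2) * v p.2 := by
  have h1 : Continuous fun p : ((T × Euc n) × Euc n) × Euc n =>
      b p.1.1.1 ((1 / 2 : ℝ) • (p.1.1.2 + p.2), p.1.2) :=
    hb.comp (f := fun p : ((T × Euc n) × Euc n) × Euc n =>
      (p.1.1.1, ((1 / 2 : ℝ) • (p.1.1.2 + p.2), p.1.2))) (by fun_prop)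
  have h2 : Continuous fun p : ((T × Euc n) × Euc n) × Euc n => v p.2 := hv.comp continuous_snd
  fun_prop

lemma stronglyMeasurable_weylInner {T : Type*} [TopologicalSpace T] [MeasurableSpace T]
    [OpensMeasurableSpace T] [SecondCountableTopology T] {b : T → Euc n × Euc n → ℂ}
    (hb : Continuous (Function.uncurry b)) {v : Euc n → ℂ} (hv : Continuous v) (h : ℝ) :
    StronglyMeasurable fun p : (T × Euc n) × Euc n => weylInner h (b p.1.1) v p.1.2 p.2 :=
  (continuous_integrand hb hv h).stronglyMeasurable.integral_prod_right'

lemma stronglyMeasurable_weylPair {T : Type*} [TopologicalSpace T] [MeasurableSpace T]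
    [OpensMeasurableSpace T] [SecondCountableTopology T] {b : T → Euc n × Euc n → ℂ}
    (hb : Continuous (Function.uncurry b)) {v : Euc n → ℂ} (hv : Continuous v) (h : ℝ) :
    StronglyMeasurable fun p : T × Euc n => weylPair h (b p.1) v p.2 :=
  (stronglyMeasurable_weylInner hb hv h).integral_prod_right'.const_mul _

lemma stronglyMeasurable_weylPair_right {b : Euc n × Euc n → ℂ}
    (hb : Continuous b) {v : Euc n → ℂ} (hv : Continuous v) (h : ℝ) :
    StronglyMeasurable (weylPair h b v) := by
  have := stronglyMeasurable_weylPair (T := Unit) (b := fun _ => b)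
    (hb.comp continuous_snd) hv h
  exact this.comp_measurable (g := fun x => ((), x)) (by fun_prop)

lemma stronglyMeasurable_weylInner_right {b : Euc n × Euc n → ℂ}
    (hb : Continuous b) {v : Euc n → ℂ} (hv : Continuous v) (h : ℝ) (x : Euc n) :
    StronglyMeasurable (weylInner h b v x) := by
  have := stronglyMeasurable_weylInner (T := Unit) (b := fun _ => b)
    (hb.comp continuous_snd) hv h
  exact this.comp_measurable (g := fun ξ => (((), x), ξ)) (by fun_prop)

lemma integrable_weylInner {ι : Type*} {M : ℕ} {L : ℤ} {h : ℝ} (hh : h ≠ 0)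
    {b : ι → Euc n × Euc n → ℂ} (hb : UniformSymbol (pairWeight M L) b) (v : 𝓢(Euc n, ℂ))
    (x : Euc n) (i : ι) : Integrable (weylInner h (b i) v x) := by
  obtain ⟨C, -, hC⟩ := weylInner_decay hh hb v x (n + 1)
  refine (integrable_one_add_norm_zpow.const_mul C).mono'
    (stronglyMeasurable_weylInner_right (hb.smooth i).continuous
      v.continuous h x).aestronglyMeasurable
    (Filter.Eventually.of_forall fun ξ => hC i ξ)

lemma weylPair_bounded {ι : Type*} {M : ℕ} {L : ℤ} {h : ℝ} (hh : h ≠ 0)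
    {b : ι → Euc n × Euc n → ℂ} (hb : UniformSymbol (pairWeight M L) b) (v : 𝓢(Euc n, ℂ))
    (x : Euc n) : ∃ C : ℝ, 0 ≤ C ∧ ∀ i, ‖weylPair h (b i) v x‖ ≤ C := by
  obtain ⟨C, hC0, hC⟩ := weylInner_decay hh hb v x (n + 1)
  refine ⟨‖((((2 * Real.pi * h) ^ n)⁻¹ : ℝ) : ℂ)‖ *
    ∫ ξ : Euc n, C * (1 + ‖ξ‖) ^ (-((n + 1 : ℕ) : ℤ)), ?_, fun i => ?_⟩
  · exact mul_nonneg (norm_nonneg _) (integral_nonneg fun ξ => by positivity)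
  · rw [weylPair_eq, norm_mul]
    refine mul_le_mul_of_nonneg_left ?_ (norm_nonneg _)
    exact norm_integral_le_of_norm_le (integrable_one_add_norm_zpow.const_mul C)
      (Filter.Eventually.of_forall fun ξ => hC i ξ)

lemma weylPair_add_left {ι : Type*} {M : ℕ} {L : ℤ} {h : ℝ} (hh : h ≠ 0)
    {b b' : ι → Euc n × Euc n → ℂ} (hb : UniformSymbol (pairWeight M L) b)
    (hb' : UniformSymbol (pairWeight M L) b') (v : 𝓢(Euc n, ℂ)) (x : Euc n) (i : ι) :
    weylPair h (fun z => b i z + b' i z) v x = weylPair h (b i) v x + weylPair h (b' i) v x := by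
  simp only [weylPair_eq, weylInner_add_left (hb.pair_temperate i) (hb'.pair_temperate i)]
  rw [integral_add (integrable_weylInner hh hb v x i) (integrable_weylInner hh hb' v x i)]
  ring

lemma weylPair_add_right {ι : Type*} {M : ℕ} {L : ℤ} {h : ℝ} (hh : h ≠ 0)
    {b : ι → Euc n × Euc n → ℂ} (hb : UniformSymbol (pairWeight M L) b)
    (v v' : 𝓢(Euc n, ℂ)) (x : Euc n) (i : ι) :
    weylPair h (b i) (fun y => v y + v' y) x =
      weylPair h (b i) v x + weylPair h (b i) v' x := by
  simp only [weylPair_eq, weylInner_add_right (hb.pair_temperate i)]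
  rw [integral_add (integrable_weylInner hh hb v x i) (integrable_weylInner hh hb v' x i)]
  ring

lemma weylPair_smul_left (c : ℂ) (b : Euc n × Euc n → ℂ) (h : ℝ) (v : Euc n → ℂ) (x : Euc n) :
    weylPair h (fun z => c * b z) v x = c * weylPair h b v x := by
  simp only [weylPair_eq, weylInner_smul_left, integral_const_mul]
  ring

lemma weylPair_smul_right (c : ℂ) (b : Euc n × Euc n → ℂ) (h : ℝ) (v : Euc n → ℂ) (x : Euc n) :
    weylPair h b (fun y => c * v y) x = c * weylPair h b v x := by
  simp only [weylPair_eq, weylInner_smul_right, integral_const_mul]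
  ring

lemma weylPair_zero_left (h : ℝ) (v : Euc n → ℂ) (x : Euc n) :
    weylPair h (fun _ => 0) v x = 0 := by
  simp [weylPair_eq, weylInner]

/-- Multiplication of the symbol by a momentum, expressed through the derivative of the function. -/
lemma weylPair_inner_mul {ι : Type*} {M : ℕ} {L : ℤ} {h : ℝ} (hh : h ≠ 0)
    {b : ι → Euc n × Euc n → ℂ} (hb : UniformSymbol (pairWeight M L) b)
    (v : 𝓢(Euc n, ℂ)) (x e : Euc n) (i : ι) :
    weylPair h (fun z => ((inner ℝ e z.2 : ℝ) : ℂ) * b i z) v x =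
      -(Complex.I * h) * weylPair h (b i) (∂_{e} v : 𝓢(Euc n, ℂ)) x -
        (Complex.I * h / 2) * weylPair h (fun z => fderiv ℝ (b i) z (e, 0)) v x := by
  have h0 : ∀ ξ, weylInner h (fun z => ((inner ℝ e z.2 : ℝ) : ℂ) * b i z) v x ξ =
      ((inner ℝ e ξ : ℝ) : ℂ) * weylInner h (b i) v x ξ := by
    intro ξ
    rw [← weylInner_smul_left]
    rfl
  simp only [weylPair_eq, h0, inner_mul_weylInner (hb.pair_temperate i) hh]
  rw [integral_sub ((integrable_weylInner hh hb _ x i).const_mul _)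
    ((integrable_weylInner hh (hb.fderiv_apply (e, (0 : Euc n))) v x i).const_mul _),
    integral_const_mul, integral_const_mul]
  ring

end

/-! ### Limits, derivatives, commutators and dilations of quantizations. -/

section
variable {n : ℕ}

/-- Dominated convergence is applied to the inner and then to the outer integral. The symbol bound
dominates the first, and the uniform decay `weylInner_decay` dominates the second. -/
lemma tendsto_weylPair {M : ℕ} {L : ℤ} {h : ℝ} (hh : h ≠ 0) {b : ℕ → Euc n × Euc n → ℂ}
    (hb : UniformSymbol (pairWeight M L) b) {b' : Euc n × Euc n → ℂ}
    (hb' : ∀ z, Tendsto (fun k => b k z) atTop (𝓝 (b' z))) (v : 𝓢(Euc n, ℂ)) (x : Euc n) :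
    Tendsto (fun k => weylPair h (b k) v x) atTop (𝓝 (weylPair h b' v x)) := by
  obtain ⟨C, hC0, hC⟩ := hb.norm_le
  have h1 : ∀ ξ, Tendsto (fun k => weylInner h (b k) v x ξ) atTop
      (𝓝 (weylInner h b' v x ξ)) := by
    intro ξ
    refine tendsto_integral_of_dominated_convergence
      (fun y => (C * (1 + ‖x‖) ^ M * (1 + ‖ξ‖) ^ L) * ((1 + ‖y‖) ^ M * ‖v y‖))
      (fun k => (weylInner_integrable (hb.pair_temperate k) h v x ξ).1)
      ((integrable_one_add_norm_pow_mul v M).const_mul _)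
      (fun k => Eventually.of_forall fun y => norm_integrand_le hC0 hC v h k x ξ y)
      (Eventually.of_forall fun y => ?_)
    exact (tendsto_const_nhds.mul (hb' _)).mul tendsto_const_nhds
  obtain ⟨D, hD0, hD⟩ := weylInner_decay hh hb v x (n + 1)
  refine Tendsto.const_mul _ ?_
  exact tendsto_integral_of_dominated_convergence
    (fun ξ => D * (1 + ‖ξ‖) ^ (-((n + 1 : ℕ) : ℤ)))
    (fun k => (integrable_weylInner hh hb v x k).1)
    (integrable_one_add_norm_zpow.const_mul D)
    (fun k => Eventually.of_forall fun ξ => hD k ξ)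
    (Eventually.of_forall fun ξ => h1 ξ)

lemma hasDerivAt_weylPair {M : ℕ} {L : ℤ} {h : ℝ} (hh : h ≠ 0) {b b' : ℝ → Euc n × Euc n → ℂ}
    (hb : UniformSymbol (pairWeight M L) b) (hb' : UniformSymbol (pairWeight M L) b')
    (hd : ∀ s z, HasDerivAt (fun s => b s z) (b' s z) s) (v : 𝓢(Euc n, ℂ)) (x : Euc n) (s : ℝ) :
    HasDerivAt (fun s => weylPair h (b s) v x) (weylPair h (b' s) v x) s := by
  obtain ⟨C, hC0, hC⟩ := hb'.norm_le
  have h1 : ∀ ξ s, HasDerivAt (fun s => weylInner h (b s) v x ξ) (weylInner h (b' s) v x ξ) s := by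
    intro ξ s
    refine (hasDerivAt_integral_of_dominated_loc_of_deriv_le (s := Set.univ)
      (bound := fun y => (C * (1 + ‖x‖) ^ M * (1 + ‖ξ‖) ^ L) * ((1 + ‖y‖) ^ M * ‖v y‖))
      (F := fun s y => Complex.exp (Complex.I * ((inner ℝ (x - y) ξ / h : ℝ) : ℂ)) *
        b s ((1 / 2 : ℝ) • (x + y), ξ) * v y)
      (F' := fun s y => Complex.exp (Complex.I * ((inner ℝ (x - y) ξ / h : ℝ) : ℂ)) *
        b' s ((1 / 2 : ℝ) • (x + y), ξ) * v y)
      Filter.univ_mem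
      (Eventually.of_forall fun s => (weylInner_integrable (hb.pair_temperate s) h v x ξ).1)
      (weylInner_integrable (hb.pair_temperate s) h v x ξ)
      (weylInner_integrable (hb'.pair_temperate s) h v x ξ).1
      (Eventually.of_forall fun y s _ => norm_integrand_le hC0 hC v h s x ξ y)
      ((integrable_one_add_norm_pow_mul v M).const_mul _)
      (Eventually.of_forall fun y s _ => ?_)).2
    exact ((hd s _).const_mul _).mul_const _
  obtain ⟨D, hD0, hD⟩ := weylInner_decay hh hb' v x (n + 1)
  refine HasDerivAt.const_mul _ ?_
  exact (hasDerivAt_integral_of_dominated_loc_of_deriv_le (s := Set.univ)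
    (bound := fun ξ => D * (1 + ‖ξ‖) ^ (-((n + 1 : ℕ) : ℤ)))
    (F := fun s ξ => weylInner h (b s) v x ξ)
    (F' := fun s ξ => weylInner h (b' s) v x ξ)
    Filter.univ_mem
    (Eventually.of_forall fun s => (integrable_weylInner hh hb v x s).1)
    (integrable_weylInner hh hb v x s)
    (integrable_weylInner hh hb' v x s).1
    (Eventually.of_forall fun ξ s _ => hD s ξ)
    (integrable_one_add_norm_zpow.const_mul D)
    (Eventually.of_forall fun ξ s _ => h1 ξ s)).2

lemma integral_mul_sub_add {X : Type*} [MeasurableSpace X] {μ : Measure X} (c d : ℂ)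
    {f g k : X → ℂ} (hf : Integrable f μ) (hg : Integrable g μ) (hk : Integrable k μ) :
    ∫ y, (c * (d * f y - g y) + k y) ∂μ = c * (d * ∫ y, f y ∂μ - ∫ y, g y ∂μ) + ∫ y, k y ∂μ := by
  have h1 : Integrable (fun y => d * f y - g y) μ := (hf.const_mul d).sub hg
  rw [integral_add (h1.const_mul c) hk, integral_const_mul, integral_sub (hf.const_mul d) hg,
    integral_const_mul]

/-- Multiplication by a linear form, as an operator on Schwartz functions. -/
noncomputable def mulInner (e : Euc n) (v : 𝓢(Euc n, ℂ)) : 𝓢(Euc n, ℂ) :=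
  SchwartzMap.smulLeftCLM ℂ (fun y : Euc n => ((inner ℝ e y : ℝ) : ℂ)) v

lemma mulInner_apply (e : Euc n) (v : 𝓢(Euc n, ℂ)) (y : Euc n) :
    mulInner e v y = ((inner ℝ e y : ℝ) : ℂ) * v y := by
  rw [mulInner, SchwartzMap.smulLeftCLM_apply_apply (by fun_prop), smul_eq_mul]

/-- The derivative of the phase in ξ brings down i ⟨x - y, e⟩ / h. Its x part comes out of the
integral and its y part is absorbed into v, which produces the commutator with the coordinate. -/
lemma hasDerivAt_weylInner_momentum {M : ℕ} {L : ℤ} {h : ℝ}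
    {b : Unit → Euc n × Euc n → ℂ}
    (hb : UniformSymbol (pairWeight M L) b) (v : 𝓢(Euc n, ℂ)) (x ξ e : Euc n) :
    HasDerivAt (fun s : ℝ => weylInner h (b ()) v x (ξ + s • e))
      (Complex.I / h * (((inner ℝ e x : ℝ) : ℂ) * weylInner h (b ()) v x ξ -
        weylInner h (b ()) (mulInner e v) x ξ) +
        weylInner h (fun z => fderiv ℝ (b ()) z (0, e)) v x ξ) 0 := by
  have hb' := hb.fderiv_apply ((0 : Euc n), e)
  obtain ⟨C, hC0, hC⟩ := hb.norm_le
  obtain ⟨C', hC0', hC'⟩ := hb'.norm_le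
  set w : 𝓢(Euc n, ℂ) := mulInner e v with hw
  set G : ℝ → Euc n → ℂ := fun s y =>
    Complex.I / h * (((inner ℝ e x : ℝ) : ℂ) *
      (Complex.exp (Complex.I * ((inner ℝ (x - y) (ξ + s • e) / h : ℝ) : ℂ)) *
        b () ((1 / 2 : ℝ) • (x + y), ξ + s • e) * v y) -
      (Complex.exp (Complex.I * ((inner ℝ (x - y) (ξ + s • e) / h : ℝ) : ℂ)) *
        b () ((1 / 2 : ℝ) • (x + y), ξ + s • e) * w y)) +
      Complex.exp (Complex.I * ((inner ℝ (x - y) (ξ + s • e) / h : ℝ) : ℂ)) *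
        fderiv ℝ (b ()) ((1 / 2 : ℝ) • (x + y), ξ + s • e) (0, e) * v y with hG
  -- L may have either sign, so the bound for |s| < 1 comes from compactness rather than
  -- monotonicity.
  have hB : ∃ B : ℝ, 0 ≤ B ∧ ∀ s ∈ Metric.ball (0 : ℝ) 1, (1 + ‖ξ + s • e‖) ^ L ≤ B := by
    have hc : ContinuousOn (fun s : ℝ => (1 + ‖ξ + s • e‖) ^ L) (Metric.closedBall 0 1) := by
      refine Continuous.continuousOn ?_
      refine Continuous.zpow₀ (by fun_prop) L fun s => Or.inl (by positivity)
    obtain ⟨B, hB⟩ := (isCompact_closedBall (0 : ℝ) 1).exists_bound_of_continuousOn hc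
    refine ⟨B, (norm_nonneg _).trans (hB 0 (by simp)), fun s hs => ?_⟩
    exact (Real.le_norm_self _).trans (hB s (Metric.ball_subset_closedBall hs))
  obtain ⟨B, hB0, hB⟩ := hB
  have hint : ∀ s, Integrable (G s) := by
    intro s
    have i1 := weylInner_integrable (hb.pair_temperate ()) h v x (ξ + s • e)
    have i2 := weylInner_integrable (hb.pair_temperate ()) h w x (ξ + s • e)
    have i3 := weylInner_integrable (hb'.pair_temperate ()) h v x (ξ + s • e)
    exact (((i1.const_mul _).sub i2).const_mul _).add i3
  have key := (hasDerivAt_integral_of_dominated_loc_of_deriv_le (s := Metric.ball (0 : ℝ) 1)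
    (x₀ := (0 : ℝ)) (μ := (volume : Measure (Euc n)))
    (bound := fun y => ‖Complex.I / h‖ * (‖((inner ℝ e x : ℝ) : ℂ)‖ *
        ((C * (1 + ‖x‖) ^ M * B) * ((1 + ‖y‖) ^ M * ‖v y‖)) +
        ((C * (1 + ‖x‖) ^ M * B) * ((1 + ‖y‖) ^ M * ‖w y‖))) +
        ((C' * (1 + ‖x‖) ^ M * B) * ((1 + ‖y‖) ^ M * ‖v y‖)))
    (F := fun s y => Complex.exp (Complex.I * ((inner ℝ (x - y) (ξ + s • e) / h : ℝ) : ℂ)) *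
        b () ((1 / 2 : ℝ) • (x + y), ξ + s • e) * v y)
    (F' := G)
    (Metric.ball_mem_nhds 0 one_pos)
    (Eventually.of_forall fun s =>
      (weylInner_integrable (hb.pair_temperate ()) h v x (ξ + s • e)).1)
    (weylInner_integrable (hb.pair_temperate ()) h v x (ξ + (0 : ℝ) • e))
    (hint 0).1 ?_ ?_ ?_).2
  · refine key.congr_deriv ?_
    have i1 := weylInner_integrable (hb.pair_temperate ()) h v x ξ
    have i2 := weylInner_integrable (hb.pair_temperate ()) h w x ξ
    have i3 := weylInner_integrable (hb'.pair_temperate ()) h v x ξ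
    simp only [hG, zero_smul, add_zero]
    exact integral_mul_sub_add _ _ i1 i2 i3
  · refine Eventually.of_forall fun y s hs => ?_
    have b1 := norm_integrand_le hC0 hC v h () x (ξ + s • e) y
    have b2 := norm_integrand_le hC0 hC w h () x (ξ + s • e) y
    have b3 := norm_integrand_le hC0' hC' v h () x (ξ + s • e) y
    have c1 : ∀ (D : ℝ) (r : ℝ), 0 ≤ D → 0 ≤ r → (D * (1 + ‖x‖) ^ M * (1 + ‖ξ + s • e‖) ^ L) * r ≤
        (D * (1 + ‖x‖) ^ M * B) * r := fun D r hD hr => by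
      have := hB s hs
      gcongr
    refine (norm_add_le _ _).trans (add_le_add ?_ (b3.trans (c1 _ _ hC0' (by positivity))))
    rw [norm_mul]
    refine mul_le_mul_of_nonneg_left ((norm_sub_le _ _).trans
      (add_le_add ?_ (b2.trans (c1 _ _ hC0 (by positivity))))) (norm_nonneg _)
    rw [norm_mul]
    exact mul_le_mul_of_nonneg_left (b1.trans (c1 _ _ hC0 (by positivity))) (norm_nonneg _)
  · exact ((((integrable_one_add_norm_pow_mul v M).const_mul _).const_mul _).add
      ((integrable_one_add_norm_pow_mul w M).const_mul _)).const_mul _ |>.add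
      ((integrable_one_add_norm_pow_mul v M).const_mul _)
  · refine Eventually.of_forall fun y s _ => ?_
    have d0 : HasDerivAt (fun s : ℝ => ξ + s • e) e s := by
      simpa using ((hasDerivAt_id s).smul_const e).const_add ξ
    have d1 : HasDerivAt (fun s : ℝ => inner ℝ (x - y) (ξ + s • e) / h)
        (inner ℝ (x - y) e / h) s := by
      have := ((innerSL ℝ (x - y)).hasFDerivAt (x := ξ + s • e)).comp_hasDerivAt s d0
      exact this.div_const h
    have d2 : HasDerivAt (fun s : ℝ => Complex.exp (Complex.I *
        ((inner ℝ (x - y) (ξ + s • e) / h : ℝ) : ℂ))) _ s :=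
      (d1.ofReal_comp.const_mul Complex.I).cexp
    have d3 : HasDerivAt (fun s : ℝ => b () ((1 / 2 : ℝ) • (x + y), ξ + s • e))
        (fderiv ℝ (b ()) ((1 / 2 : ℝ) • (x + y), ξ + s • e) (0, e)) s := by
      have hbd : DifferentiableAt ℝ (b ()) ((1 / 2 : ℝ) • (x + y), ξ + s • e) :=
        (hb.smooth ()).differentiable (by simp) _
      exact hbd.hasFDerivAt.comp_hasDerivAt s ((hasDerivAt_const s _).prodMk d0)
    refine ((d2.mul d3).mul_const (v y)).congr_deriv ?_
    simp only [hG, hw, mulInner_apply]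
    have hin : inner ℝ (x - y) e = inner ℝ e x - inner ℝ e y := by
      rw [inner_sub_left, real_inner_comm x e, real_inner_comm y e]
    rw [hin]
    push_cast
    ring

/-- The commutator of the Weyl quantization with a coordinate. -/
lemma weylPair_commutator {M : ℕ} {L : ℤ} {h : ℝ} (hh : h ≠ 0)
    {b : Unit → Euc n × Euc n → ℂ}
    (hb : UniformSymbol (pairWeight M L) b) (v : 𝓢(Euc n, ℂ)) (x e : Euc n) :
    weylPair h (fun z => fderiv ℝ (b ()) z (0, e)) v x =
      -(Complex.I / h) * (((inner ℝ e x : ℝ) : ℂ) * weylPair h (b ()) v x -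
        weylPair h (b ()) (mulInner e v) x) := by
  have i1 := integrable_weylInner hh hb v x ()
  have i2 := integrable_weylInner hh hb (mulInner e v) x ()
  have i3 := integrable_weylInner hh (hb.fderiv_apply ((0 : Euc n), e)) v x ()
  have i4 : Integrable (fun ξ => Complex.I / h * (((inner ℝ e x : ℝ) : ℂ) *
      weylInner h (b ()) v x ξ - weylInner h (b ()) (mulInner e v) x ξ) +
      weylInner h (fun z => fderiv ℝ (b ()) z (0, e)) v x ξ) :=
    (((i1.const_mul (((inner ℝ e x : ℝ) : ℂ))).sub i2).const_mul (Complex.I / h)).add i3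
  -- The integral over ξ of a derivative vanishes; this is integration by parts against the constant
  -- function 1.
  have key := integral_bilinear_hasLineDerivAt_right_eq_neg_left_of_integrable
    (μ := (volume : Measure (Euc n))) (v := e)
    (f := fun _ : Euc n => (1 : ℂ)) (f' := fun _ => 0) (g := weylInner h (b ()) v x)
    (B := ContinuousLinearMap.mul ℝ ℂ) (by simp) (by simpa using i4) (by simpa using i1)
    (fun ξ _ => hasDerivAt_const (0 : ℝ) (1 : ℂ))
    (fun ξ _ => hasDerivAt_weylInner_momentum hb v x ξ e)
  simp only [ContinuousLinearMap.mul_apply', one_mul, zero_mul, integral_zero, neg_zero] at key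
  rw [integral_mul_sub_add _ _ i1 i2 i3] at key
  simp only [weylPair_eq]
  linear_combination ((((2 * Real.pi * h) ^ n)⁻¹ : ℝ) : ℂ) * key

/-- Quantizing a function of the position gives a multiplication operator. -/
lemma weylPair_fst {f : Euc n → ℂ} (hf : f.HasTemperateGrowth) (v : 𝓢(Euc n, ℂ)) (x : Euc n) :
    weylPair 1 (fun z => f z.1) v x = f x * v x := by
  have hb : (fun z : Euc n × Euc n => f z.1).HasTemperateGrowth :=
    hf.comp (ContinuousLinearMap.fst ℝ (Euc n) (Euc n)).hasTemperateGrowth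
  -- The symbol does not depend on ξ, so the slice at ξ = 0 serves for all ξ. After ξ = 2πη the
  -- inner integral is the Fourier transform of φ up to a phase, and the outer one is Fourier
  -- inversion at x, where the midpoint is x itself.
  set φ : 𝓢(Euc n, ℂ) := midpointSlice (fun z : Euc n × Euc n => f z.1) v x 0 with hφ
  have hφa : ∀ y, φ y = f ((1 / 2 : ℝ) • (x + y)) * v y := fun y => midpointSlice_apply hb v x 0 y
  have h1 : ∀ η : Euc n, weylInner 1 (fun z : Euc n × Euc n => f z.1) v x ((2 * Real.pi) • η) =
      Complex.exp (((2 * Real.pi * inner ℝ η x : ℝ) : ℂ) * Complex.I) *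
        (FourierTransform.fourier φ : 𝓢(Euc n, ℂ)) η := by
    intro η
    rw [SchwartzMap.fourier_coe, Real.fourier_eq', ← integral_const_mul]
    unfold weylInner
    congr 1 with y
    rw [smul_eq_mul, hφa, ← mul_assoc, ← mul_assoc, ← Complex.exp_add]
    congr 3
    rw [inner_smul_right, inner_sub_left, real_inner_comm x η]
    push_cast
    ring
  have h2 : ∫ ξ, weylInner 1 (fun z : Euc n × Euc n => f z.1) v x ξ =
      (((2 * Real.pi) ^ n : ℝ) : ℂ) *
        ∫ η : Euc n, Complex.exp (((2 * Real.pi * inner ℝ η x : ℝ) : ℂ) * Complex.I) *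
        (FourierTransform.fourier φ : 𝓢(Euc n, ℂ)) η := by
    have := Measure.integral_comp_smul (volume : Measure (Euc n))
      (weylInner 1 (fun z : Euc n × Euc n => f z.1) v x) (2 * Real.pi)
    simp only [h1, finrank_euclideanSpace, Fintype.card_fin] at this
    rw [this, abs_of_pos (by positivity), Complex.real_smul, ← mul_assoc, ← Complex.ofReal_mul,
      mul_inv_cancel₀ (by positivity)]
    simp
  have h3 : ∫ η : Euc n, Complex.exp (((2 * Real.pi * inner ℝ η x : ℝ) : ℂ) * Complex.I) *
        (FourierTransform.fourier φ : 𝓢(Euc n, ℂ)) η = φ x := by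
    have : (FourierTransformInv.fourierInv (FourierTransform.fourier φ) : 𝓢(Euc n, ℂ)) = φ :=
      FourierPair.fourierInv_fourier_eq φ
    conv_rhs => rw [← this]
    rw [SchwartzMap.fourierInv_coe, Real.fourierInv_eq']
    rfl
  rw [weylPair_eq, h2, h3, hφa, ← mul_assoc, ← Complex.ofReal_mul, mul_one,
    inv_mul_cancel₀ (by positivity)]
  have : (1 / 2 : ℝ) • (x + x) = x := by
    rw [← two_smul ℝ x, smul_smul]; norm_num
  rw [this, Complex.ofReal_one, one_mul]

/-- Dilations intertwine Weyl quantizations with different parameters. -/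
lemma weylRn_dilation {h r : ℝ} (hr : 0 < r) (b : Euc n → Euc n → ℂ) (v : Euc n → ℂ)
    (x : Euc n) :
    weylRn h b v (r • x) =
      weylRn (h / r ^ 2) (fun y ξ => b (r • y) (r • ξ)) (fun y => v (r • y)) x := by
  have hrn : (0 : ℝ) < r ^ n := by positivity
  have cv : ∀ f : Euc n → ℂ, ∫ y, f y = ((r ^ n : ℝ) : ℂ) * ∫ y, f (r • y) := by
    intro f
    have := Measure.integral_comp_smul (volume : Measure (Euc n)) f r
    simp only [finrank_euclideanSpace, Fintype.card_fin] at this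
    rw [this, abs_of_pos (by positivity), Complex.real_smul, ← mul_assoc, ← Complex.ofReal_mul,
      mul_inv_cancel₀ hrn.ne']
    simp
  have h1 : ∀ ξ y : Euc n, (inner ℝ (r • x - r • y) (r • ξ) / h : ℝ) =
      inner ℝ (x - y) ξ / (h / r ^ 2) := by
    intro ξ y
    rw [← smul_sub, inner_smul_left, inner_smul_right]
    simp
    field_simp
  have h2 : ∀ y : Euc n, (1 / 2 : ℝ) • (r • x + r • y) = r • ((1 / 2 : ℝ) • (x + y)) := by
    intro y
    rw [← smul_add, smul_comm]
  unfold weylRn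
  -- Each of the two integrals contributes r ^ n, and together they turn (2πh)⁻ⁿ into (2πh / r²)⁻ⁿ.
  rw [cv]
  simp only [cv (fun y => Complex.exp (Complex.I * ((inner ℝ (r • x - y) _ / h : ℝ) : ℂ)) *
        b ((1 / 2 : ℝ) • (r • x + y)) _ * v y)]
  rw [integral_const_mul]
  simp only [h1, h2]
  rw [← mul_assoc, ← mul_assoc, ← Complex.ofReal_mul, ← Complex.ofReal_mul]
  congr 2
  rw [mul_div_assoc', div_pow, inv_div, ← pow_mul, div_eq_mul_inv, mul_assoc, mul_comm, ← mul_pow]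
  ring

end

/-! ### Ladder relations for Hermite functions on the line. -/

open Polynomial in
-- Differentiating the recursion He_{j+1} = X He_j - He_j' and inserting the previous case
-- reproduces the same recursion one degree lower.
lemma derivative_hermite_succ (j : ℕ) :
    derivative (hermite (j + 1)) = ((j : ℤ[X]) + 1) * hermite j := by
  induction j with
  | zero => simp
  | succ j ih =>
    rw [hermite_succ (j + 1), derivative_sub, derivative_mul, derivative_X, ih, derivative_mul]
    have : derivative ((j : ℤ[X]) + 1) = 0 := by simp
    rw [this, hermite_succ j]
    push_cast
    ring

open Polynomial in
-- For j = 0 the truncated index j - 1 is harmless because its coefficient vanishes. All later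
-- ladder relations rely on the same convention.
lemma X_mul_hermite (j : ℕ) :
    X * hermite j = hermite (j + 1) + (j : ℤ[X]) * hermite (j - 1) := by
  cases j with
  | zero => simp
  | succ j =>
    rw [hermite_succ (j + 1), derivative_hermite_succ]
    simp

lemma derivative_hermite_eq (j : ℕ) : Polynomial.derivative (Polynomial.hermite j) =
    (j : Polynomial ℤ) * Polynomial.hermite (j - 1) := by
  cases j with
  | zero => simp
  | succ j => rw [derivative_hermite_succ]; simp

/-- The normalization constant of the `j`-th Hermite function. -/
noncomputable def hermiteConst (j : ℕ) : ℝ :=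
  (Real.sqrt ((j.factorial : ℝ) * Real.sqrt Real.pi))⁻¹

lemma hermiteConst_eq (j : ℕ) : hermiteConst j = Real.sqrt (j + 1) * hermiteConst (j + 1) := by
  unfold hermiteConst
  rw [Nat.factorial_succ]
  push_cast
  rw [mul_assoc, Real.sqrt_mul (x := (j : ℝ) + 1) (by positivity), mul_inv, ← mul_assoc,
    mul_inv_cancel₀ (by positivity), one_mul]

lemma nat_mul_hermiteConst (j : ℕ) :
    (j : ℝ) * hermiteConst j = Real.sqrt j * hermiteConst (j - 1) := by
  cases j with
  | zero => simp
  | succ j =>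
    rw [Nat.add_sub_cancel, hermiteConst_eq j, ← mul_assoc]
    push_cast
    rw [Real.mul_self_sqrt (by positivity)]

lemma hermiteFun_eq (j : ℕ) (r : ℝ) : hermiteFun j r = hermiteConst j *
    Polynomial.aeval (Real.sqrt 2 * r) (Polynomial.hermite j) * Real.exp (-(r ^ 2) / 2) := rfl

lemma sqrt_two_mul_hermiteFun (j : ℕ) (r : ℝ) : Real.sqrt 2 * r * hermiteFun j r =
    Real.sqrt (j + 1) * hermiteFun (j + 1) r + Real.sqrt j * hermiteFun (j - 1) r := by
  have h1 := congrArg (Polynomial.aeval (Real.sqrt 2 * r)) (X_mul_hermite j)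
  simp only [map_mul, Polynomial.aeval_X, map_add, map_natCast] at h1
  simp only [hermiteFun_eq]
  have h2 := hermiteConst_eq j
  have h3 := nat_mul_hermiteConst j
  set A := Polynomial.aeval (Real.sqrt 2 * r) (Polynomial.hermite j)
  set B := Polynomial.aeval (Real.sqrt 2 * r) (Polynomial.hermite (j + 1))
  set D := Polynomial.aeval (Real.sqrt 2 * r) (Polynomial.hermite (j - 1))
  set E := Real.exp (-(r ^ 2) / 2)
  linear_combination hermiteConst j * E * h1 + B * E * h2 + D * E * h3

lemma mul_hermiteFun (j : ℕ) (r : ℝ) : r * hermiteFun j r =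
    Real.sqrt ((j + 1) / 2) * hermiteFun (j + 1) r + Real.sqrt (j / 2) * hermiteFun (j - 1) r := by
  have h := sqrt_two_mul_hermiteFun j r
  have h2 : Real.sqrt 2 ≠ 0 := by positivity
  rw [Real.sqrt_div (by positivity), Real.sqrt_div (by positivity)]
  field_simp
  linear_combination h

lemma hasDerivAt_hermiteFun (j : ℕ) (r : ℝ) : HasDerivAt (hermiteFun j)
    (Real.sqrt (j / 2) * hermiteFun (j - 1) r -
      Real.sqrt ((j + 1) / 2) * hermiteFun (j + 1) r) r := by
  have d1 : HasDerivAt (fun r : ℝ => Polynomial.aeval (Real.sqrt 2 * r) (Polynomial.hermite j))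
      (Polynomial.aeval (Real.sqrt 2 * r) (Polynomial.derivative (Polynomial.hermite j)) *
        Real.sqrt 2) r := by
    have h0 : HasDerivAt (fun r : ℝ => Real.sqrt 2 * r) (Real.sqrt 2) r := by
      simpa using (hasDerivAt_id r).const_mul (Real.sqrt 2)
    exact ((Polynomial.hermite j).hasDerivAt_aeval (Real.sqrt 2 * r)).comp r h0
  have d2 : HasDerivAt (fun r : ℝ => Real.exp (-(r ^ 2) / 2)) (Real.exp (-(r ^ 2) / 2) * (-r)) r := by
    refine HasDerivAt.exp ?_
    refine (((hasDerivAt_pow 2 r).neg).div_const 2).congr_deriv ?_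
    simp
    ring
  have d3 := (d1.const_mul (hermiteConst j)).mul d2
  refine HasDerivAt.congr_deriv (f := hermiteFun j) d3 ?_
  rw [derivative_hermite_eq]
  simp only [map_mul, map_natCast]
  have h1 := mul_hermiteFun j r
  have h3 := nat_mul_hermiteConst j
  have h4 : Real.sqrt (j / 2) * Real.sqrt 2 = Real.sqrt j := by
    rw [← Real.sqrt_mul (by positivity)]; congr 1; field_simp
  have h5 : Real.sqrt 2 * Real.sqrt 2 = 2 := Real.mul_self_sqrt (by norm_num)
  rw [hermiteFun_eq j r] at h1
  rw [hermiteFun_eq (j - 1) r] at h1 ⊢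
  set A := Polynomial.aeval (Real.sqrt 2 * r) (Polynomial.hermite j)
  set D := Polynomial.aeval (Real.sqrt 2 * r) (Polynomial.hermite (j - 1))
  set E := Real.exp (-(r ^ 2) / 2)
  rw [← h4] at h3
  linear_combination -h1 + D * E * Real.sqrt 2 * h3 +
    Real.sqrt (j / 2) * hermiteConst (j - 1) * D * E * h5

/-! ### Rescaled Hermite functions on ℝⁿ: Schwartz class, ladder operators, normalization. -/

section
variable {n : ℕ}

lemma norm_iteratedFDeriv_exp_neg_le (k : ℕ) : ∃ C : ℝ, ∀ x : Euc n,
    ‖x‖ ^ 0 * ‖iteratedFDeriv ℝ k (fun x : Euc n => Real.exp (-(‖x‖ ^ 2) / 2)) x‖ ≤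
      C * ((1 + ‖x‖) ^ k * Real.exp (-(‖x‖ ^ 2) / 2)) := by
  refine ⟨k.factorial * 2 ^ k, fun x => ?_⟩
  have hf : ContDiff ℝ ∞ (fun x : Euc n => -(‖x‖ ^ 2) / 2) :=
    ((contDiff_norm_sq ℝ).neg).div_const 2
  have hid : ∀ x : Euc n, HasFDerivAt (fun x : Euc n => -(‖x‖ ^ 2) / 2) (-(innerSL ℝ x)) x := by
    intro x
    have h1 : HasFDerivAt (fun x : Euc n => ‖x‖ ^ 2) (2 • innerSL ℝ x) x :=
      (hasStrictFDerivAt_norm_sq x).hasFDerivAt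
    have h2 := h1.neg.const_smul (1 / 2 : ℝ)
    have h3 : (fun x : Euc n => -(‖x‖ ^ 2) / 2) = fun x => (1 / 2 : ℝ) • (-(‖x‖ ^ 2)) := by
      ext1 y; rw [smul_eq_mul]; ring
    rw [h3]
    refine h2.congr_fderiv ?_
    ext y
    simp
  have hfd : fderiv ℝ (fun x : Euc n => -(‖x‖ ^ 2) / 2) =
      (-(innerSL ℝ) : Euc n →L[ℝ] Euc n →L[ℝ] ℝ) ∘ fun x => x := by
    ext1 x; exact (hid x).fderiv
  rw [pow_zero, one_mul]
  -- Faà di Bruno bound: every derivative of exp is exp itself, which provides C, and the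
  -- derivatives of -|x|²/2 of order i ≥ 1 are at most 1 + |x|, hence at most D ^ i.
  refine (norm_iteratedFDeriv_comp_le (g := Real.exp) (C := Real.exp (-(‖x‖ ^ 2) / 2))
    (D := 2 * (1 + ‖x‖)) Real.contDiff_exp hf (n := k) (N := ∞) (mod_cast le_top) x
    (fun i _ => ?_) (fun i hi _ => ?_)).trans (le_of_eq ?_)
  · rw [norm_iteratedFDeriv_eq_norm_iteratedDeriv, iteratedDeriv_eq_iterate, Real.iter_deriv_exp,
      Real.norm_of_nonneg (Real.exp_pos _).le]
  · obtain ⟨j, rfl⟩ : ∃ j, i = j + 1 := ⟨i - 1, by omega⟩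
    rw [← norm_iteratedFDeriv_fderiv, hfd]
    refine ((-(innerSL ℝ) : Euc n →L[ℝ] Euc n →L[ℝ] ℝ).norm_iteratedFDeriv_comp_left
      (f := fun x : Euc n => x) contDiff_id.contDiffAt (n := j) (N := ∞) (mod_cast le_top)).trans ?_
    have h1 : ‖(-(innerSL ℝ) : Euc n →L[ℝ] Euc n →L[ℝ] ℝ)‖ ≤ 1 :=
      (ContinuousLinearMap.opNorm_neg _).trans_le (norm_innerSL_le ℝ)
    have h2 := norm_iteratedFDeriv_id_le j x
    have h3 : (1 : ℝ) ≤ 2 * (1 + ‖x‖) := by linarith [norm_nonneg x]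
    calc _ ≤ 1 * (1 + ‖x‖) := mul_le_mul h1 h2 (norm_nonneg _) zero_le_one
      _ ≤ (2 * (1 + ‖x‖)) ^ 1 := by linarith [norm_nonneg x]
      _ ≤ _ := pow_le_pow_right₀ h3 (by omega)
  · rw [mul_pow]; ring

lemma exists_one_add_pow_mul_exp_le (k : ℕ) :
    ∃ C : ℝ, ∀ r : ℝ, 0 ≤ r → (1 + r) ^ k * Real.exp (-(r ^ 2) / 2) ≤ C := by
  refine ⟨k.factorial * Real.exp 2, fun r hr => ?_⟩
  have h1 : (1 + r) ^ k / k.factorial ≤ Real.exp (1 + r) :=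
    Real.pow_div_factorial_le_exp (1 + r) (by positivity) k
  have h2 : (1 + r) ^ k ≤ k.factorial * Real.exp (1 + r) := by
    rwa [div_le_iff₀ (by positivity), mul_comm] at h1
  calc _ ≤ (k.factorial * Real.exp (1 + r)) * Real.exp (-(r ^ 2) / 2) := by gcongr
    _ = k.factorial * Real.exp (1 + r + -(r ^ 2) / 2) := by rw [mul_assoc, ← Real.exp_add]
    _ ≤ _ := by
      gcongr
      nlinarith [sq_nonneg (r - 1)]

/-- The standard Gaussian `exp (-|x|² / 2)` as a Schwartz function. -/
noncomputable def gaussianSchwartz (n : ℕ) : 𝓢(Euc n, ℝ) where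
  toFun x := Real.exp (-(‖x‖ ^ 2) / 2)
  smooth' := Real.contDiff_exp.comp (((contDiff_norm_sq ℝ).neg).div_const 2)
  decay' k l := by
    obtain ⟨C, hC⟩ := norm_iteratedFDeriv_exp_neg_le (n := n) l
    obtain ⟨D, hD⟩ := exists_one_add_pow_mul_exp_le (k + l)
    refine ⟨|C| * D, fun x => ?_⟩
    have h1 := hC x
    rw [pow_zero, one_mul] at h1
    calc _ ≤ (1 + ‖x‖) ^ k * (|C| * ((1 + ‖x‖) ^ l * Real.exp (-(‖x‖ ^ 2) / 2))) := by
          refine mul_le_mul ?_ (h1.trans ?_) (norm_nonneg _) (by positivity)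
          · gcongr; linarith
          · gcongr; exact le_abs_self C
      _ = |C| * ((1 + ‖x‖) ^ (k + l) * Real.exp (-(‖x‖ ^ 2) / 2)) := by rw [pow_add]; ring
      _ ≤ |C| * D := mul_le_mul_of_nonneg_left (hD _ (norm_nonneg x)) (abs_nonneg _)

lemma hasTemperateGrowth_aeval (p : Polynomial ℤ) :
    (fun r : ℝ => Polynomial.aeval r p).HasTemperateGrowth := by
  induction p using Polynomial.induction_on' with
  | add p q hp hq =>
    simp only [map_add]
    exact hp.add hq
  | monomial k c =>
    simp only [Polynomial.aeval_monomial]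
    fun_prop

/-- The rescaled Hermite function `h^{-n/4} ∏ h_{μᵢ} (xᵢ / √h)`. -/
noncomputable def hermiteProd (h : ℝ) (μ : Fin n → ℕ) (x : Euc n) : ℝ :=
  h ^ (-(n : ℝ) / 4) * ∏ i, hermiteFun (μ i) (x i / Real.sqrt h)

/-- A function of temperate growth times a dilated Gaussian: this form exhibits the product as a
Schwartz function. -/
lemma hermiteProd_eq (h : ℝ) (μ : Fin n → ℕ) (x : Euc n) :
    hermiteProd h μ x = (h ^ (-(n : ℝ) / 4) * ∏ i, (hermiteConst (μ i) *
      Polynomial.aeval (Real.sqrt 2 * ((Real.sqrt h)⁻¹ * x i)) (Polynomial.hermite (μ i)))) *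
      Real.exp (-(‖(Real.sqrt h)⁻¹ • x‖ ^ 2) / 2) := by
  unfold hermiteProd
  simp only [hermiteFun_eq, div_eq_inv_mul _ (Real.sqrt h)]
  rw [Finset.prod_mul_distrib, ← mul_assoc, ← Real.exp_sum, EuclideanSpace.norm_sq_eq]
  congr 2
  rw [← Finset.sum_div, Finset.sum_neg_distrib]
  congr 2
  refine Finset.sum_congr rfl fun i _ => ?_
  rw [Real.norm_eq_abs, sq_abs]
  rfl

/-- The rescaled Hermite function as a real Schwartz function. -/
noncomputable def hermiteReal (h : ℝ) (μ : Fin n → ℕ) : 𝓢(Euc n, ℝ) :=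
  if hh : 0 < h then
    SchwartzMap.smulLeftCLM ℝ (fun x : Euc n => h ^ (-(n : ℝ) / 4) * ∏ i, (hermiteConst (μ i) *
      Polynomial.aeval (Real.sqrt 2 * ((Real.sqrt h)⁻¹ * x i)) (Polynomial.hermite (μ i))))
      (SchwartzMap.compCLMOfContinuousLinearEquiv ℝ
        (LinearEquiv.smulOfNeZero ℝ (Euc n) (Real.sqrt h)⁻¹
          (inv_ne_zero (Real.sqrt_ne_zero'.2 hh))).toContinuousLinearEquiv (gaussianSchwartz n))
  else 0

lemma hasTemperateGrowth_finset_prod {V ι : Type*} [NormedAddCommGroup V] [NormedSpace ℝ V]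
    (s : Finset ι) (f : ι → V → ℝ)
    (hf : ∀ i ∈ s, (f i).HasTemperateGrowth) : (fun x => ∏ i ∈ s, f i x).HasTemperateGrowth := by
  classical
  induction s using Finset.induction_on with
  | empty => simp
  | insert a s ha ih =>
    simp only [Finset.prod_insert ha]
    exact (hf a (by simp)).mul (ih fun i hi => hf i (by simp [hi]))

lemma hasTemperateGrowth_coord (i : Fin n) : (fun x : Euc n => x i).HasTemperateGrowth :=
  (EuclideanSpace.proj i : Euc n →L[ℝ] ℝ).hasTemperateGrowth

lemma hermiteReal_apply {h : ℝ} (hh : 0 < h) (μ : Fin n → ℕ) (x : Euc n) :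
    hermiteReal h μ x = hermiteProd h μ x := by
  have ht : (fun x : Euc n => h ^ (-(n : ℝ) / 4) * ∏ i, (hermiteConst (μ i) *
      Polynomial.aeval (Real.sqrt 2 * ((Real.sqrt h)⁻¹ * x i))
        (Polynomial.hermite (μ i)))).HasTemperateGrowth := by
    refine (Function.HasTemperateGrowth.const _).mul
      (hasTemperateGrowth_finset_prod _ _ fun i _ =>
        (Function.HasTemperateGrowth.const _).mul ?_)
    refine (hasTemperateGrowth_aeval (Polynomial.hermite (μ i))).comp ?_
    have := hasTemperateGrowth_coord i
    fun_prop
  rw [hermiteReal, dif_pos hh, SchwartzMap.smulLeftCLM_apply_apply ht, hermiteProd_eq,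
    smul_eq_mul]
  rfl

/-- The rescaled Hermite function as a complex Schwartz function. -/
noncomputable def hermiteSchwartz (h : ℝ) (μ : Fin n → ℕ) : 𝓢(Euc n, ℂ) :=
  (hermiteReal h μ).postcompCLM Complex.ofRealCLM

lemma hermiteSchwartz_apply {h : ℝ} (hh : 0 < h) (μ : Fin n → ℕ) (x : Euc n) :
    hermiteSchwartz h μ x = (hermiteProd h μ x : ℂ) := by
  rw [hermiteSchwartz, SchwartzMap.postcompCLM_apply, hermiteReal_apply hh]
  rfl

/-- Isolating the j-th factor reduces relations in n variables to one variable. With the entry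
written through `Function.update`, raising and lowering only change k. -/
lemma hermiteProd_update (h : ℝ) (μ : Fin n → ℕ) (j : Fin n) (k : ℕ) (x : Euc n) :
    hermiteProd h (Function.update μ j k) x = h ^ (-(n : ℝ) / 4) *
      (hermiteFun k (x j / Real.sqrt h) *
        ∏ i ∈ Finset.univ.erase j, hermiteFun (μ i) (x i / Real.sqrt h)) := by
  unfold hermiteProd
  rw [← Finset.mul_prod_erase _ _ (Finset.mem_univ j)]
  congr 2
  · simp
  · refine Finset.prod_congr rfl fun i hi => ?_
    rw [Function.update_of_ne (Finset.ne_of_mem_erase hi)]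

lemma coord_mul_hermiteProd {h : ℝ} (hh : 0 < h) (μ : Fin n → ℕ) (j : Fin n) (k : ℕ) (x : Euc n) :
    x j * hermiteProd h (Function.update μ j k) x =
      Real.sqrt h * (Real.sqrt ((k + 1) / 2) * hermiteProd h (Function.update μ j (k + 1)) x +
        Real.sqrt (k / 2) * hermiteProd h (Function.update μ j (k - 1)) x) := by
  have h1 := mul_hermiteFun k (x j / Real.sqrt h)
  have h2 : x j = Real.sqrt h * (x j / Real.sqrt h) := by
    field_simp
  simp only [hermiteProd_update]
  set A := ∏ i ∈ Finset.univ.erase j, hermiteFun (μ i) (x i / Real.sqrt h)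
  set c := h ^ (-(n : ℝ) / 4)
  set f := hermiteFun k (x j / Real.sqrt h)
  linear_combination (Real.sqrt h * c * A) * h1 + (c * A * f) * h2

lemma lineDeriv_hermiteProd (h : ℝ) (μ : Fin n → ℕ) (j : Fin n) (k : ℕ) (x : Euc n) :
    h * lineDeriv ℝ (hermiteProd h (Function.update μ j k)) x (EuclideanSpace.single j (1 : ℝ)) =
      Real.sqrt h * (Real.sqrt (k / 2) * hermiteProd h (Function.update μ j (k - 1)) x -
        Real.sqrt ((k + 1) / 2) * hermiteProd h (Function.update μ j (k + 1)) x) := by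
  have h0 : (fun t : ℝ => hermiteProd h (Function.update μ j k)
      (x + t • EuclideanSpace.single j (1 : ℝ))) = fun t => h ^ (-(n : ℝ) / 4) *
      (hermiteFun k ((x j + t) / Real.sqrt h) *
        ∏ i ∈ Finset.univ.erase j, hermiteFun (μ i) (x i / Real.sqrt h)) := by
    ext1 t
    rw [hermiteProd_update]
    congr 2
    · simp
    · refine Finset.prod_congr rfl fun i hi => ?_
      simp [Finset.ne_of_mem_erase hi]
  have h1 : HasDerivAt (fun t : ℝ => (x j + t) / Real.sqrt h) (1 / Real.sqrt h) 0 :=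
    ((hasDerivAt_id (0 : ℝ)).const_add (x j)).div_const _
  have h2 : HasDerivAt (fun t : ℝ => hermiteFun k ((x j + t) / Real.sqrt h))
      ((Real.sqrt (k / 2) * hermiteFun (k - 1) (x j / Real.sqrt h) -
        Real.sqrt ((k + 1) / 2) * hermiteFun (k + 1) (x j / Real.sqrt h)) *
          (1 / Real.sqrt h)) 0 :=
    HasDerivAt.comp_of_eq (0 : ℝ) (hasDerivAt_hermiteFun k (x j / Real.sqrt h)) h1 (by simp)
  have h3 := (h2.mul_const (∏ i ∈ Finset.univ.erase j,
    hermiteFun (μ i) (x i / Real.sqrt h))).const_mul (h ^ (-(n : ℝ) / 4))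
  rw [lineDeriv, h0, h3.deriv]
  simp only [hermiteProd_update]
  have h4 : h * (1 / Real.sqrt h) = Real.sqrt h := by
    rw [mul_one_div, Real.div_sqrt]
  set A := ∏ i ∈ Finset.univ.erase j, hermiteFun (μ i) (x i / Real.sqrt h)
  set c := h ^ (-(n : ℝ) / 4)
  set B := Real.sqrt (k / 2) * hermiteFun (k - 1) (x j / Real.sqrt h) -
    Real.sqrt ((k + 1) / 2) * hermiteFun (k + 1) (x j / Real.sqrt h) with hB
  calc _ = (h * (1 / Real.sqrt h)) * (c * A * B) := by ring
    _ = _ := by rw [h4, hB]; ring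

/-- The creation operator x_j - h ∂_j, obtained by subtracting the ladder formula for h ∂_j from the
one for x_j. The companion `hermiteReal_lower` is the annihilation operator, with the same
coefficient. -/
lemma hermiteReal_raise {h : ℝ} (hh : 0 < h) (μ : Fin n → ℕ) (j : Fin n) (k : ℕ) (x : Euc n) :
    2 * (Real.sqrt h * Real.sqrt ((k + 1) / 2)) * hermiteReal h (Function.update μ j (k + 1)) x =
      x j * hermiteReal h (Function.update μ j k) x -
        h * (∂_{(EuclideanSpace.single j (1 : ℝ) : Euc n)}
          (hermiteReal h (Function.update μ j k))) x := by
  have h0 : (hermiteReal h (Function.update μ j k) : Euc n → ℝ) =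
      hermiteProd h (Function.update μ j k) := by ext1 x; exact hermiteReal_apply hh _ x
  rw [SchwartzMap.lineDerivOp_apply, h0, lineDeriv_hermiteProd, coord_mul_hermiteProd hh,
    hermiteReal_apply hh]
  ring

lemma hermiteReal_lower {h : ℝ} (hh : 0 < h) (μ : Fin n → ℕ) (j : Fin n) (k : ℕ) (x : Euc n) :
    2 * (Real.sqrt h * Real.sqrt ((k + 1) / 2)) * hermiteReal h (Function.update μ j k) x =
      x j * hermiteReal h (Function.update μ j (k + 1)) x +
        h * (∂_{(EuclideanSpace.single j (1 : ℝ) : Euc n)}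
          (hermiteReal h (Function.update μ j (k + 1)))) x := by
  have h0 : (hermiteReal h (Function.update μ j (k + 1)) : Euc n → ℝ) =
      hermiteProd h (Function.update μ j (k + 1)) := by ext1 x; exact hermiteReal_apply hh _ x
  rw [SchwartzMap.lineDerivOp_apply, h0, lineDeriv_hermiteProd, coord_mul_hermiteProd hh,
    hermiteReal_apply hh]
  push_cast
  ring

lemma SchwartzMap.integrable_mul (f g : 𝓢(Euc n, ℝ)) : Integrable fun x => f x * g x :=
  (f.memLp 2).integrable_mul (g.memLp 2)

/-- Creation and annihilation are formal adjoints. Multiplying the raising relation by f, the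
lowering one by g and subtracting gives c (f² - g²) = -h ∂_j (f g), whose integral is zero. This
reduces the normalization to the Gaussian. -/
lemma integral_hermiteReal_update {h : ℝ} (hh : 0 < h) (μ : Fin n → ℕ) (j : Fin n) (k : ℕ) :
    ∫ x, hermiteReal h (Function.update μ j (k + 1)) x * hermiteReal h (Function.update μ j (k + 1)) x
      = ∫ x, hermiteReal h (Function.update μ j k) x * hermiteReal h (Function.update μ j k) x := by
  set f := hermiteReal h (Function.update μ j (k + 1)) with hf
  set g := hermiteReal h (Function.update μ j k) with hg
  set e : Euc n := EuclideanSpace.single j (1 : ℝ) with he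
  set c : ℝ := 2 * (Real.sqrt h * Real.sqrt ((k + 1) / 2)) with hc
  have hc0 : c ≠ 0 := by positivity
  have r1 := hermiteReal_raise hh μ j k
  have r2 := hermiteReal_lower hh μ j k
  have ibp := SchwartzMap.integral_mul_lineDerivOp_right_eq_neg_left (μ := volume) f g e
  have i1 := SchwartzMap.integrable_mul f (∂_{e} g)
  have i2 := SchwartzMap.integrable_mul (∂_{e} f) g
  have e1 : ∀ x, c * (f x * f x) = (c * (g x * g x) - h * ((∂_{e} f) x * g x)) -
      h * (f x * (∂_{e} g) x) := by
    intro x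
    have a1 := r1 x
    have a2 := r2 x
    linear_combination f x * a1 - g x * a2
  have i3 : Integrable (fun x => c * (g x * g x) - h * ((∂_{e} f) x * g x)) :=
    ((SchwartzMap.integrable_mul g g).const_mul c).sub (i2.const_mul h)
  have e2 : ∫ x, c * (f x * f x) = ∫ x, c * (g x * g x) := by
    simp only [e1]
    rw [integral_sub i3 (i1.const_mul h), integral_sub
      ((SchwartzMap.integrable_mul g g).const_mul c) (i2.const_mul h), integral_const_mul h,
      integral_const_mul h, ibp]
    ring
  rw [integral_const_mul, integral_const_mul] at e2
  exact mul_left_cancel₀ hc0 e2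

lemma integral_hermiteReal_zero {h : ℝ} (hh : 0 < h) :
    ∫ x : Euc n, hermiteReal h (fun _ => 0) x * hermiteReal h (fun _ => 0) x = 1 := by
  have h1 : ∀ x : Euc n, hermiteReal h (fun _ => 0) x * hermiteReal h (fun _ => 0) x =
      (h ^ (-(n : ℝ) / 2) * Real.pi ^ (-(n : ℝ) / 2)) * Real.exp (-h⁻¹ * ‖x‖ ^ 2) := by
    intro x
    rw [hermiteReal_apply hh, hermiteProd_eq]
    simp only [Polynomial.hermite_zero, Polynomial.aeval_C, Finset.prod_const, Finset.card_univ,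
      Fintype.card_fin, hermiteConst]
    have a1 : ((Real.sqrt (((0 : ℕ).factorial : ℝ) * Real.sqrt Real.pi))⁻¹ : ℝ) =
        Real.pi ^ (-(1 : ℝ) / 4) := by
      rw [Nat.factorial_zero, Nat.cast_one, one_mul, Real.sqrt_eq_rpow, Real.sqrt_eq_rpow,
        ← Real.rpow_mul Real.pi_pos.le, ← Real.rpow_neg Real.pi_pos.le]
      norm_num
    have a2 : ‖(Real.sqrt h)⁻¹ • x‖ ^ 2 = h⁻¹ * ‖x‖ ^ 2 := by
      rw [norm_smul, mul_pow, Real.norm_of_nonneg (by positivity), inv_pow, Real.sq_sqrt hh.le]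
    rw [a1, a2]
    have a3 : h ^ (-(n : ℝ) / 4) * h ^ (-(n : ℝ) / 4) = h ^ (-(n : ℝ) / 2) := by
      rw [← Real.rpow_add hh]; congr 1; ring
    have a4 : (Real.pi ^ (-(1 : ℝ) / 4)) ^ n * (Real.pi ^ (-(1 : ℝ) / 4)) ^ n =
        Real.pi ^ (-(n : ℝ) / 2) := by
      rw [← Real.rpow_natCast, ← Real.rpow_mul Real.pi_pos.le, ← Real.rpow_add Real.pi_pos]
      congr 1; ring
    have a5 : Real.exp (-(h⁻¹ * ‖x‖ ^ 2) / 2) * Real.exp (-(h⁻¹ * ‖x‖ ^ 2) / 2) =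
        Real.exp (-h⁻¹ * ‖x‖ ^ 2) := by
      rw [← Real.exp_add]; congr 1; ring
    rw [← a3, ← a4, ← a5]
    simp
    ring
  simp only [h1]
  rw [integral_const_mul, GaussianFourier.integral_rexp_neg_mul_sq_norm (by positivity)]
  rw [finrank_euclideanSpace, Fintype.card_fin, div_inv_eq_mul, Real.mul_rpow Real.pi_pos.le hh.le]
  have b1 : h ^ (-(n : ℝ) / 2) * h ^ ((n : ℝ) / 2) = 1 := by
    rw [← Real.rpow_add hh]; simp [neg_div]
  have b2 : Real.pi ^ (-(n : ℝ) / 2) * Real.pi ^ ((n : ℝ) / 2) = 1 := by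
    rw [← Real.rpow_add Real.pi_pos]; simp [neg_div]
  calc _ = (h ^ (-(n : ℝ) / 2) * h ^ ((n : ℝ) / 2)) *
        (Real.pi ^ (-(n : ℝ) / 2) * Real.pi ^ ((n : ℝ) / 2)) := by ring
    _ = 1 := by rw [b1, b2, one_mul]

lemma integral_hermiteReal {h : ℝ} (hh : 0 < h) (N : ℕ) : ∀ μ : Fin n → ℕ, ∑ i, μ i = N →
    ∫ x, hermiteReal h μ x * hermiteReal h μ x = 1 := by
  induction N with
  | zero =>
    intro μ hμ
    have : μ = fun _ => 0 := by
      ext i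
      exact (Finset.sum_eq_zero_iff.1 hμ) i (Finset.mem_univ i)
    rw [this]
    exact integral_hermiteReal_zero hh
  | succ N ih =>
    intro μ hμ
    obtain ⟨j, hj⟩ : ∃ j, μ j ≠ 0 := by
      by_contra hcon
      push Not at hcon
      simp [hcon] at hμ
    obtain ⟨k, hk⟩ := Nat.exists_eq_succ_of_ne_zero hj
    have h1 : Function.update μ j (k + 1) = μ := by
      rw [← Nat.succ_eq_add_one, ← hk, Function.update_eq_self]
    have h2 := integral_hermiteReal_update hh μ j k
    rw [h1] at h2
    rw [h2]
    refine ih _ ?_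
    rw [Finset.sum_update_of_mem (Finset.mem_univ j)]
    rw [← Finset.add_sum_erase _ _ (Finset.mem_univ j), hk] at hμ
    rw [Finset.sdiff_singleton_eq_erase]
    omega

lemma eLpNorm_hermiteSchwartz {h : ℝ} (hh : 0 < h) (μ : Fin n → ℕ) :
    eLpNorm (hermiteSchwartz h μ) 2 volume = 1 := by
  have hm : MemLp (hermiteSchwartz h μ) 2 (volume : Measure (Euc n)) :=
    (hermiteSchwartz h μ).memLp 2
  rw [hm.eLpNorm_eq_integral_rpow_norm (by norm_num) (by norm_num)]
  have : ∀ x, ‖hermiteSchwartz h μ x‖ ^ (2 : ENNReal).toReal =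
      hermiteReal h μ x * hermiteReal h μ x := by
    intro x
    rw [hermiteSchwartz, SchwartzMap.postcompCLM_apply, Complex.ofRealCLM_apply,
      Complex.norm_real, ENNReal.toReal_ofNat, Real.rpow_ofNat, Real.norm_eq_abs, sq_abs, sq]
  simp only [this, integral_hermiteReal hh _ μ rfl]
  simp

end

/-! ### Cauchy–Schwarz and Young inequalities. -/

section Lp

lemma eLpNorm_two_sq {X : Type*} [MeasurableSpace X] (μ : Measure X) (f : X → ℂ) :
    eLpNorm f 2 μ ^ 2 = ∫⁻ x, ‖f x‖ₑ ^ 2 ∂μ := by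
  rw [eLpNorm_eq_lintegral_rpow_enorm_toReal (by norm_num) (by norm_num)]
  simp only [ENNReal.toReal_ofNat, ENNReal.rpow_ofNat]
  rw [← ENNReal.rpow_ofNat, ← ENNReal.rpow_mul]
  norm_num

/-- Cauchy–Schwarz after splitting k as the product of two square roots, so that only one full
factor k stays with f². -/
lemma lintegral_mul_sq_le {X : Type*} [MeasurableSpace X] (μ : Measure X) {k f : X → ℝ≥0∞}
    (hk : Measurable k) (hf : Measurable f) :
    (∫⁻ x, k x * f x ∂μ) ^ 2 ≤ (∫⁻ x, k x ∂μ) * ∫⁻ x, k x * f x ^ 2 ∂μ := by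
  have h1 := ENNReal.lintegral_mul_le_Lp_mul_Lq μ (Real.HolderConjugate.two_two)
    (f := fun x => k x ^ (1 / 2 : ℝ)) (g := fun x => k x ^ (1 / 2 : ℝ) * f x)
    (hk.pow_const _).aemeasurable ((hk.pow_const _).mul hf).aemeasurable
  have h2 : ∀ x, k x ^ (1 / 2 : ℝ) * (k x ^ (1 / 2 : ℝ) * f x) = k x * f x := by
    intro x
    rw [← mul_assoc, ← ENNReal.rpow_add_of_nonneg _ _ (by norm_num) (by norm_num)]
    norm_num
  have h3 : ∀ x, (k x ^ (1 / 2 : ℝ)) ^ (2 : ℝ) = k x := by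
    intro x
    rw [← ENNReal.rpow_mul]; norm_num
  have h4 : ∀ x, (k x ^ (1 / 2 : ℝ) * f x) ^ (2 : ℝ) = k x * f x ^ 2 := by
    intro x
    rw [ENNReal.mul_rpow_of_nonneg _ _ (by norm_num), h3, ENNReal.rpow_ofNat]
  simp only [Pi.mul_apply, h2, h3, h4] at h1
  calc _ ≤ ((∫⁻ x, k x ∂μ) ^ (1 / 2 : ℝ) * (∫⁻ x, k x * f x ^ 2 ∂μ) ^ (1 / 2 : ℝ)) ^ 2 := by
        gcongr
    _ = _ := by
        rw [mul_pow, ← ENNReal.rpow_natCast, ← ENNReal.rpow_natCast, ← ENNReal.rpow_mul,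
          ← ENNReal.rpow_mul]
        norm_num

/-- Young's inequality L¹ * L² ⊂ L²: weighted Cauchy–Schwarz in y, then Tonelli and translation
invariance. -/
lemma lintegral_convolution_sq_le {n : ℕ} {k f : Euc n → ℝ≥0∞}
    (hk : Measurable k) (hf : Measurable f) :
    ∫⁻ x, (∫⁻ y, k (x - y) * f y) ^ 2 ≤ (∫⁻ x, k x) ^ 2 * ∫⁻ y, f y ^ 2 := by
  have h0 : ∀ x, ∫⁻ y, k (x - y) = ∫⁻ y, k y := fun x => lintegral_sub_left_eq_self k x
  calc ∫⁻ x, (∫⁻ y, k (x - y) * f y) ^ 2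
      ≤ ∫⁻ x, (∫⁻ y, k y) * ∫⁻ y, k (x - y) * f y ^ 2 := by
        refine lintegral_mono fun x => ?_
        refine (lintegral_mul_sq_le volume (k := fun y => k (x - y))
          (hk.comp (measurable_const.sub measurable_id)) hf).trans ?_
        rw [h0]
    _ = (∫⁻ y, k y) * ∫⁻ x, ∫⁻ y, k (x - y) * f y ^ 2 := by
        rw [lintegral_const_mul]
        exact Measurable.lintegral_prod_right' (f := fun p : Euc n × Euc n =>
          k (p.1 - p.2) * f p.2 ^ 2)
          ((hk.comp (measurable_fst.sub measurable_snd)).mul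
            ((hf.comp measurable_snd).pow_const 2))
    _ = (∫⁻ y, k y) * ∫⁻ y, ∫⁻ x, k (x - y) * f y ^ 2 := by
        rw [lintegral_lintegral_swap]
        exact ((hk.comp (measurable_fst.sub measurable_snd)).mul
            ((hf.comp measurable_snd).pow_const 2)).aemeasurable
    _ = (∫⁻ y, k y) * ∫⁻ y, (∫⁻ x, k x) * f y ^ 2 := by
        congr 2 with y
        have hm : Measurable fun x => k (x - y) := hk.comp (measurable_id.sub measurable_const)
        rw [lintegral_mul_const _ hm]
        congr 1
        exact lintegral_sub_right_eq_self k y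
    _ = _ := by
        rw [lintegral_const_mul _ (hf.pow_const 2)]
        ring

end Lp

/-! ### Hermite functions of bounded energy. -/

section
variable {n : ℕ}

lemma lineDerivOp_hermiteSchwartz (h : ℝ) (μ : Fin n → ℕ) (e y : Euc n) :
    (∂_{e} (hermiteSchwartz h μ)) y = (((∂_{e} (hermiteReal h μ)) y : ℝ) : ℂ) := by
  rw [SchwartzMap.lineDerivOp_apply_eq_fderiv, SchwartzMap.lineDerivOp_apply_eq_fderiv]
  have h0 : (hermiteSchwartz h μ : Euc n → ℂ) = Complex.ofRealCLM ∘ (hermiteReal h μ) := by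
    ext1 x; rfl
  rw [h0, (Complex.ofRealCLM.hasFDerivAt.comp y
    (hermiteReal h μ).differentiableAt.hasFDerivAt).fderiv]
  rfl

/-- Raising one entry of a multi-index. -/
def raiseIndex (μ : Fin n → ℕ) (j : Fin n) : Fin n → ℕ := Function.update μ j (μ j + 1)

/-- Lowering one entry of a multi-index. -/
def lowerIndex (μ : Fin n → ℕ) (j : Fin n) : Fin n → ℕ := Function.update μ j (μ j - 1)

lemma coord_mul_hermiteSchwartz {h : ℝ} (hh : 0 < h) (μ : Fin n → ℕ) (j : Fin n) (y : Euc n) :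
    (y j : ℂ) * hermiteSchwartz h μ y =
      ((Real.sqrt h * Real.sqrt (((μ j : ℝ) + 1) / 2) : ℝ) : ℂ) *
        hermiteSchwartz h (raiseIndex μ j) y +
      ((Real.sqrt h * Real.sqrt ((μ j : ℝ) / 2) : ℝ) : ℂ) *
        hermiteSchwartz h (lowerIndex μ j) y := by
  have h1 := coord_mul_hermiteProd hh μ j (μ j) y
  rw [Function.update_eq_self] at h1
  simp only [hermiteSchwartz_apply hh, raiseIndex, lowerIndex]
  rw [← Complex.ofReal_mul, h1]
  push_cast
  ring

lemma deriv_hermiteSchwartz {h : ℝ} (hh : 0 < h) (μ : Fin n → ℕ) (j : Fin n) (y : Euc n) :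
    (h : ℂ) * (∂_{(EuclideanSpace.single j (1 : ℝ) : Euc n)} (hermiteSchwartz h μ)) y =
      ((Real.sqrt h * Real.sqrt ((μ j : ℝ) / 2) : ℝ) : ℂ) *
        hermiteSchwartz h (lowerIndex μ j) y +
      ((-(Real.sqrt h * Real.sqrt (((μ j : ℝ) + 1) / 2)) : ℝ) : ℂ) *
        hermiteSchwartz h (raiseIndex μ j) y := by
  have h0 : (hermiteReal h μ : Euc n → ℝ) = hermiteProd h μ := by
    ext1 x; exact hermiteReal_apply hh _ x
  have h1 := lineDeriv_hermiteProd h μ j (μ j) y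
  rw [Function.update_eq_self] at h1
  rw [lineDerivOp_hermiteSchwartz, SchwartzMap.lineDerivOp_apply, h0, ← Complex.ofReal_mul, h1]
  simp only [hermiteSchwartz_apply hh, raiseIndex, lowerIndex]
  push_cast
  ring

/-- The indices `(h, μ)` with `0 < h ≤ 1` for which `h |μ|₁ ≤ R`. -/
def BoundedEnergy (R h : ℝ) (μ : Fin n → ℕ) : Prop :=
  0 < h ∧ h ≤ 1 ∧ h * ∑ i, (μ i : ℝ) ≤ R

lemma BoundedEnergy.raise {R h : ℝ} {μ : Fin n → ℕ} (H : BoundedEnergy R h μ) (j : Fin n) :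
    BoundedEnergy (R + 1) h (raiseIndex μ j) := by
  obtain ⟨h0, h1, h2⟩ := H
  refine ⟨h0, h1, ?_⟩
  have : ∑ i, ((raiseIndex μ j i : ℕ) : ℝ) = ∑ i, (μ i : ℝ) + 1 := by
    have e : ∀ i, ((raiseIndex μ j i : ℕ) : ℝ) = μ i + if i = j then 1 else 0 := by
      intro i
      unfold raiseIndex
      by_cases hi : i = j
      · subst hi; simp
      · simp [hi]
    simp only [e, Finset.sum_add_distrib]
    simp
  rw [this]
  nlinarith

lemma BoundedEnergy.lower {R h : ℝ} {μ : Fin n → ℕ} (H : BoundedEnergy R h μ) (j : Fin n) :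
    BoundedEnergy (R + 1) h (lowerIndex μ j) := by
  obtain ⟨h0, h1, h2⟩ := H
  refine ⟨h0, h1, ?_⟩
  have : ∑ i, ((lowerIndex μ j i : ℕ) : ℝ) ≤ ∑ i, (μ i : ℝ) := by
    refine Finset.sum_le_sum fun i _ => ?_
    unfold lowerIndex
    by_cases hi : i = j
    · subst hi; simp
    · simp [hi]
  nlinarith

lemma BoundedEnergy.nonneg {R h : ℝ} {μ : Fin n → ℕ} (H : BoundedEnergy R h μ) : 0 ≤ R :=
  (mul_nonneg H.1.le (Finset.sum_nonneg fun _ _ => Nat.cast_nonneg _)).trans H.2.2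

/-- The coefficient is √(h (μ_j + 1) / 2), so only the product h μ_j matters. This is where bounded
energy makes the ladder operators bounded although μ itself is unbounded. -/
lemma BoundedEnergy.coeff_raise {R h : ℝ} {μ : Fin n → ℕ} (H : BoundedEnergy R h μ) (j : Fin n) :
    Real.sqrt h * Real.sqrt (((μ j : ℝ) + 1) / 2) ≤ R + 1 := by
  have h0 := H.1
  have hR := H.nonneg
  have h1 : h * (μ j : ℝ) ≤ R := by
    refine le_trans ?_ H.2.2
    exact mul_le_mul_of_nonneg_left (Finset.single_le_sum (f := fun i => (μ i : ℝ))
      (fun _ _ => Nat.cast_nonneg _) (Finset.mem_univ j)) h0.le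
  rw [← Real.sqrt_mul h0.le]
  refine Real.sqrt_le_iff.2 ⟨by linarith, ?_⟩
  nlinarith [H.2.1]

lemma BoundedEnergy.coeff_lower {R h : ℝ} {μ : Fin n → ℕ} (H : BoundedEnergy R h μ) (j : Fin n) :
    Real.sqrt h * Real.sqrt ((μ j : ℝ) / 2) ≤ R + 1 := by
  refine le_trans ?_ (H.coeff_raise j)
  gcongr
  linarith

/-- Multiplication by `w` is bounded on Hermite functions of bounded energy. -/
def HermiteBounded (w : Euc n → ℂ) : Prop :=
  Continuous w ∧ ∀ R : ℝ, ∃ C : ℝ≥0, ∀ (h : ℝ) (μ : Fin n → ℕ), BoundedEnergy R h μ →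
    eLpNorm (fun y => w y * hermiteSchwartz h μ y) 2 volume ≤ C

lemma HermiteBounded.one : HermiteBounded (fun _ : Euc n => 1) :=
  ⟨continuous_const, fun _ => ⟨1, fun h μ H => by
    simp only [one_mul]
    rw [eLpNorm_hermiteSchwartz H.1]; simp⟩⟩

lemma HermiteBounded.add {w w' : Euc n → ℂ} (hw : HermiteBounded w) (hw' : HermiteBounded w') :
    HermiteBounded (fun y => w y + w' y) := by
  refine ⟨hw.1.add hw'.1, fun R => ?_⟩
  obtain ⟨C, hC⟩ := hw.2 R
  obtain ⟨C', hC'⟩ := hw'.2 R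
  refine ⟨C + C', fun h μ H => ?_⟩
  have h1 : (fun y => (w y + w' y) * hermiteSchwartz h μ y) =
      (fun y => w y * hermiteSchwartz h μ y) + fun y => w' y * hermiteSchwartz h μ y := by
    ext y; simp; ring
  rw [h1]
  refine (eLpNorm_add_le (hw.1.mul (hermiteSchwartz h μ).continuous).aestronglyMeasurable
    (hw'.1.mul (hermiteSchwartz h μ).continuous).aestronglyMeasurable (by norm_num)).trans ?_
  push_cast
  exact add_le_add (hC h μ H) (hC' h μ H)

lemma HermiteBounded.sum {σ : Type*} (s : Finset σ) {w : σ → Euc n → ℂ}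
    (hw : ∀ a ∈ s, HermiteBounded (w a)) : HermiteBounded (fun y => ∑ a ∈ s, w a y) := by
  classical
  induction s using Finset.induction_on with
  | empty =>
    simp only [Finset.sum_empty]
    exact ⟨continuous_const, fun _ => ⟨0, fun h μ _ => by simp⟩⟩
  | insert a s ha ih =>
    simp only [Finset.sum_insert ha]
    exact (hw a (by simp)).add (ih fun c hc => hw c (by simp [hc]))

lemma eLpNorm_real_mul_le {X : Type*} [MeasurableSpace X] {ν : Measure X} (c : ℝ) {D : ℝ}
    (hc : |c| ≤ D) (f : X → ℂ) {C : ℝ≥0∞} (hf : eLpNorm f 2 ν ≤ C) :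
    eLpNorm (fun y => (c : ℂ) * f y) 2 ν ≤ ENNReal.ofReal D * C := by
  have : (fun y => (c : ℂ) * f y) = (c : ℂ) • f := by ext y; simp
  rw [this, eLpNorm_const_smul]
  refine mul_le_mul' ?_ hf
  rw [← ofReal_norm, Complex.norm_real, Real.norm_eq_abs]
  exact ENNReal.ofReal_le_ofReal hc

/-- A factor y_j moves to the two neighbouring Hermite functions with bounded coefficients, at the
price of energy R + 1. For this reason `HermiteBounded` asks for a bound at every R. -/
lemma HermiteBounded.mul_coord {w : Euc n → ℂ} (hw : HermiteBounded w) (j : Fin n) :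
    HermiteBounded (fun y => w y * (y j : ℂ)) := by
  refine ⟨hw.1.mul (by fun_prop), fun R => ?_⟩
  obtain ⟨C, hC⟩ := hw.2 (R + 1)
  refine ⟨(R + 1).toNNReal * C + (R + 1).toNNReal * C, fun h μ H => ?_⟩
  have h1 : (fun y => w y * (y j : ℂ) * hermiteSchwartz h μ y) =
      (fun y => ((Real.sqrt h * Real.sqrt (((μ j : ℝ) + 1) / 2) : ℝ) : ℂ) *
        (w y * hermiteSchwartz h (raiseIndex μ j) y)) +
      fun y => ((Real.sqrt h * Real.sqrt ((μ j : ℝ) / 2) : ℝ) : ℂ) *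
        (w y * hermiteSchwartz h (lowerIndex μ j) y) := by
    ext y
    rw [mul_assoc, coord_mul_hermiteSchwartz H.1, Pi.add_apply]
    ring
  rw [h1]
  have hm : ∀ ν, Continuous fun y => w y * hermiteSchwartz h ν y := fun ν =>
    hw.1.mul (hermiteSchwartz h ν).continuous
  have m1 : ∀ (r : ℂ) ν, AEStronglyMeasurable (fun y => r * (w y * hermiteSchwartz h ν y))
      volume := fun r ν => (continuous_const.mul (hm ν)).aestronglyMeasurable
  refine (eLpNorm_add_le (m1 _ (raiseIndex μ j)) (m1 _ (lowerIndex μ j)) (by norm_num)).trans ?_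
  rw [ENNReal.coe_add, ENNReal.coe_mul]
  refine add_le_add ?_ ?_
  · refine eLpNorm_real_mul_le _ ?_ _ (hC h _ (H.raise j))
    rw [abs_of_nonneg (by positivity)]
    exact H.coeff_raise j
  · refine eLpNorm_real_mul_le _ ?_ _ (hC h _ (H.lower j))
    rw [abs_of_nonneg (by positivity)]
    exact H.coeff_lower j

lemma HermiteBounded.one_add_norm_sq_pow (M : ℕ) :
    HermiteBounded (fun y : Euc n => (((1 + ‖y‖ ^ 2) ^ M : ℝ) : ℂ)) := by
  induction M with
  | zero => simpa using HermiteBounded.one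
  | succ M ih =>
    have h1 : (fun y : Euc n => (((1 + ‖y‖ ^ 2) ^ (M + 1) : ℝ) : ℂ)) = fun y =>
        (((1 + ‖y‖ ^ 2) ^ M : ℝ) : ℂ) +
          ∑ j, (((1 + ‖y‖ ^ 2) ^ M : ℝ) : ℂ) * (y j : ℂ) * (y j : ℂ) := by
      ext y
      have h2 : ‖y‖ ^ 2 = ∑ j, y j ^ 2 := by
        rw [EuclideanSpace.norm_sq_eq]; simp
      have h3 : (((1 + ‖y‖ ^ 2) ^ (M + 1) : ℝ) : ℂ) = (((1 + ‖y‖ ^ 2) ^ M : ℝ) : ℂ) *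
          (1 + ((∑ j, y j ^ 2 : ℝ) : ℂ)) := by
        rw [← h2]; push_cast; ring
      rw [h3, mul_add, mul_one]
      push_cast
      rw [Finset.mul_sum]
      congr 1
      refine Finset.sum_congr rfl fun j _ => ?_
      ring
    rw [h1]
    exact ih.add (HermiteBounded.sum _ fun j _ => (ih.mul_coord j).mul_coord j)

lemma hermite_weight_bound (M : ℕ) (R : ℝ) : ∃ C : ℝ≥0, ∀ (h : ℝ) (μ : Fin n → ℕ),
    BoundedEnergy R h μ →
    eLpNorm (fun y : Euc n => (((1 + ‖y‖) ^ M : ℝ) : ℂ) * hermiteSchwartz h μ y) 2 volume ≤ C := by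
  obtain ⟨C, hC⟩ := (HermiteBounded.one_add_norm_sq_pow (n := n) M).2 R
  refine ⟨2 ^ M * C, fun h μ H => ?_⟩
  have h1 := eLpNorm_real_mul_le (2 ^ M) (D := 2 ^ M) (by rw [abs_of_pos (by positivity)]) _
    (hC h μ H)
  rw [ENNReal.ofReal_pow (by norm_num), ENNReal.ofReal_ofNat] at h1
  rw [ENNReal.coe_mul, ENNReal.coe_pow, ENNReal.coe_ofNat]
  refine le_trans (eLpNorm_mono fun y => ?_) h1
  simp only [norm_mul, Complex.norm_real]
  rw [← mul_assoc]
  refine mul_le_mul_of_nonneg_right ?_ (norm_nonneg _)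
  rw [Real.norm_of_nonneg (by positivity), Real.norm_of_nonneg (by positivity),
    Real.norm_of_nonneg (by positivity), ← mul_pow]
  gcongr
  -- The constant 2 ^ M comes from 1 + |y| ≤ 2 (1 + |y|²).
  nlinarith [sq_nonneg (‖y‖ - 1)]

end

/-! ### Kernel bounds for symbols of order -(n+1). -/

section
variable {n : ℕ}

/-- The weight is integrable on ℝⁿ, so all derivatives of the family are bounded in L¹, and N of
them bound |w| ^ N times the Fourier transform. -/
lemma UniformSymbol.fourier_decay {κ : Type*} {g : κ → Euc n → ℂ}
    (hg : UniformSymbol (fun ξ => (1 + ‖ξ‖) ^ (-((n + 1 : ℕ) : ℤ))) g) (N : ℕ) :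
    ∃ C : ℝ, 0 ≤ C ∧ ∀ k w, (1 + ‖w‖) ^ N * ‖FourierTransform.fourier (g k) w‖ ≤ C := by
  choose A hA0 hA using hg.bound
  have hint : ∀ k j, Integrable fun ξ => ‖iteratedFDeriv ℝ j (g k) ξ‖ := fun k j =>
    (integrable_one_add_norm_zpow.const_mul (A j)).mono'
      (((hg.smooth k).continuous_iteratedFDeriv (m := j) (mod_cast le_top)).norm).aestronglyMeasurable
      (Eventually.of_forall fun ξ => by rw [norm_norm]; exact hA j k ξ)
  have hI : ∀ k j, ∫ ξ, ‖iteratedFDeriv ℝ j (g k) ξ‖ ≤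
      A j * ∫ ξ : Euc n, (1 + ‖ξ‖) ^ (-((n + 1 : ℕ) : ℤ)) := by
    intro k j
    rw [← integral_const_mul]
    exact integral_mono (hint k j) (integrable_one_add_norm_zpow.const_mul _) (hA j k)
  have h1 : ∀ N : ℕ, ∃ C : ℝ, 0 ≤ C ∧ ∀ k w,
      ‖w‖ ^ N * ‖FourierTransform.fourier (g k) w‖ ≤ C := by
    intro N
    refine ⟨2 ^ N * ∑ j ∈ Finset.range (N + 1),
      A j * ∫ ξ : Euc n, (1 + ‖ξ‖) ^ (-((n + 1 : ℕ) : ℤ)), ?_, fun k w => ?_⟩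
    · refine mul_nonneg (by positivity) (Finset.sum_nonneg fun j _ => mul_nonneg (hA0 j) ?_)
      exact integral_nonneg fun ξ => by positivity
    · have := Real.pow_mul_norm_iteratedFDeriv_fourier_le (K := 0) (N := ⊤) (f := g k)
        ((hg.smooth k).of_le (mod_cast le_rfl)) (k := 0) (n := N) (fun k' j hk _ => by
          obtain rfl : k' = 0 := by simpa using hk
          simpa using hint k j) le_rfl le_top w
      simp only [norm_iteratedFDeriv_zero] at this
      refine this.trans ?_
      simp only [zero_add, Finset.range_one, Finset.singleton_product, Finset.sum_map,
        Function.Embedding.coeFn_mk, pow_zero, one_mul]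
      rw [show (2 * ((0 : ℕ) : ℝ) + 2) = 2 by norm_num]
      exact mul_le_mul_of_nonneg_left (Finset.sum_le_sum fun j _ => hI k j) (by positivity)
  obtain ⟨C, hC0, hC⟩ := h1 N
  obtain ⟨C', hC0', hC'⟩ := h1 0
  refine ⟨2 ^ N * (C' + C), by positivity, fun k w => ?_⟩
  have h2 : (1 + ‖w‖) ^ N ≤ 2 ^ N * (1 + ‖w‖ ^ N) := by
    rcases le_total ‖w‖ 1 with h | h
    · calc (1 + ‖w‖) ^ N ≤ 2 ^ N := by gcongr; linarith
        _ ≤ _ := le_mul_of_one_le_right (by positivity) (by linarith [pow_nonneg (norm_nonneg w) N])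
    · calc (1 + ‖w‖) ^ N ≤ (2 * ‖w‖) ^ N := by gcongr; linarith
        _ = 2 ^ N * ‖w‖ ^ N := mul_pow _ _ _
        _ ≤ _ := by gcongr; linarith
  have h3 := hC k w
  have h4 := hC' k w
  rw [pow_zero, one_mul] at h4
  calc _ ≤ 2 ^ N * (1 + ‖w‖ ^ N) * ‖FourierTransform.fourier (g k) w‖ := by gcongr
    _ = 2 ^ N * (‖FourierTransform.fourier (g k) w‖ +
        ‖w‖ ^ N * ‖FourierTransform.fourier (g k) w‖) := by ring
    _ ≤ _ := by gcongr

/-- Division by (1 + |x|) ^ M makes the symbols in ξ uniform over all positions, so x may be treated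
as one more index. -/
lemma UniformSymbol.momentum_slice {ι : Type*} {M : ℕ} {L : ℤ} {b : ι → Euc n × Euc n → ℂ}
    (hb : UniformSymbol (pairWeight M L) b) :
    UniformSymbol (fun ξ => (1 + ‖ξ‖) ^ L) (fun (p : ι × Euc n) (ξ : Euc n) =>
      (((1 + ‖p.2‖) ^ M)⁻¹ : ℝ) • b p.1 (p.2, ξ)) := by
  have h := (hb.reindex (Prod.fst : ι × Euc n → ι)).comp_affine_smul
    (fun p => ((1 + ‖p.2‖) ^ M)⁻¹) (fun p => by positivity)
    (fun _ => ContinuousLinearMap.inr ℝ (Euc n) (Euc n)) (fun p => (p.2, 0)) 1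
    (fun _ => ContinuousLinearMap.norm_inr_le_one ℝ _ _) (w' := fun ξ => (1 + ‖ξ‖) ^ L) 1
    (fun ξ => by positivity) (fun p ξ => by
      simp only [pairWeight, ContinuousLinearMap.inr_apply, Prod.mk_add_mk, add_zero, zero_add]
      rw [inv_mul_cancel_left₀ (by positivity), one_mul])
  simpa using h

/-- The kernel of the quantization of an integrable symbol. -/
noncomputable def weylKernel (h : ℝ) (b : Euc n × Euc n → ℂ) (x y : Euc n) : ℂ :=
  ∫ ξ : Euc n, Complex.exp (Complex.I * ((inner ℝ (x - y) ξ / h : ℝ) : ℂ)) *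
    b ((1 / 2 : ℝ) • (x + y), ξ)

/-- At fixed midpoint m the kernel is a Fourier transform in ξ, evaluated at a multiple of u = (x -
y) / h. The growth (1 + |m|) ^ M is transferred to y: since m = y + (h/2) u and h ≤ 1, it costs (1 +
|y|) ^ M and M powers of 1 + |u|. Decay of order M + n + 1 pays for these and leaves an integrable
function of u. -/
lemma weylKernel_le {ι : Type*} {M : ℕ} {b : ι → Euc n × Euc n → ℂ}
    (hb : UniformSymbol (pairWeight M (-((n + 1 : ℕ) : ℤ))) b) :
    ∃ C : ℝ, 0 ≤ C ∧ ∀ i h x y, 0 < h → h ≤ 1 →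
      ‖weylKernel h (b i) x y‖ ≤
        C * (1 + ‖h⁻¹ • (x - y)‖) ^ (-((n + 1 : ℕ) : ℤ)) * (1 + ‖y‖) ^ M := by
  obtain ⟨C, hC0, hC⟩ := hb.momentum_slice.fourier_decay (M + (n + 1))
  refine ⟨C * 7 ^ (M + (n + 1)), by positivity, fun i h x y hh hh1 => ?_⟩
  set m : Euc n := (1 / 2 : ℝ) • (x + y) with hm
  set u : Euc n := h⁻¹ • (x - y) with hu
  set w : Euc n := -((2 * Real.pi)⁻¹ • u) with hw
  have hK : weylKernel h (b i) x y = (((1 + ‖m‖) ^ M : ℝ) : ℂ) * FourierTransform.fourier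
      (fun ξ => (((1 + ‖m‖) ^ M)⁻¹ : ℝ) • b i (m, ξ)) w := by
    rw [Real.fourier_eq', ← integral_const_mul]
    unfold weylKernel
    congr 1 with ξ
    rw [smul_eq_mul, Complex.real_smul, ← hm]
    have e1 : ((inner ℝ (x - y) ξ / h : ℝ) : ℂ) = ((-2 * Real.pi * inner ℝ ξ w : ℝ) : ℂ) := by
      congr 1
      rw [hw, inner_neg_right, inner_smul_right, hu, inner_smul_right, real_inner_comm]
      field_simp
    have e2 : (((1 + ‖m‖) ^ M : ℝ) : ℂ) * ((((1 + ‖m‖) ^ M)⁻¹ : ℝ) : ℂ) = 1 := by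
      rw [← Complex.ofReal_mul, mul_inv_cancel₀ (by positivity), Complex.ofReal_one]
    rw [e1, mul_comm Complex.I]
    linear_combination (-Complex.exp (((-2 * Real.pi * inner ℝ ξ w : ℝ) : ℂ) * Complex.I) *
      b i (m, ξ)) * e2
  -- The 7 is a bound for 2π, the ratio of |u| to |w|.
  have hwn : 1 + ‖u‖ ≤ 7 * (1 + ‖w‖) := by
    have : ‖w‖ = (2 * Real.pi)⁻¹ * ‖u‖ := by
      rw [hw, norm_neg, norm_smul, Real.norm_of_nonneg (by positivity)]
    have h2 : ‖u‖ = 2 * Real.pi * ‖w‖ := by rw [this]; field_simp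
    rw [h2]
    nlinarith [Real.pi_lt_d2, norm_nonneg w]
  have hmn : 1 + ‖m‖ ≤ (1 + ‖y‖) * (1 + ‖u‖) := by
    have e : m = y + ((1 / 2 : ℝ) * h) • u := by
      rw [hm, hu, smul_smul, mul_assoc, mul_inv_cancel₀ hh.ne', mul_one, smul_add, smul_sub]
      have : y = (1 / 2 : ℝ) • y + (1 / 2 : ℝ) • y := by rw [← add_smul]; norm_num
      nth_rewrite 2 [this]
      abel
    have h1 : ‖m‖ ≤ ‖y‖ + ‖u‖ := by
      rw [e]
      refine (norm_add_le _ _).trans ?_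
      rw [norm_smul, Real.norm_of_nonneg (by positivity)]
      nlinarith [norm_nonneg u]
    nlinarith [norm_nonneg u, norm_nonneg y, mul_nonneg (norm_nonneg u) (norm_nonneg y)]
  have hF := hC (i, m) w
  set F := ‖FourierTransform.fourier (fun ξ => (((1 + ‖m‖) ^ M)⁻¹ : ℝ) • b i (m, ξ)) w‖ with hFd
  have hF' : (1 + ‖u‖) ^ (M + (n + 1)) * F ≤ C * 7 ^ (M + (n + 1)) := by
    calc _ ≤ (7 * (1 + ‖w‖)) ^ (M + (n + 1)) * F := by gcongr
      _ = 7 ^ (M + (n + 1)) * ((1 + ‖w‖) ^ (M + (n + 1)) * F) := by rw [mul_pow]; ring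
      _ ≤ 7 ^ (M + (n + 1)) * C := by gcongr
      _ = _ := mul_comm _ _
  rw [hK, norm_mul, Complex.norm_real, Real.norm_of_nonneg (by positivity), ← hFd, zpow_neg,
    zpow_natCast]
  have hu0 : (0 : ℝ) < (1 + ‖u‖) ^ (n + 1) := by positivity
  rw [mul_right_comm, ← div_eq_mul_inv, le_div_iff₀ hu0]
  calc (1 + ‖m‖) ^ M * F * (1 + ‖u‖) ^ (n + 1)
      ≤ ((1 + ‖y‖) * (1 + ‖u‖)) ^ M * F * (1 + ‖u‖) ^ (n + 1) := by
        gcongr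
    _ = ((1 + ‖u‖) ^ (M + (n + 1)) * F) * (1 + ‖y‖) ^ M := by rw [mul_pow, pow_add]; ring
    _ ≤ _ := by gcongr

lemma weylPair_eq_integral_kernel {ι : Type*} {M : ℕ} {b : ι → Euc n × Euc n → ℂ}
    (hb : UniformSymbol (pairWeight M (-((n + 1 : ℕ) : ℤ))) b) (h : ℝ) (v : 𝓢(Euc n, ℂ))
    (x : Euc n) (i : ι) :
    weylPair h (b i) v x =
      ((((2 * Real.pi * h) ^ n)⁻¹ : ℝ) : ℂ) * ∫ y, weylKernel h (b i) x y * v y := by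
  obtain ⟨C, hC0, hC⟩ := hb.norm_le
  rw [weylPair_eq]
  congr 1
  unfold weylInner
  rw [integral_integral_swap]
  · congr 1 with y
    rw [weylKernel, ← integral_mul_const]
  · have h1 : Integrable fun p : Euc n × Euc n =>
        (C * (1 + ‖x‖) ^ M * (1 + ‖p.1‖) ^ (-((n + 1 : ℕ) : ℤ))) * ((1 + ‖p.2‖) ^ M * ‖v p.2‖) :=
      (integrable_one_add_norm_zpow.const_mul (C * (1 + ‖x‖) ^ M)).mul_prod
        (integrable_one_add_norm_pow_mul v M)
    refine h1.mono' ?_ (Eventually.of_forall fun p => ?_)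
    · have hc : Continuous (Function.uncurry fun (_ : Unit) => b i) :=
        (hb.smooth i).continuous.comp continuous_snd
      have := (continuous_integrand hc v.continuous h).comp
        (f := fun p : Euc n × Euc n => ((((), x), p.1), p.2)) (by fun_prop)
      exact this.aestronglyMeasurable
    · exact norm_integrand_le hC0 hC v h i x p.1 p.2

/-- The kernel is dominated by a convolution kernel acting on (1 + |y|) ^ M v. Its L¹ norm does not
depend on h, since the prefactor h⁻ⁿ cancels the Jacobian of z ↦ z / h; Young's inequality then
applies. -/
lemma weylPair_Lp_base {ι : Type*} {M : ℕ} {b : ι → Euc n × Euc n → ℂ}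
    (hb : UniformSymbol (pairWeight M (-((n + 1 : ℕ) : ℤ))) b) :
    ∃ C : ℝ≥0, ∀ (i : ι) (h : ℝ) (v : 𝓢(Euc n, ℂ)), 0 < h → h ≤ 1 →
      eLpNorm (weylPair h (b i) v) 2 volume ≤
        C * eLpNorm (fun y => (((1 + ‖y‖) ^ M : ℝ) : ℂ) * v y) 2 volume := by
  obtain ⟨C, hC0, hC⟩ := weylKernel_le hb
  set I : ℝ := ∫ u : Euc n, (1 + ‖u‖) ^ (-((n + 1 : ℕ) : ℤ)) with hI
  have hI0 : 0 ≤ I := integral_nonneg fun u => by positivity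
  refine ⟨(((2 * Real.pi) ^ n)⁻¹ * C * I).toNNReal, fun i h v hh hh1 => ?_⟩
  set k : Euc n → ℝ := fun z => ((2 * Real.pi * h) ^ n)⁻¹ * C *
    (1 + ‖h⁻¹ • z‖) ^ (-((n + 1 : ℕ) : ℤ)) with hk
  have hk0 : ∀ z, 0 ≤ k z := fun z => by simp only [hk]; positivity
  have hkc : Continuous k := by
    simp only [hk, zpow_neg, zpow_natCast]
    refine continuous_const.mul (Continuous.inv₀ (by fun_prop) fun z => ?_)
    positivity
  set f : Euc n → ℂ := fun y => (((1 + ‖y‖) ^ M : ℝ) : ℂ) * v y with hf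
  have hfc : Continuous f := by
    have := v.continuous
    simp only [hf]; fun_prop
  have hkI : ∫⁻ z, ENNReal.ofReal (k z) = ENNReal.ofReal (((2 * Real.pi) ^ n)⁻¹ * C * I) := by
    have hki : Integrable k :=
      ((integrable_one_add_norm_zpow (n := n)).comp_smul (inv_ne_zero hh.ne')).const_mul _
    rw [← ofReal_integral_eq_lintegral_ofReal hki (Eventually.of_forall hk0)]
    congr 1
    simp only [hk]
    rw [integral_const_mul, Measure.integral_comp_inv_smul_of_nonneg volume
      (fun u : Euc n => (1 + ‖u‖) ^ (-((n + 1 : ℕ) : ℤ))) hh.le, finrank_euclideanSpace,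
      Fintype.card_fin, smul_eq_mul, ← hI, mul_pow]
    field_simp
  have hpt : ∀ x, ‖weylPair h (b i) v x‖ₑ ≤ ∫⁻ y, ENNReal.ofReal (k (x - y)) * ‖f y‖ₑ := by
    intro x
    rw [weylPair_eq_integral_kernel hb h v x i, ← integral_const_mul]
    refine (enorm_integral_le_lintegral_enorm _).trans (lintegral_mono fun y => ?_)
    rw [← ofReal_norm, ← ofReal_norm, ← ENNReal.ofReal_mul (hk0 _)]
    refine ENNReal.ofReal_le_ofReal ?_
    simp only [norm_mul, hf, Complex.norm_real, hk]
    rw [Real.norm_of_nonneg (by positivity), Real.norm_of_nonneg (by positivity)]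
    have := hC i h x y hh hh1
    calc _ ≤ ((2 * Real.pi * h) ^ n)⁻¹ *
          (C * (1 + ‖h⁻¹ • (x - y)‖) ^ (-((n + 1 : ℕ) : ℤ)) * (1 + ‖y‖) ^ M * ‖v y‖) := by gcongr
      _ = _ := by ring
  have hsq : eLpNorm (weylPair h (b i) v) 2 volume ^ 2 ≤
      (((((2 * Real.pi) ^ n)⁻¹ * C * I).toNNReal : ℝ≥0∞) * eLpNorm f 2 volume) ^ 2 := by
    rw [mul_pow, eLpNorm_two_sq, eLpNorm_two_sq]
    calc _ ≤ ∫⁻ x, (∫⁻ y, ENNReal.ofReal (k (x - y)) * ‖f y‖ₑ) ^ 2 :=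
          lintegral_mono fun x => by gcongr; exact hpt x
      _ ≤ (∫⁻ z, ENNReal.ofReal (k z)) ^ 2 * ∫⁻ y, ‖f y‖ₑ ^ 2 :=
          lintegral_convolution_sq_le (k := fun z => ENNReal.ofReal (k z))
            (hkc.measurable.ennreal_ofReal) hfc.measurable.enorm
      _ = _ := by rw [hkI]; rfl
  exact (ENNReal.pow_le_pow_left_iff two_ne_zero).1 hsq

end

/-! ### Symbols of any order on Hermite functions of bounded energy. -/

section
variable {n : ℕ} {ι : Type*}

lemma eLpNorm_const_mul_le {X : Type*} [MeasurableSpace X] {ν : Measure X} (c : ℂ) {D : ℝ}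
    (hc : ‖c‖ ≤ D) (f : X → ℂ) {C : ℝ≥0∞} (hf : eLpNorm f 2 ν ≤ C) :
    eLpNorm (fun y => c * f y) 2 ν ≤ ENNReal.ofReal D * C := by
  have : (fun y => c * f y) = c • f := by ext y; simp
  rw [this, eLpNorm_const_smul]
  refine mul_le_mul' ?_ hf
  rw [← ofReal_norm]
  exact ENNReal.ofReal_le_ofReal hc

/-- The quantizations of a family of symbols are uniformly bounded on Hermite functions of
bounded energy. -/
def WeylBounded (b : ι → Euc n × Euc n → ℂ) : Prop :=
  ∀ R : ℝ, ∃ C : ℝ≥0, ∀ (i : ι) (h : ℝ) (μ : Fin n → ℕ), BoundedEnergy R h μ →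
    eLpNorm (weylPair h (b i) (hermiteSchwartz h μ)) 2 volume ≤ C

lemma WeylBounded.add {M : ℕ} {L : ℤ} {b b' : ι → Euc n × Euc n → ℂ}
    (hb : UniformSymbol (pairWeight M L) b) (hb' : UniformSymbol (pairWeight M L) b')
    (h1 : WeylBounded b) (h2 : WeylBounded b') : WeylBounded (fun i z => b i z + b' i z) := by
  intro R
  obtain ⟨C, hC⟩ := h1 R
  obtain ⟨C', hC'⟩ := h2 R
  refine ⟨C + C', fun i h μ H => ?_⟩
  have e : weylPair h (fun z => b i z + b' i z) (hermiteSchwartz h μ) =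
      weylPair h (b i) (hermiteSchwartz h μ) + weylPair h (b' i) (hermiteSchwartz h μ) := by
    ext1 x
    exact weylPair_add_left H.1.ne' hb hb' _ x i
  rw [e, ENNReal.coe_add]
  exact (eLpNorm_add_le
    (stronglyMeasurable_weylPair_right (hb.smooth i).continuous
      (hermiteSchwartz h μ).continuous h).aestronglyMeasurable
    (stronglyMeasurable_weylPair_right (hb'.smooth i).continuous
      (hermiteSchwartz h μ).continuous h).aestronglyMeasurable (by norm_num)).trans
    (add_le_add (hC i h μ H) (hC' i h μ H))

lemma WeylBounded.sum {σ : Type*} (s : Finset σ) {M : ℕ} {L : ℤ}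
    {b : σ → ι → Euc n × Euc n → ℂ}
    (hb : ∀ a ∈ s, UniformSymbol (pairWeight M L) (b a)) (h : ∀ a ∈ s, WeylBounded (b a)) :
    WeylBounded (fun i z => ∑ a ∈ s, b a i z) := by
  classical
  induction s using Finset.induction_on with
  | empty =>
    simp only [Finset.sum_empty]
    refine fun R => ⟨0, fun i h μ _ => ?_⟩
    have : weylPair h (fun _ : Euc n × Euc n => 0) (hermiteSchwartz h μ) = 0 := by
      ext1 x; exact weylPair_zero_left h _ x
    rw [this]; simp
  | insert a s ha ih =>
    simp only [Finset.sum_insert ha]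
    exact WeylBounded.add (hb a (by simp)) (UniformSymbol.sum s b (pairWeight_nonneg M L)
      fun c hc => hb c (by simp [hc])) (h a (by simp))
      (ih (fun c hc => hb c (by simp [hc])) (fun c hc => h c (by simp [hc])))

/-- By `weylPair_inner_mul`, a factor ξ_j becomes h ∂_j acting on the Hermite function, plus h times
the quantization of a position derivative. The ladder relations turn h ∂_j into bounded combinations
of neighbouring Hermite functions, so a factor ξ_j does not spoil boundedness. -/
lemma WeylBounded.coord_mul {M : ℕ} {L : ℤ} {b : ι → Euc n × Euc n → ℂ}
    (hb : UniformSymbol (pairWeight M L) b) (j : Fin n) (h1 : WeylBounded b)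
    (h2 : WeylBounded (fun i z => fderiv ℝ (b i) z (EuclideanSpace.single j (1 : ℝ), 0))) :
    WeylBounded (fun i z =>
      ((inner ℝ (EuclideanSpace.single j (1 : ℝ) : Euc n) z.2 : ℝ) : ℂ) * b i z) := by
  intro R
  obtain ⟨C, hC⟩ := h1 (R + 1)
  obtain ⟨C', hC'⟩ := h2 R
  refine ⟨(R + 1).toNNReal * C + (R + 1).toNNReal * C + 1 * C', fun i h μ H => ?_⟩
  set e : Euc n := EuclideanSpace.single j (1 : ℝ) with he
  have hb' := hb.fderiv_apply (e, (0 : Euc n))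
  set α : ℝ := Real.sqrt h * Real.sqrt ((μ j : ℝ) / 2) with hα
  set β : ℝ := Real.sqrt h * Real.sqrt (((μ j : ℝ) + 1) / 2) with hβ
  have hm : ∀ (c : ℂ) ν, AEStronglyMeasurable
      (fun x => c * weylPair h (b i) (hermiteSchwartz h ν) x) volume := fun c ν =>
    ((stronglyMeasurable_weylPair_right (hb.smooth i).continuous
      (hermiteSchwartz h ν).continuous h).const_mul c).aestronglyMeasurable
  have hm' : AEStronglyMeasurable (fun x => (-(Complex.I * h / 2)) *
      weylPair h (fun z => fderiv ℝ (b i) z (e, 0)) (hermiteSchwartz h μ) x) volume :=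
    ((stronglyMeasurable_weylPair_right (hb'.smooth i).continuous
      (hermiteSchwartz h μ).continuous h).const_mul _).aestronglyMeasurable
  have key : weylPair h (fun z => ((inner ℝ e z.2 : ℝ) : ℂ) * b i z) (hermiteSchwartz h μ) =
      ((fun x => (-Complex.I * α) * weylPair h (b i) (hermiteSchwartz h (lowerIndex μ j)) x) +
      fun x => (Complex.I * β) * weylPair h (b i) (hermiteSchwartz h (raiseIndex μ j)) x) +
      fun x => (-(Complex.I * h / 2)) *
        weylPair h (fun z => fderiv ℝ (b i) z (e, 0)) (hermiteSchwartz h μ) x := by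
    ext1 x
    rw [weylPair_inner_mul H.1.ne' hb]
    have e1 : (h : ℂ) * weylPair h (b i) (∂_{e} (hermiteSchwartz h μ) : 𝓢(Euc n, ℂ)) x =
        α * weylPair h (b i) (hermiteSchwartz h (lowerIndex μ j)) x +
        ((-β : ℝ) : ℂ) * weylPair h (b i) (hermiteSchwartz h (raiseIndex μ j)) x := by
      rw [← weylPair_smul_right, ← weylPair_smul_right, ← weylPair_smul_right]
      have e2 : (fun y => (h : ℂ) * (∂_{e} (hermiteSchwartz h μ) : 𝓢(Euc n, ℂ)) y) = fun y =>
          ((α : ℂ) • hermiteSchwartz h (lowerIndex μ j)) y +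
          (((-β : ℝ) : ℂ) • hermiteSchwartz h (raiseIndex μ j)) y := by
        ext1 y
        rw [deriv_hermiteSchwartz H.1]
        rfl
      rw [e2, weylPair_add_right H.1.ne' hb]
      rfl
    simp only [Pi.add_apply]
    rw [Complex.ofReal_neg] at e1
    linear_combination (-Complex.I) * e1
  rw [key, ENNReal.coe_add, ENNReal.coe_add, ENNReal.coe_mul, ENNReal.coe_mul]
  refine (eLpNorm_add_le ((hm _ _).add (hm _ _)) hm' (by norm_num)).trans (add_le_add ?_ ?_)
  · refine (eLpNorm_add_le (hm _ _) (hm _ _) (by norm_num)).trans (add_le_add ?_ ?_)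
    · refine eLpNorm_const_mul_le _ ?_ _ (hC i h _ (H.lower j))
      rw [norm_mul, norm_neg, Complex.norm_I, one_mul, Complex.norm_real,
        Real.norm_of_nonneg (by positivity)]
      exact H.coeff_lower j
    · refine eLpNorm_const_mul_le _ ?_ _ (hC i h _ (H.raise j))
      rw [norm_mul, Complex.norm_I, one_mul, Complex.norm_real,
        Real.norm_of_nonneg (by positivity)]
      exact H.coeff_raise j
  · have := eLpNorm_const_mul_le (-(Complex.I * h / 2)) (D := 1) (by
      rw [norm_neg, norm_div, norm_mul, Complex.norm_I, one_mul, Complex.norm_real,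
        Real.norm_of_nonneg H.1.le, Complex.norm_ofNat]
      linarith [H.2.1]) _ (hC' i h μ H)
    simpa using this

lemma uniformSymbol_momentum_coord (j : Fin n) :
    UniformSymbol (pairWeight 0 1) (fun (_ : ι) (z : Euc n × Euc n) =>
      ((inner ℝ (EuclideanSpace.single j (1 : ℝ) : Euc n) z.2 : ℝ) : ℂ)) := by
  have h1 := uniformSymbol_clm (ι := ι)
    (Complex.ofRealCLM.comp (innerSL ℝ (EuclideanSpace.single j (1 : ℝ) : Euc n)))
  have h2 := h1.comp_affine (fun _ => ContinuousLinearMap.snd ℝ (Euc n) (Euc n)) (fun _ => 0) 1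
    (fun _ => ContinuousLinearMap.norm_snd_le ℝ _ _) (w' := pairWeight 0 1) 1
    (pairWeight_nonneg 0 1) (fun i z => by simp [pairWeight])
  simpa using h2

lemma uniformSymbol_momentum_bracket :
    UniformSymbol (pairWeight 0 (-2)) (fun (_ : ι) (z : Euc n × Euc n) =>
      (((1 + ‖z.2‖ ^ 2)⁻¹ : ℝ) : ℂ)) := by
  have h1 := uniformSymbol_inv_one_add_norm_sq (ι := ι) (H := Euc n)
  have h2 := h1.comp_affine (fun _ => ContinuousLinearMap.snd ℝ (Euc n) (Euc n)) (fun _ => 0) 1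
    (fun _ => ContinuousLinearMap.norm_snd_le ℝ _ _) (w' := pairWeight 0 (-2)) 2
    (pairWeight_nonneg 0 (-2)) (fun i z => by
      simp only [pairWeight, zero_add, ContinuousLinearMap.coe_snd', pow_zero, one_mul]
      rw [zpow_neg, inv_le_iff_one_le_mul₀ (by positivity), mul_right_comm, ← div_eq_mul_inv,
        one_le_div (by positivity)]
      norm_cast
      nlinarith [sq_nonneg (‖z.2‖ - 1)])
  simpa using h2

lemma UniformSymbol.pair_mul {M M' : ℕ} {L L' : ℤ} {b b' : ι → Euc n × Euc n → ℂ}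
    (hb : UniformSymbol (pairWeight M L) b) (hb' : UniformSymbol (pairWeight M' L') b') :
    UniformSymbol (pairWeight (M + M') (L + L')) (fun i z => b i z * b' i z) := by
  refine (hb.mul hb').mono 1 (pairWeight_nonneg _ _) fun z => ?_
  unfold pairWeight
  rw [one_mul, pow_add, zpow_add₀ (by positivity)]
  exact le_of_eq (by ring)

lemma UniformSymbol.pair_mono {M M' : ℕ} {L L' : ℤ} {b : ι → Euc n × Euc n → ℂ}
    (hb : UniformSymbol (pairWeight M L) b) (hM : M ≤ M') (hL : L ≤ L') :
    UniformSymbol (pairWeight M' L') b := by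
  refine hb.mono 1 (pairWeight_nonneg _ _) fun z => ?_
  unfold pairWeight
  rw [one_mul]
  gcongr <;> simp

/-- Quantizations of bounded families of symbols of any order are uniformly bounded on Hermite
functions of bounded energy. -/
theorem UniformSymbol.weylBounded {M : ℕ} {L : ℤ} {b : ι → Euc n × Euc n → ℂ}
    (hb : UniformSymbol (pairWeight M L) b) : WeylBounded b := by
  -- Induction on the excess of the order over -(n+1), where the kernel estimate applies.
  have main : ∀ (k : ℕ) (b : ι → Euc n × Euc n → ℂ),
      UniformSymbol (pairWeight M (-((n + 1 : ℕ) : ℤ) + k)) b → WeylBounded b := by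
    intro k
    induction k with
    | zero =>
      intro b hb R
      obtain ⟨C, hC⟩ := weylPair_Lp_base (by simpa using hb)
      obtain ⟨D, hD⟩ := hermite_weight_bound (n := n) M R
      refine ⟨C * D, fun i h μ H => (hC i h _ H.1 H.2.1).trans ?_⟩
      rw [ENNReal.coe_mul]
      exact mul_le_mul' le_rfl (hD h μ H)
    | succ k ih =>
      intro b hb
      set L : ℤ := -((n + 1 : ℕ) : ℤ) + k with hL
      have hb1 : UniformSymbol (pairWeight M (L + 1)) b := by
        have : L + 1 = -((n + 1 : ℕ) : ℤ) + ((k + 1 : ℕ) : ℤ) := by push_cast; omega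
        rwa [this]
      set p : Euc n × Euc n → ℂ := fun z => (((1 + ‖z.2‖ ^ 2)⁻¹ : ℝ) : ℂ) with hp
      have hg : UniformSymbol (pairWeight M (L - 1)) (fun i z => p z * b i z) :=
        (uniformSymbol_momentum_bracket.pair_mul hb1).pair_mono (by simp) (by omega)
      set q : Fin n → Euc n × Euc n → ℂ := fun j z =>
        ((inner ℝ (EuclideanSpace.single j (1 : ℝ) : Euc n) z.2 : ℝ) : ℂ) with hq
      have hgj : ∀ j, UniformSymbol (pairWeight M L) (fun i z => q j z * (p z * b i z)) := fun j =>
        ((uniformSymbol_momentum_coord j).pair_mul hg).pair_mono (by simp) (by omega)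
      have hgjj : ∀ j, UniformSymbol (pairWeight M (L + 1))
          (fun i z => q j z * (q j z * (p z * b i z))) := fun j =>
        ((uniformSymbol_momentum_coord j).pair_mul (hgj j)).pair_mono (by simp) (by omega)
      -- The identity 1 = p + Σ ξ_j² p with p = (1 + |ξ|²)⁻¹. For b of order L + 1, p b has order L
      -- - 1 and ξ_j p b order L, so the induction hypothesis covers both. The last factor ξ_j is
      -- handled by `WeylBounded.coord_mul`.
      have e : b = fun i z => p z * b i z + ∑ j, q j z * (q j z * (p z * b i z)) := by
        ext i z
        have h1 : ‖z.2‖ ^ 2 = ∑ j, z.2 j ^ 2 := by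
          rw [EuclideanSpace.norm_sq_eq]; simp
        have h2 : ∀ j, q j z = ((z.2 j : ℝ) : ℂ) := by
          intro j; simp [hq, EuclideanSpace.inner_single_left]
        have h3 : ∀ j, q j z * (q j z * (p z * b i z)) = ((z.2 j ^ 2 : ℝ) : ℂ) * (p z * b i z) := by
          intro j; rw [h2]; push_cast; ring
        simp only [h3]
        rw [← Finset.sum_mul, ← Complex.ofReal_sum, ← h1, ← one_add_mul, ← mul_assoc]
        simp only [hp]
        rw [← Complex.ofReal_one, ← Complex.ofReal_add, ← Complex.ofReal_mul,
          mul_inv_cancel₀ (by positivity), Complex.ofReal_one, one_mul]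
      rw [e]
      refine WeylBounded.add (hg.pair_mono le_rfl (by omega)) (UniformSymbol.sum Finset.univ
        (fun j i z => q j z * (q j z * (p z * b i z))) (pairWeight_nonneg M (L + 1))
        fun j _ => hgjj j) (ih _ (hg.pair_mono le_rfl (by omega))) ?_
      exact WeylBounded.sum Finset.univ (fun j _ => hgjj j) fun j _ =>
        WeylBounded.coord_mul (hgj j) j (ih _ (hgj j)) (ih _ ((hgj j).fderiv_apply _))
  exact main (L.toNat + (n + 1)) b (hb.pair_mono le_rfl (by omega))

end

/-! ### Fourier modes in the angular variable. -/

section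
variable {n : ℕ} {ι : Type*}

/-- The restriction of a function on phase space to fixed `(t, τ)`. -/
def phaseSlice (b : Phase n → ℂ) (t τ : ℝ) : Euc n × Euc n → ℂ := fun z => b (z.1, z.2, t, τ)

/-- The oscillating factor `exp (-i k t)`. -/
noncomputable def angleExp (k : ℤ) (t : ℝ) : ℂ := Complex.exp (-(Complex.I * (((k : ℝ) * t : ℝ) : ℂ)))

/-- The `l`-th Fourier mode of the quantization of `b` applied to `v x * exp (i m t)`. -/
noncomputable def weylCoeff (h : ℝ) (b : Phase n → ℂ) (v : Euc n → ℂ) (m l : ℤ) (x : Euc n) : ℂ :=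
  (((2 * Real.pi)⁻¹ : ℝ) : ℂ) * ∫ t in (0 : ℝ)..(2 * Real.pi),
    angleExp (l - 2 * m) t * weylPair h (phaseSlice b t (h * l / 2)) v x

lemma norm_angleExp (k : ℤ) (t : ℝ) : ‖angleExp k t‖ = 1 := by
  rw [angleExp, ← mul_neg, ← Complex.ofReal_neg, mul_comm, Complex.norm_exp_ofReal_mul_I]

lemma angleExp_add (k l : ℤ) (t : ℝ) : angleExp (k + l) t = angleExp k t * angleExp l t := by
  rw [angleExp, angleExp, angleExp, ← Complex.exp_add]
  congr 1
  push_cast; ring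

lemma angleExp_periodic (k : ℤ) : Function.Periodic (angleExp k) (2 * Real.pi) := by
  intro t
  rw [angleExp, angleExp, Complex.exp_eq_exp_iff_exists_int]
  exact ⟨-k, by push_cast; ring⟩

lemma continuous_angleExp (k : ℤ) : Continuous (angleExp k) := by
  unfold angleExp; fun_prop

lemma hasDerivAt_angleExp (k : ℤ) (t : ℝ) :
    HasDerivAt (angleExp k) (-(Complex.I * k) * angleExp k t) t := by
  have h1 : HasDerivAt (fun t : ℝ => -(Complex.I * (((k : ℝ) * t : ℝ) : ℂ)))
      (-(Complex.I * (((k : ℝ) * 1 : ℝ) : ℂ))) t :=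
    ((((hasDerivAt_id t).const_mul (k : ℝ)).ofReal_comp).const_mul Complex.I).neg
  have h2 := h1.cexp
  refine h2.congr_deriv ?_
  rw [angleExp]; push_cast; ring

lemma PeriodicInT.phaseSlice {b : Phase n → ℂ} (hb : PeriodicInT b) (t τ : ℝ) :
    phaseSlice b (t + 2 * Real.pi) τ = phaseSlice b t τ := by
  ext1 z
  exact hb z.1 z.2 t τ

/-- The substitution s ↦ t - s/2 maps the interval of length 4π onto one full period and separates
the phases. The l-th term sends frequency m to l - m, with τ evaluated at h l / 2, the mean of the
incoming and outgoing momenta, and it sees the Fourier coefficient of the symbol at l - 2m. -/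
lemma weylOp_eq_tsum (h : ℝ) {b : Phase n → ℂ} (hb : PeriodicInT b) (v : Euc n → ℂ) (m : ℤ)
    (z : Euc n × ℝ) :
    weylOp h b (fun w => v w.1 * Complex.exp (Complex.I * (((m : ℝ) * w.2 : ℝ) : ℂ))) z =
      ∑' l : ℤ, angleExp (m - l) z.2 * weylCoeff h b v m l z.1 := by
  obtain ⟨x, t⟩ := z
  unfold weylOp
  congr 1 with l
  set P : ℝ → ℂ := fun t => angleExp (l - 2 * m) t * weylPair h (phaseSlice b t (h * l / 2)) v x
    with hP
  have hPp : Function.Periodic P (2 * Real.pi) := by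
    intro t
    simp only [hP]
    rw [angleExp_periodic, hb.phaseSlice]
  have h1 : ∀ s : ℝ, Complex.exp (Complex.I * (((l : ℝ) * s / 2 : ℝ) : ℂ)) *
        weylRn h (fun y ξ => b (y, ξ, t - s / 2, h * (l : ℝ) / 2))
          (fun y => v y * Complex.exp (Complex.I * (((m : ℝ) * (t - s) : ℝ) : ℂ))) x =
      angleExp (m - l) t * P (t - s / 2) := by
    intro s
    have e1 := weylPair_smul_right (Complex.exp (Complex.I * (((m : ℝ) * (t - s) : ℝ) : ℂ)))
      (phaseSlice b (t - s / 2) (h * l / 2)) h v x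
    have e2 : (fun y => v y * Complex.exp (Complex.I * (((m : ℝ) * (t - s) : ℝ) : ℂ))) =
        fun y => Complex.exp (Complex.I * (((m : ℝ) * (t - s) : ℝ) : ℂ)) * v y := by
      ext1 y; ring
    have e3 : weylRn h (fun y ξ => b (y, ξ, t - s / 2, h * (l : ℝ) / 2))
          (fun y => v y * Complex.exp (Complex.I * (((m : ℝ) * (t - s) : ℝ) : ℂ))) x =
        Complex.exp (Complex.I * (((m : ℝ) * (t - s) : ℝ) : ℂ)) *
          weylPair h (phaseSlice b (t - s / 2) (h * l / 2)) v x := by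
      rw [e2]; exact e1
    rw [e3]
    simp only [hP]
    rw [← mul_assoc, ← mul_assoc, ← Complex.exp_add, angleExp, angleExp, ← Complex.exp_add]
    congr 2
    push_cast
    ring
  simp only [h1]
  rw [intervalIntegral.integral_const_mul, intervalIntegral.integral_comp_sub_div _ two_ne_zero]
  have h2 : ∫ s in (t - 2 * Real.pi / 2)..(t - -(2 * Real.pi) / 2), P s =
      ∫ s in (0 : ℝ)..(2 * Real.pi), P s := by
    have := hPp.intervalIntegral_add_eq (t - 2 * Real.pi / 2) 0
    rw [zero_add] at this
    rw [← this]
    congr 1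
    ring
  rw [h2, weylCoeff, Complex.real_smul]
  push_cast
  rw [mul_inv, mul_inv]
  ring

/-- A family of symbols on phase space, bounded with respect to the weight
`(1 + |x| + |ξ| + |τ|) ^ M`. -/
abbrev PhaseSymbol (M : ℕ) (b : ι → Phase n → ℂ) : Prop :=
  UniformSymbol (fun z => phaseWeight z ^ M) b

/-- Since 1 + |x| + |ξ| + |τ| ≤ (1 + |τ|)(1 + |x|)(1 + |ξ|), division by (1 + |τ|) ^ M makes t and τ
mere indices of a bounded family on T^*ℝⁿ. -/
lemma PhaseSymbol.slice {M : ℕ} {b : ι → Phase n → ℂ} (hb : PhaseSymbol M b) :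
    UniformSymbol (pairWeight M M) (fun p : ι × ℝ × ℝ => fun z =>
      (((1 + |p.2.2|) ^ M)⁻¹ : ℝ) • phaseSlice (b p.1) p.2.1 p.2.2 z) := by
  set A : Euc n × Euc n →L[ℝ] Phase n := (ContinuousLinearMap.fst ℝ _ _).prod
    ((ContinuousLinearMap.snd ℝ _ _).prod 0) with hA
  have h := (hb.reindex (Prod.fst : ι × ℝ × ℝ → ι)).comp_affine_smul
    (fun p => ((1 + |p.2.2|) ^ M)⁻¹) (fun p => by positivity)
    (fun _ => A) (fun p => (0, 0, p.2.1, p.2.2)) ‖A‖ (fun _ => le_rfl)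
    (w' := pairWeight M M) 1 (pairWeight_nonneg _ _) (fun p z => by
      simp only [phaseWeight, hA, ContinuousLinearMap.prod_apply, ContinuousLinearMap.coe_fst',
        ContinuousLinearMap.coe_snd', zero_apply, Prod.fst_add, Prod.snd_add,
        zero_add, add_zero, pairWeight, one_mul, zpow_natCast]
      rw [inv_mul_le_iff₀ (by positivity), ← mul_pow, ← mul_pow]
      gcongr
      have h1 := norm_nonneg z.1
      have h2 := norm_nonneg z.2
      have h3 := abs_nonneg p.2.2
      nlinarith [mul_nonneg h1 h2, mul_nonneg h1 h3, mul_nonneg h2 h3,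
        mul_nonneg h3 (mul_nonneg h1 h2)])
  simpa [hA, phaseSlice] using h

lemma PhaseSymbol.slice_fixed {M : ℕ} {b : ι → Phase n → ℂ} (hb : PhaseSymbol M b) (τ : ℝ) :
    UniformSymbol (pairWeight M M) (fun p : ι × ℝ => phaseSlice (b p.1) p.2 τ) := by
  have h1 := (hb.slice.reindex (fun p : ι × ℝ => (p.1, p.2, τ))).const_smul
    (fun _ => ((1 + |τ|) ^ M : ℝ)) _ (fun _ => le_rfl)
  have h0 : ((1 + |τ|) ^ M : ℝ) ≠ 0 := by positivity
  simpa only [smul_smul, mul_inv_cancel₀ h0, one_smul] using h1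

/-- The derivative in the angular variable. -/
noncomputable def angleDeriv (b : Phase n → ℂ) : Phase n → ℂ := fun z =>
  fderiv ℝ b z ((0, 0, 1, 0) : Phase n)

lemma PhaseSymbol.angleDeriv {M : ℕ} {b : ι → Phase n → ℂ} (hb : PhaseSymbol M b) :
    PhaseSymbol M (fun i => angleDeriv (b i)) := UniformSymbol.fderiv_apply hb _

lemma PeriodicInT.angleDeriv {b : Phase n → ℂ} (hb : PeriodicInT b) :
    PeriodicInT (angleDeriv b) := by
  intro x ξ t τ
  have h1 : b = fun z => b (z + (0, 0, 2 * Real.pi, 0)) := by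
    ext1 z
    obtain ⟨x, ξ, t, τ⟩ := z
    simpa using (hb x ξ t τ).symm
  have h2 : fderiv ℝ b (x, ξ, t, τ) = fderiv ℝ b ((x, ξ, t, τ) + (0, 0, 2 * Real.pi, 0)) := by
    conv_lhs => rw [h1]
    exact fderiv_comp_add_right _
  unfold _root_.angleDeriv
  rw [h2]
  simp

lemma hasDerivAt_phaseSlice {b : Phase n → ℂ} (hb : ContDiff ℝ ∞ b) (t τ : ℝ)
    (z : Euc n × Euc n) :
    HasDerivAt (fun t => phaseSlice b t τ z) (phaseSlice (angleDeriv b) t τ z) t := by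
  have h1 : HasDerivAt (fun t : ℝ => ((z.1, z.2, t, τ) : Phase n)) (0, 0, 1, 0) t :=
    (hasDerivAt_const t z.1).prodMk ((hasDerivAt_const t z.2).prodMk
      ((hasDerivAt_id t).prodMk (hasDerivAt_const t τ)))
  exact ((hb.differentiable (by simp)) _).hasFDerivAt.comp_hasDerivAt t h1

lemma hasDerivAt_weylPair_slice {M : ℕ} {b : Phase n → ℂ}
    (hb : PhaseSymbol M (fun _ : Unit => b)) {h : ℝ} (hh : h ≠ 0) (τ : ℝ) (v : 𝓢(Euc n, ℂ))
    (x : Euc n) (t : ℝ) :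
    HasDerivAt (fun t => weylPair h (phaseSlice b t τ) v x)
      (weylPair h (phaseSlice (angleDeriv b) t τ) v x) t :=
  hasDerivAt_weylPair hh ((hb.slice_fixed τ).reindex (fun t : ℝ => ((), t)))
    ((PhaseSymbol.angleDeriv hb).slice_fixed τ |>.reindex (fun t : ℝ => ((), t)))
    (fun s z => hasDerivAt_phaseSlice (hb.smooth ()) s τ z) v x t

lemma continuous_weylPair_slice {M : ℕ} {b : Phase n → ℂ}
    (hb : PhaseSymbol M (fun _ : Unit => b)) {h : ℝ} (hh : h ≠ 0) (τ : ℝ) (v : 𝓢(Euc n, ℂ))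
    (x : Euc n) : Continuous (fun t => weylPair h (phaseSlice b t τ) v x) :=
  continuous_iff_continuousAt.2 fun t => (hasDerivAt_weylPair_slice hb hh τ v x t).continuousAt

/-- Integration by parts over one period; periodicity of the symbol cancels the boundary terms. -/
lemma weylCoeff_angleDeriv {M : ℕ} {b : Phase n → ℂ} (hb : PhaseSymbol M (fun _ : Unit => b))
    (hp : PeriodicInT b) {h : ℝ} (hh : h ≠ 0) (v : 𝓢(Euc n, ℂ)) (m l : ℤ) (x : Euc n) :
    weylCoeff h (angleDeriv b) v m l x =
      (Complex.I * ((l - 2 * m : ℤ) : ℂ)) * weylCoeff h b v m l x := by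
  unfold weylCoeff
  have hc := continuous_weylPair_slice (PhaseSymbol.angleDeriv hb) hh (h * l / 2) v x
  have hc' := (continuous_angleExp (l - 2 * m))
  rw [intervalIntegral.integral_mul_deriv_eq_deriv_mul
    (fun t _ => hasDerivAt_angleExp (l - 2 * m) t)
    (fun t _ => hasDerivAt_weylPair_slice hb hh (h * l / 2) v x t)
    ((continuous_const.mul hc').intervalIntegrable _ _) (hc.intervalIntegrable _ _)]
  have e1 : angleExp (l - 2 * m) (2 * Real.pi) = angleExp (l - 2 * m) 0 := by
    have := angleExp_periodic (l - 2 * m) 0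
    rwa [zero_add] at this
  have e2 : phaseSlice b (2 * Real.pi) (h * l / 2) = phaseSlice b 0 (h * l / 2) := by
    have := hp.phaseSlice 0 (h * l / 2)
    rwa [zero_add] at this
  rw [e1, e2, sub_self, zero_sub, ← intervalIntegral.integral_neg]
  have e3 : ∀ t : ℝ, -(-(Complex.I * ((l - 2 * m : ℤ) : ℂ)) * angleExp (l - 2 * m) t *
      weylPair h (phaseSlice b t (h * l / 2)) v x) = (Complex.I * ((l - 2 * m : ℤ) : ℂ)) *
      (angleExp (l - 2 * m) t * weylPair h (phaseSlice b t (h * l / 2)) v x) := fun t => by ring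
  simp only [e3]
  rw [intervalIntegral.integral_const_mul]
  ring

lemma angleDeriv_iterate {M : ℕ} {b : ι → Phase n → ℂ} (hb : PhaseSymbol M b) (q : ℕ) :
    PhaseSymbol M (fun i => angleDeriv^[q] (b i)) := by
  induction q with
  | zero => exact hb
  | succ q ih =>
    simp only [Function.iterate_succ_apply']
    exact PhaseSymbol.angleDeriv ih

lemma PeriodicInT.angleDeriv_iterate {b : Phase n → ℂ} (hb : PeriodicInT b) (q : ℕ) :
    PeriodicInT (_root_.angleDeriv^[q] b) := by
  induction q with
  | zero => exact hb
  | succ q ih =>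
    rw [Function.iterate_succ_apply']
    exact ih.angleDeriv

lemma norm_weylCoeff_angleDeriv_iterate {M : ℕ} {b : Phase n → ℂ}
    (hb : PhaseSymbol M (fun _ : Unit => b))
    (hp : PeriodicInT b) {h : ℝ} (hh : h ≠ 0) (v : 𝓢(Euc n, ℂ)) (m l : ℤ) (x : Euc n) (q : ℕ) :
    ‖weylCoeff h (angleDeriv^[q] b) v m l x‖ =
      |((l - 2 * m : ℤ) : ℝ)| ^ q * ‖weylCoeff h b v m l x‖ := by
  induction q with
  | zero => simp
  | succ q ih =>
    rw [Function.iterate_succ_apply', weylCoeff_angleDeriv (_root_.angleDeriv_iterate hb q)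
      (hp.angleDeriv_iterate q) hh, norm_mul, ih, norm_mul, Complex.norm_I, one_mul,
      Complex.norm_intCast, pow_succ]
    ring

/-- Each angular derivative multiplies the mode by |l - 2m|, so bounds on a symbol and on its q-th
angular derivative give decay of order q in l - 2m. -/
lemma weylCoeff_decay {M : ℕ} {b : Phase n → ℂ}
    (hb : PhaseSymbol M (fun _ : Unit => b))
    (hp : PeriodicInT b) {h : ℝ} (hh : h ≠ 0) (v : 𝓢(Euc n, ℂ)) (m l : ℤ) (x : Euc n) (q : ℕ) :
    (1 + |((l - 2 * m : ℤ) : ℝ)|) ^ q * ‖weylCoeff h b v m l x‖ ≤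
      2 ^ q * (‖weylCoeff h b v m l x‖ + ‖weylCoeff h (angleDeriv^[q] b) v m l x‖) := by
  rw [norm_weylCoeff_angleDeriv_iterate hb hp hh]
  set k := |((l - 2 * m : ℤ) : ℝ)| with hk
  have hk0 : 0 ≤ k := abs_nonneg _
  have h2 : (1 + k) ^ q ≤ 2 ^ q * (1 + k ^ q) := by
    rcases le_total k 1 with h | h
    · calc (1 + k) ^ q ≤ 2 ^ q := by gcongr; linarith
        _ ≤ _ := le_mul_of_one_le_right (by positivity) (by linarith [pow_nonneg hk0 q])
    · calc (1 + k) ^ q ≤ (2 * k) ^ q := by gcongr; linarith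
        _ = 2 ^ q * k ^ q := mul_pow _ _ _
        _ ≤ _ := by gcongr; linarith
  calc _ ≤ 2 ^ q * (1 + k ^ q) * ‖weylCoeff h b v m l x‖ := by gcongr
    _ = _ := by ring

end

/-! ### L² norms on ℝⁿ × S¹ and Fourier modes. -/

section
variable {n : ℕ} {ι : Type*}

/-- The Lebesgue measure on a fundamental domain of the circle. -/
noncomputable abbrev circleMeasure : Measure ℝ :=
  (volume : Measure ℝ).restrict (Set.Ioc 0 (2 * Real.pi))

lemma circleMeasure_univ : circleMeasure Set.univ = ENNReal.ofReal (2 * Real.pi) := by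
  rw [Measure.restrict_apply_univ, Real.volume_Ioc, sub_zero]

lemma weylCoeff_eq (h : ℝ) (b : Phase n → ℂ) (v : Euc n → ℂ) (m l : ℤ) (x : Euc n) :
    weylCoeff h b v m l x = (((2 * Real.pi)⁻¹ : ℝ) : ℂ) *
      ∫ t, angleExp (l - 2 * m) t * weylPair h (phaseSlice b t (h * l / 2)) v x ∂circleMeasure := by
  rw [weylCoeff, intervalIntegral.integral_of_le (by positivity)]

lemma stronglyMeasurable_weylPair_slice {b : Phase n → ℂ} (hb : Continuous b) {v : Euc n → ℂ}
    (hv : Continuous v) (h τ : ℝ) :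
    StronglyMeasurable fun p : ℝ × Euc n => weylPair h (phaseSlice b p.1 τ) v p.2 := by
  refine stronglyMeasurable_weylPair (b := fun t => phaseSlice b t τ) ?_ hv h
  have : (Function.uncurry fun t => phaseSlice b t τ) =
      fun p : ℝ × (Euc n × Euc n) => b (p.2.1, p.2.2, p.1, τ) := rfl
  rw [this]
  fun_prop

lemma stronglyMeasurable_weylCoeff {b : Phase n → ℂ} (hb : Continuous b) {v : Euc n → ℂ}
    (hv : Continuous v) (h : ℝ) (m l : ℤ) : StronglyMeasurable (weylCoeff h b v m l) := by
  have h1 : weylCoeff h b v m l = fun x => (((2 * Real.pi)⁻¹ : ℝ) : ℂ) *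
      ∫ t, angleExp (l - 2 * m) t * weylPair h (phaseSlice b t (h * l / 2)) v x
        ∂circleMeasure := by
    ext1 x; exact weylCoeff_eq h b v m l x
  rw [h1]
  refine StronglyMeasurable.const_mul ?_ _
  exact StronglyMeasurable.integral_prod_left' (f := fun p : ℝ × Euc n =>
    angleExp (l - 2 * m) p.1 * weylPair h (phaseSlice b p.1 (h * l / 2)) v p.2)
    (((continuous_angleExp _).comp continuous_fst).stronglyMeasurable.mul
      (stronglyMeasurable_weylPair_slice hb hv h _))

lemma enorm_circle_average_sq_le {f : ℝ → ℂ} (hf : Measurable fun t => ‖f t‖ₑ) :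
    ‖(((2 * Real.pi)⁻¹ : ℝ) : ℂ) * ∫ t, f t ∂circleMeasure‖ₑ ^ 2 ≤
      (ENNReal.ofReal (2 * Real.pi))⁻¹ * ∫⁻ t, ‖f t‖ₑ ^ 2 ∂circleMeasure := by
  have hP0 : ENNReal.ofReal (2 * Real.pi) ≠ 0 := by
    rw [Ne, ENNReal.ofReal_eq_zero, not_le]; positivity
  have h1 : ‖(((2 * Real.pi)⁻¹ : ℝ) : ℂ)‖ₑ = (ENNReal.ofReal (2 * Real.pi))⁻¹ := by
    rw [← ofReal_norm, Complex.norm_real, Real.norm_of_nonneg (by positivity),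
      ENNReal.ofReal_inv_of_pos (by positivity)]
  have h2 := lintegral_mul_sq_le circleMeasure (k := fun _ => 1) measurable_const hf
  simp only [one_mul, lintegral_const, circleMeasure_univ] at h2
  rw [enorm_mul, h1, mul_pow]
  calc _ ≤ (ENNReal.ofReal (2 * Real.pi))⁻¹ ^ 2 * (∫⁻ t, ‖f t‖ₑ ∂circleMeasure) ^ 2 := by
        gcongr; exact enorm_integral_le_lintegral_enorm _
    _ ≤ (ENNReal.ofReal (2 * Real.pi))⁻¹ ^ 2 *
        (ENNReal.ofReal (2 * Real.pi) * ∫⁻ t, ‖f t‖ₑ ^ 2 ∂circleMeasure) := by gcongr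
    _ = _ := by
        rw [pow_two, mul_assoc, ← mul_assoc (ENNReal.ofReal (2 * Real.pi))⁻¹ (ENNReal.ofReal _),
          ENNReal.inv_mul_cancel hP0 ENNReal.ofReal_ne_top, one_mul]

/-- A mode is an average over the circle with unimodular weights, and averaging does not increase
the L² norm: Cauchy–Schwarz in t, then Tonelli. -/
lemma eLpNorm_weylCoeff_le {b : Phase n → ℂ} (hb : Continuous b) {v : Euc n → ℂ}
    (hv : Continuous v) (h : ℝ) (m l : ℤ) {B : ℝ≥0∞}
    (hB : ∀ t, eLpNorm (weylPair h (phaseSlice b t (h * l / 2)) v) 2 volume ≤ B) :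
    eLpNorm (weylCoeff h b v m l) 2 volume ≤ B := by
  refine (ENNReal.pow_le_pow_left_iff two_ne_zero).1 ?_
  rw [eLpNorm_two_sq]
  have hP0 : ENNReal.ofReal (2 * Real.pi) ≠ 0 := by
    rw [Ne, ENNReal.ofReal_eq_zero, not_le]; positivity
  have hm := stronglyMeasurable_weylPair_slice hb hv h (h * l / 2)
  have h1 : ∀ x, ‖weylCoeff h b v m l x‖ₑ ^ 2 ≤ (ENNReal.ofReal (2 * Real.pi))⁻¹ *
      ∫⁻ t, ‖weylPair h (phaseSlice b t (h * l / 2)) v x‖ₑ ^ 2 ∂circleMeasure := by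
    intro x
    have e : ∀ t, ‖angleExp (l - 2 * m) t * weylPair h (phaseSlice b t (h * l / 2)) v x‖ₑ =
        ‖weylPair h (phaseSlice b t (h * l / 2)) v x‖ₑ := by
      intro t
      rw [enorm_mul, ← ofReal_norm (angleExp _ t), norm_angleExp, ENNReal.ofReal_one, one_mul]
    rw [weylCoeff_eq]
    refine (enorm_circle_average_sq_le ?_).trans ?_
    · simp only [e]
      exact (hm.comp_measurable (g := fun t : ℝ => (t, x)) (by fun_prop)).enorm
    · simp only [e]; exact le_rfl
  calc _ ≤ ∫⁻ x, (ENNReal.ofReal (2 * Real.pi))⁻¹ *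
      ∫⁻ t, ‖weylPair h (phaseSlice b t (h * l / 2)) v x‖ₑ ^ 2 ∂circleMeasure := lintegral_mono h1
    _ = (ENNReal.ofReal (2 * Real.pi))⁻¹ *
      ∫⁻ x, ∫⁻ t, ‖weylPair h (phaseSlice b t (h * l / 2)) v x‖ₑ ^ 2 ∂circleMeasure := by
        rw [lintegral_const_mul]
        exact Measurable.lintegral_prod_left' (f := fun p : ℝ × Euc n =>
          ‖weylPair h (phaseSlice b p.1 (h * l / 2)) v p.2‖ₑ ^ 2) (hm.enorm.pow_const 2)
    _ = (ENNReal.ofReal (2 * Real.pi))⁻¹ *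
      ∫⁻ t, ∫⁻ x, ‖weylPair h (phaseSlice b t (h * l / 2)) v x‖ₑ ^ 2 ∂volume ∂circleMeasure := by
        rw [lintegral_lintegral_swap]
        exact ((hm.enorm.pow_const 2).comp measurable_swap).aemeasurable
    _ ≤ (ENNReal.ofReal (2 * Real.pi))⁻¹ * ∫⁻ t, B ^ 2 ∂circleMeasure := by
        gcongr with t
        rw [← eLpNorm_two_sq]
        gcongr
        exact hB t
    _ = B ^ 2 := by
        rw [lintegral_const, circleMeasure_univ, mul_comm, mul_assoc,
          ENNReal.mul_inv_cancel hP0 ENNReal.ofReal_ne_top, mul_one]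

lemma tsum_sq_le {α : Type*} (a K : α → ℝ≥0∞) (hK0 : ∀ l, K l ≠ 0) (hK : ∀ l, K l ≠ ⊤) :
    (∑' l, a l) ^ 2 ≤ (∑' l, K l) * ∑' l, (K l)⁻¹ * a l ^ 2 := by
  let _ : MeasurableSpace α := ⊤
  have := lintegral_mul_sq_le Measure.count (k := K) (f := fun l => (K l)⁻¹ * a l)
    measurable_from_top measurable_from_top
  simp only [lintegral_count' measurable_from_top] at this
  have e1 : ∀ l, K l * ((K l)⁻¹ * a l) = a l := fun l => by
    rw [← mul_assoc, ENNReal.mul_inv_cancel (hK0 l) (hK l), one_mul]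
  have e2 : ∀ l, K l * ((K l)⁻¹ * a l) ^ 2 = (K l)⁻¹ * a l ^ 2 := fun l => by
    rw [pow_two, ← mul_assoc (K l), e1]; ring
  simpa only [e1, e2] using this

/-- Cauchy–Schwarz over the modes with weights K replaces Parseval: pointwise in (x, t) the square
of the sum is at most (Σ K)(Σ K⁻¹ |mode|²), which is independent of t and integrates to at most 2π
(B Σ K)². The 7 comes from 2π ≤ 7². -/
lemma normL2_weylOp_le (h : ℝ) {b : Phase n → ℂ} (hb : Continuous b) (hp : PeriodicInT b)
    {v : Euc n → ℂ} (hv : Continuous v) (m : ℤ) {B : ℝ≥0∞} {K : ℤ → ℝ≥0∞}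
    (hK0 : ∀ l, K l ≠ 0) (hK : ∀ l, K l ≠ ⊤)
    (hB : ∀ l, eLpNorm (weylCoeff h b v m l) 2 volume ≤ B * K l) :
    normL2 (weylOp h b (fun w => v w.1 * Complex.exp (Complex.I * (((m : ℝ) * w.2 : ℝ) : ℂ)))) ≤
      7 * (B * ∑' l, K l) := by
  refine (ENNReal.pow_le_pow_left_iff two_ne_zero).1 ?_
  rw [normL2, eLpNorm_two_sq]
  have hm : ∀ l, Measurable fun x => ‖weylCoeff h b v m l x‖ₑ := fun l =>
    (stronglyMeasurable_weylCoeff hb hv h m l).enorm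
  set G : Euc n → ℝ≥0∞ := fun x => (∑' l, K l) * ∑' l, (K l)⁻¹ * ‖weylCoeff h b v m l x‖ₑ ^ 2 with hG
  have hGm : Measurable G := by
    refine Measurable.const_mul ?_ _
    exact Measurable.tsum fun l => ((hm l).pow_const 2).const_mul _
  have h1 : ∀ z : Euc n × ℝ, ‖weylOp h b
      (fun w => v w.1 * Complex.exp (Complex.I * (((m : ℝ) * w.2 : ℝ) : ℂ))) z‖ₑ ^ 2 ≤ G z.1 * 1 := by
    intro z
    rw [mul_one, weylOp_eq_tsum h hp]
    refine le_trans ?_ (tsum_sq_le (fun l => ‖weylCoeff h b v m l z.1‖ₑ) K hK0 hK)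
    gcongr
    refine enorm_tsum_le_tsum_enorm.trans (le_of_eq ?_)
    congr 1 with l
    rw [enorm_mul, ← ofReal_norm (angleExp _ _), norm_angleExp, ENNReal.ofReal_one, one_mul]
  refine (lintegral_mono h1).trans ?_
  rw [lintegral_prod_mul hGm.aemeasurable aemeasurable_const, lintegral_const, circleMeasure_univ,
    one_mul]
  have h2 : ∫⁻ x, G x ≤ (B * ∑' l, K l) ^ 2 := by
    simp only [hG]
    rw [lintegral_const_mul _ (Measurable.tsum fun l => ((hm l).pow_const 2).const_mul _),
      lintegral_tsum fun l => (((hm l).pow_const 2).const_mul _).aemeasurable]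
    calc _ ≤ (∑' l, K l) * ∑' l, B ^ 2 * K l := by
          gcongr with l
          rw [lintegral_const_mul _ ((hm l).pow_const 2), ← eLpNorm_two_sq]
          calc _ ≤ (K l)⁻¹ * (B * K l) ^ 2 := by gcongr; exact hB l
            _ = B ^ 2 * K l * (K l * (K l)⁻¹) := by ring
            _ = _ := by rw [ENNReal.mul_inv_cancel (hK0 l) (hK l), mul_one]
      _ = _ := by rw [ENNReal.tsum_mul_left]; ring
  have h3 : ENNReal.ofReal (2 * Real.pi) ≤ 7 ^ 2 := by
    rw [ENNReal.ofReal_le_iff_le_toReal (by norm_num)]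
    norm_num
    linarith [Real.pi_lt_d2]
  calc _ ≤ (B * ∑' l, K l) ^ 2 * 7 ^ 2 := mul_le_mul' h2 h3
    _ = _ := by ring

lemma integral_angleExp (k : ℤ) :
    ∫ t, angleExp k t ∂circleMeasure = if k = 0 then ((2 * Real.pi : ℝ) : ℂ) else 0 := by
  rw [← intervalIntegral.integral_of_le (by positivity)]
  split_ifs with hk
  · subst hk
    simp [angleExp]
  · have h1 : ∀ t : ℝ, angleExp k t = Complex.exp ((-(Complex.I * k)) * t) := by
      intro t; rw [angleExp]; congr 1; push_cast; ring
    have h2 : (-(Complex.I * k)) ≠ 0 := by simp [hk]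
    simp only [h1]
    rw [integral_exp_mul_complex h2, ← h1, ← h1]
    have := angleExp_periodic k 0
    rw [zero_add] at this
    rw [this, sub_self, zero_div]

/-- Orthogonality of exponentials recovers a mode from the output of the operator; absolute
summability permits integration term by term. -/
lemma weylCoeff_eq_circle_integral (h : ℝ) {b : Phase n → ℂ} (hp : PeriodicInT b)
    {v : Euc n → ℂ} (m l : ℤ) (x : Euc n)
    (hs : Summable fun l => ‖weylCoeff h b v m l x‖) :
    weylCoeff h b v m l x = (((2 * Real.pi)⁻¹ : ℝ) : ℂ) * ∫ t, angleExp (l - m) t * weylOp h b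
      (fun w => v w.1 * Complex.exp (Complex.I * (((m : ℝ) * w.2 : ℝ) : ℂ))) (x, t)
        ∂circleMeasure := by
  have h1 : ∀ t, angleExp (l - m) t * weylOp h b
      (fun w => v w.1 * Complex.exp (Complex.I * (((m : ℝ) * w.2 : ℝ) : ℂ))) (x, t) =
      ∑' j : ℤ, angleExp (l - j) t * weylCoeff h b v m j x := by
    intro t
    rw [weylOp_eq_tsum h hp, ← tsum_mul_left]
    congr 1 with j
    rw [← mul_assoc, ← angleExp_add, sub_add_sub_cancel]
  simp only [h1]
  have hi : ∀ j, Integrable (fun t => angleExp (l - j) t * weylCoeff h b v m j x)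
      circleMeasure := fun j =>
    (((continuous_angleExp (l - j)).mul continuous_const).integrableOn_Ioc)
  rw [← integral_tsum_of_summable_integral_norm hi]
  · have h2 : ∀ j, ∫ t, angleExp (l - j) t * weylCoeff h b v m j x ∂circleMeasure =
        if j = l then ((2 * Real.pi : ℝ) : ℂ) * weylCoeff h b v m l x else 0 := by
      intro j
      rw [integral_mul_const, integral_angleExp]
      by_cases hj : j = l
      · subst hj; simp
      · rw [if_neg (sub_ne_zero.2 (Ne.symm hj)), if_neg hj, zero_mul]
    simp only [h2]
    rw [tsum_ite_eq, ← mul_assoc, ← Complex.ofReal_mul, inv_mul_cancel₀ (by positivity),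
      Complex.ofReal_one, one_mul]
  · simp only [norm_mul, norm_angleExp, one_mul, integral_const, smul_eq_mul]
    exact hs.mul_left _

/-- A Bessel inequality for one mode. It converts the decay of ‖A H_μ‖ into decay of individual
matrix entries, as the converse direction requires. -/
lemma eLpNorm_weylCoeff_le_normL2 (h : ℝ) {b : Phase n → ℂ} (hb : Continuous b)
    (hp : PeriodicInT b) {v : Euc n → ℂ} (hv : Continuous v) (m l : ℤ)
    (hs : ∀ x, Summable fun l => ‖weylCoeff h b v m l x‖) :
    eLpNorm (weylCoeff h b v m l) 2 volume ≤
      normL2 (weylOp h b (fun w => v w.1 * Complex.exp (Complex.I * (((m : ℝ) * w.2 : ℝ) : ℂ)))) := by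
  refine (ENNReal.pow_le_pow_left_iff two_ne_zero).1 ?_
  rw [normL2, eLpNorm_two_sq, eLpNorm_two_sq]
  set A : Euc n × ℝ → ℂ := weylOp h b
    (fun w => v w.1 * Complex.exp (Complex.I * (((m : ℝ) * w.2 : ℝ) : ℂ))) with hA
  have hAm : Measurable A := by
    refine measurable_of_tendsto_metrizable' (atTop : Filter (Finset ℤ))
      (f := fun s z => ∑ l ∈ s, angleExp (m - l) z.2 * weylCoeff h b v m l z.1) (fun s => ?_) ?_
    · refine Finset.measurable_sum _ fun l _ => ?_
      exact ((continuous_angleExp _).comp continuous_snd).measurable.mul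
        ((stronglyMeasurable_weylCoeff hb hv h m l).measurable.comp measurable_fst)
    · refine tendsto_pi_nhds.2 fun z => ?_
      have : Summable fun l => angleExp (m - l) z.2 * weylCoeff h b v m l z.1 := by
        refine Summable.of_norm ?_
        simpa only [norm_mul, norm_angleExp, one_mul] using hs z.1
      rw [hA, weylOp_eq_tsum h hp]
      exact this.hasSum
  rw [lintegral_prod _ (hAm.enorm.pow_const 2).aemeasurable]
  refine lintegral_mono fun x => ?_
  rw [weylCoeff_eq_circle_integral h hp m l x (hs x)]
  have hme : ∀ t, ‖angleExp (l - m) t * A (x, t)‖ₑ = ‖A (x, t)‖ₑ := by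
    intro t
    rw [enorm_mul, ← ofReal_norm (angleExp _ _), norm_angleExp, ENNReal.ofReal_one, one_mul]
  refine (enorm_circle_average_sq_le ?_).trans ?_
  · simp only [← hA, hme]
    exact (hAm.comp (measurable_const.prodMk measurable_id)).enorm
  · simp only [← hA, hme]
    refine mul_le_of_le_one_left' ?_
    rw [ENNReal.inv_le_one, ← ENNReal.ofReal_one]
    exact ENNReal.ofReal_le_ofReal (by linarith [Real.pi_gt_three])

/-- The summable weight `(1 + |k|)⁻²` on the integers. -/
noncomputable def angleWeight (k : ℤ) : ℝ := ((1 + |(k : ℝ)|) ^ 2)⁻¹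

lemma angleWeight_pos (k : ℤ) : 0 < angleWeight k := by unfold angleWeight; positivity

lemma summable_angleWeight : Summable angleWeight := by
  -- The shift by 1/2 avoids a zero denominator, and |k + 1/2| ≤ 1 + |k| allows the comparison.
  have h1 := (Real.summable_one_div_int_add_rpow (1 / 2) 2).2 (by norm_num)
  refine Summable.of_nonneg_of_le (fun k => (angleWeight_pos k).le) (fun k => ?_) h1
  have h2 : (0 : ℝ) < |(k : ℝ) + 1 / 2| := by
    rw [abs_pos]
    intro h
    have h3 : (2 * k + 1 : ℤ) = 0 := by
      have : ((2 * k + 1 : ℤ) : ℝ) = 0 := by push_cast; linarith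
      exact_mod_cast this
    omega
  rw [angleWeight, one_div, Real.rpow_ofNat]
  gcongr
  refine (abs_add_le _ _).trans ?_
  rw [abs_of_pos (by norm_num : (0 : ℝ) < 1 / 2)]
  linarith

lemma weylPair_slice_le {M : ℕ} {b : Phase n → ℂ} (hb : PhaseSymbol M (fun _ : Unit => b))
    {h : ℝ} (hh : h ≠ 0) (v : 𝓢(Euc n, ℂ)) (x : Euc n) :
    ∃ C : ℝ, 0 ≤ C ∧ ∀ t τ, ‖weylPair h (phaseSlice b t τ) v x‖ ≤ C * (1 + |τ|) ^ M := by
  obtain ⟨C, hC0, hC⟩ := weylPair_bounded hh hb.slice v x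
  refine ⟨C, hC0, fun t τ => ?_⟩
  have h1 := hC ((), t, τ)
  simp only [Complex.real_smul] at h1
  rw [weylPair_smul_left, norm_mul, Complex.norm_real, Real.norm_of_nonneg (by positivity),
    inv_mul_le_iff₀ (by positivity)] at h1
  rwa [mul_comm]

lemma weylCoeff_le {h C : ℝ} {b : Phase n → ℂ} {v : Euc n → ℂ} {m l : ℤ} {x : Euc n}
    (hC : ∀ t, ‖weylPair h (phaseSlice b t (h * l / 2)) v x‖ ≤ C) :
    ‖weylCoeff h b v m l x‖ ≤ C := by
  rw [weylCoeff, norm_mul, Complex.norm_real, Real.norm_of_nonneg (by positivity),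
    inv_mul_le_iff₀ (by positivity)]
  have := intervalIntegral.norm_integral_le_of_norm_le_const (a := 0) (b := 2 * Real.pi)
    (f := fun t => angleExp (l - 2 * m) t * weylPair h (phaseSlice b t (h * l / 2)) v x) (C := C)
    (fun t _ => by rw [norm_mul, norm_angleExp, one_mul]; exact hC t)
  rwa [sub_zero, abs_of_pos (by positivity), mul_comm C] at this

/-- The growth (1 + |h l / 2|) ^ M coming from the symbol's dependence on τ is beaten by M + 2
angular derivatives, which leave the summable weight (1 + |l - 2m|)⁻². -/
lemma summable_weylCoeff {M : ℕ} {b : Phase n → ℂ} (hb : PhaseSymbol M (fun _ : Unit => b))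
    (hp : PeriodicInT b) {h : ℝ} (hh : 0 < h) (v : 𝓢(Euc n, ℂ)) (m : ℤ) (x : Euc n) :
    Summable fun l => ‖weylCoeff h b v m l x‖ := by
  obtain ⟨C, hC0, hC⟩ := weylPair_slice_le hb hh.ne' v x
  obtain ⟨C', hC0', hC'⟩ := weylPair_slice_le (angleDeriv_iterate hb (M + 2)) hh.ne' v x
  set D : ℝ := 2 ^ (M + 2) * (C + C') * ((1 + h) * (1 + |(m : ℝ)|)) ^ M with hD
  have hw : Summable fun l : ℤ => D * angleWeight (l - 2 * m) :=
    (summable_angleWeight.comp_injective (sub_left_injective (b := 2 * m))).mul_left D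
  refine Summable.of_nonneg_of_le (fun l => norm_nonneg _) (fun l => ?_) hw
  set k : ℝ := |((l - 2 * m : ℤ) : ℝ)| with hk
  have hk0 : 0 ≤ k := abs_nonneg _
  have h1 := weylCoeff_decay hb hp hh.ne' v m l x (M + 2)
  have h2 := weylCoeff_le (m := m) (fun t => hC t (h * l / 2))
  have h3 := weylCoeff_le (m := m) (fun t => hC' t (h * l / 2))
  have h4 : 1 + |h * l / 2| ≤ (1 + h) * (1 + |(m : ℝ)|) * (1 + k) := by
    have e1 : (l : ℝ) = ((l - 2 * m : ℤ) : ℝ) + 2 * m := by push_cast; ring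
    have e2 : |(l : ℝ)| ≤ k + 2 * |(m : ℝ)| := by
      rw [e1, hk]
      refine (abs_add_le _ _).trans ?_
      rw [abs_mul, abs_two]
    have e3 : |h * l / 2| = h * |(l : ℝ)| / 2 := by
      rw [abs_div, abs_mul, abs_of_pos hh, abs_two]
    rw [e3]
    have hm0 := abs_nonneg (m : ℝ)
    nlinarith [mul_nonneg hh.le hk0, mul_nonneg hh.le hm0, mul_nonneg hm0 hk0,
      mul_nonneg hh.le (mul_nonneg hm0 hk0)]
  have h5 : (1 + |h * l / 2|) ^ M ≤ ((1 + h) * (1 + |(m : ℝ)|)) ^ M * (1 + k) ^ M := by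
    rw [← mul_pow]; gcongr
  have h6 : (1 + k) ^ (M + 2) * ‖weylCoeff h b v m l x‖ ≤ D * (1 + k) ^ M := by
    refine h1.trans ?_
    calc _ ≤ 2 ^ (M + 2) * (C * (1 + |h * l / 2|) ^ M + C' * (1 + |h * l / 2|) ^ M) := by gcongr
      _ = 2 ^ (M + 2) * (C + C') * (1 + |h * l / 2|) ^ M := by ring
      _ ≤ 2 ^ (M + 2) * (C + C') * (((1 + h) * (1 + |(m : ℝ)|)) ^ M * (1 + k) ^ M) := by gcongr
      _ = _ := by rw [hD]; ring
  rw [angleWeight, ← hk, ← div_eq_mul_inv, le_div_iff₀ (by positivity)]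
  rw [pow_add, mul_assoc, mul_comm D] at h6
  have := le_of_mul_le_mul_left h6 (by positivity)
  linarith

end

/-! ### Uniform bounds on the Hermite basis, and dilations. -/

section
variable {n : ℕ} {ι : Type*}

lemma hermiteBasis_eq {h : ℝ} (hh : 0 < h) (μ : Fin n → ℕ) (m : ℤ) :
    hermiteBasis h μ m = fun w : Euc n × ℝ => hermiteSchwartz h μ w.1 *
      Complex.exp (Complex.I * (((m : ℝ) * w.2 : ℝ) : ℂ)) := by
  ext1 w
  rw [hermiteSchwartz_apply hh]
  rfl

lemma PhaseSymbol.weylPair_slice_bounded {M : ℕ} {b : ι → Phase n → ℂ} (hb : PhaseSymbol M b)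
    (R : ℝ) : ∃ C : ℝ≥0, ∀ (i : ι) (h : ℝ) (μ : Fin n → ℕ) (t τ : ℝ), BoundedEnergy R h μ →
      eLpNorm (weylPair h (phaseSlice (b i) t τ) (hermiteSchwartz h μ)) 2 volume ≤
        ENNReal.ofReal ((1 + |τ|) ^ M) * C := by
  obtain ⟨C, hC⟩ := hb.slice.weylBounded R
  refine ⟨C, fun i h μ t τ H => ?_⟩
  have h1 := eLpNorm_const_mul_le (((1 + |τ|) ^ M : ℝ) : ℂ) (D := (1 + |τ|) ^ M)
    (by rw [Complex.norm_real, Real.norm_of_nonneg (by positivity)]) _ (hC (i, t, τ) h μ H)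
  refine le_of_eq_of_le ?_ h1
  congr 1
  ext1 x
  rw [← weylPair_smul_left]
  congr 1
  ext1 z
  have h0 : (((1 + |τ|) ^ M : ℝ)) ≠ 0 := by positivity
  simp only [Complex.real_smul]
  rw [← mul_assoc, ← Complex.ofReal_mul, mul_inv_cancel₀ h0, Complex.ofReal_one, one_mul]

lemma eLpNorm_le_of_norm_le_mul_add {X : Type*} [MeasurableSpace X] {ν : Measure X}
    {d d' : X → ℂ} (hd : AEStronglyMeasurable d ν) (hd' : AEStronglyMeasurable d' ν) {s : ℝ}
    (hs : 0 ≤ s) (h : ∀ x, ‖d x‖ ≤ s * (‖d x‖ + ‖d' x‖)) {A A' : ℝ≥0∞}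
    (hA : eLpNorm d 2 ν ≤ A) (hA' : eLpNorm d' 2 ν ≤ A') :
    eLpNorm d 2 ν ≤ ENNReal.ofReal s * (A + A') := by
  calc eLpNorm d 2 ν ≤ eLpNorm (s • ((fun x => ‖d x‖) + fun x => ‖d' x‖)) 2 ν :=
        eLpNorm_mono_real h
    _ ≤ ENNReal.ofReal s * (eLpNorm (fun x => ‖d x‖) 2 ν + eLpNorm (fun x => ‖d' x‖) 2 ν) := by
        rw [eLpNorm_const_smul, ← ofReal_norm, Real.norm_of_nonneg hs]
        gcongr
        exact eLpNorm_add_le hd.norm hd'.norm (by norm_num)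
    _ ≤ _ := by
        rw [eLpNorm_norm, eLpNorm_norm]
        gcongr

/-- The quantitative form of the previous summability. With h ≤ 1 and h |m| ≤ 1 one has 1 + |h l /
2| ≤ 2 (1 + |l - 2m|), so the constants depend on neither h nor m. -/
lemma eLpNorm_weylCoeff_le_angleWeight {M : ℕ} {b b' : Phase n → ℂ} (hb : Continuous b)
    (hb' : Continuous b') {h : ℝ} (hh : 0 < h) (hh1 : h ≤ 1) {v : Euc n → ℂ} (hv : Continuous v)
    {m l : ℤ} (hm : h * |(m : ℝ)| ≤ 1)
    (hd : ∀ x, (1 + |((l - 2 * m : ℤ) : ℝ)|) ^ (M + 2) * ‖weylCoeff h b v m l x‖ ≤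
      2 ^ (M + 2) * (‖weylCoeff h b v m l x‖ + ‖weylCoeff h b' v m l x‖)) {C C' : ℝ≥0}
    (hC : ∀ t τ, eLpNorm (weylPair h (phaseSlice b t τ) v) 2 volume ≤
      ENNReal.ofReal ((1 + |τ|) ^ M) * C)
    (hC' : ∀ t τ, eLpNorm (weylPair h (phaseSlice b' t τ) v) 2 volume ≤
      ENNReal.ofReal ((1 + |τ|) ^ M) * C') :
    eLpNorm (weylCoeff h b v m l) 2 volume ≤
      ENNReal.ofReal (2 ^ (M + 2) * 2 ^ M) * (C + C') *
        ENNReal.ofReal (angleWeight (l - 2 * m)) := by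
  set k : ℝ := |((l - 2 * m : ℤ) : ℝ)| with hk
  have hk0 : 0 ≤ k := abs_nonneg _
  have hτ : (1 + |h * l / 2|) ^ M ≤ 2 ^ M * (1 + k) ^ M := by
    rw [← mul_pow]
    refine pow_le_pow_left₀ (by positivity) ?_ M
    have e1 : (l : ℝ) = ((l - 2 * m : ℤ) : ℝ) + 2 * m := by push_cast; ring
    have e2 : |(l : ℝ)| ≤ k + 2 * |(m : ℝ)| := by
      rw [e1, hk]
      refine (abs_add_le _ _).trans ?_
      rw [abs_mul, abs_two]
    have e3 : |h * l / 2| = h * |(l : ℝ)| / 2 := by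
      rw [abs_div, abs_mul, abs_of_pos hh, abs_two]
    rw [e3]
    nlinarith
  have h1 : eLpNorm (weylCoeff h b v m l) 2 volume ≤ ENNReal.ofReal (2 ^ M * (1 + k) ^ M) * C :=
    eLpNorm_weylCoeff_le hb hv h m l fun t =>
      (hC t _).trans (mul_le_mul' (ENNReal.ofReal_le_ofReal hτ) le_rfl)
  have h2 : eLpNorm (weylCoeff h b' v m l) 2 volume ≤
      ENNReal.ofReal (2 ^ M * (1 + k) ^ M) * C' :=
    eLpNorm_weylCoeff_le hb' hv h m l fun t =>
      (hC' t _).trans (mul_le_mul' (ENNReal.ofReal_le_ofReal hτ) le_rfl)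
  set s : ℝ := 2 ^ (M + 2) * ((1 + k) ^ (M + 2))⁻¹ with hs
  have hs0 : 0 ≤ s := by positivity
  have h3 : ∀ x, ‖weylCoeff h b v m l x‖ ≤
      s * (‖weylCoeff h b v m l x‖ + ‖weylCoeff h b' v m l x‖) := by
    intro x
    rw [hs, mul_assoc, mul_left_comm, ← div_eq_inv_mul, le_div_iff₀ (by positivity), mul_comm]
    exact hd x
  refine (eLpNorm_le_of_norm_le_mul_add
    (stronglyMeasurable_weylCoeff hb hv h m l).aestronglyMeasurable
    (stronglyMeasurable_weylCoeff hb' hv h m l).aestronglyMeasurable hs0 h3 h1 h2).trans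
    (le_of_eq ?_)
  have h4 : s * (2 ^ M * (1 + k) ^ M) = 2 ^ (M + 2) * 2 ^ M * angleWeight (l - 2 * m) := by
    rw [hs, angleWeight, ← hk, pow_add (1 + k)]
    have : (1 + k) ^ M ≠ 0 := by positivity
    field_simp
  rw [← mul_add, ← mul_assoc, ← ENNReal.ofReal_mul hs0, h4, ENNReal.ofReal_mul (by positivity)]
  ring

/-- Quantizations of bounded families of symbols are uniformly bounded on the basis functions of
bounded energy. -/
theorem PhaseSymbol.normL2_weylOp_bounded {M : ℕ} {b : ι → Phase n → ℂ} (hb : PhaseSymbol M b)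
    (hp : ∀ i, PeriodicInT (b i)) (R : ℝ) :
    ∃ C : ℝ≥0, ∀ (i : ι) (h : ℝ) (μ : Fin n → ℕ) (m : ℤ), BoundedEnergy R h μ → h * |(m : ℝ)| ≤ 1 →
      normL2 (weylOp h (b i) (hermiteBasis h μ m)) ≤ C := by
  obtain ⟨C, hC⟩ := hb.weylPair_slice_bounded R
  obtain ⟨C', hC'⟩ := (angleDeriv_iterate hb (M + 2)).weylPair_slice_bounded R
  set D : ℝ≥0∞ := ENNReal.ofReal (2 ^ (M + 2) * 2 ^ M) * (C + C') with hD
  have hDt : D ≠ ⊤ := ENNReal.mul_ne_top ENNReal.ofReal_ne_top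
    (ENNReal.add_ne_top.2 ⟨ENNReal.coe_ne_top, ENNReal.coe_ne_top⟩)
  set S : ℝ≥0∞ := ∑' k : ℤ, ENNReal.ofReal (angleWeight k) with hS
  have hSt : S ≠ ⊤ := summable_angleWeight.tsum_ofReal_ne_top
  refine ⟨(7 * (D * S)).toNNReal, fun i h μ m H hm => ?_⟩
  rw [ENNReal.coe_toNNReal (ENNReal.mul_ne_top (by norm_num) (ENNReal.mul_ne_top hDt hSt)),
    hermiteBasis_eq H.1]
  have hv := (hermiteSchwartz h μ).continuous
  have hS' : ∑' l : ℤ, ENNReal.ofReal (angleWeight (l - 2 * m)) = S :=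
    (Equiv.subRight (2 * m)).tsum_eq fun k => ENNReal.ofReal (angleWeight k)
  rw [← hS']
  refine normL2_weylOp_le h (hb.smooth i).continuous (hp i) hv m
    (fun l => by simpa using angleWeight_pos _) (fun l => ENNReal.ofReal_ne_top) fun l => ?_
  exact eLpNorm_weylCoeff_le_angleWeight (hb.smooth i).continuous
    ((angleDeriv_iterate hb (M + 2)).smooth i).continuous H.1 H.2.1 hv hm
    (fun x => weylCoeff_decay (hb.reindex fun _ : Unit => i) (hp i) H.1.ne'
      (hermiteSchwartz h μ) m l x (M + 2))
    (fun t τ => hC i h μ t τ H) (fun t τ => hC' i h μ t τ H)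

/-- The dilation `(x, ξ, t, τ) ↦ (r x, r ξ, t, r² τ)` as a linear map. -/
noncomputable def phaseDilation (n : ℕ) (r : ℝ) : Phase n →L[ℝ] Phase n :=
  (r • ContinuousLinearMap.id ℝ (Euc n)).prodMap ((r • ContinuousLinearMap.id ℝ (Euc n)).prodMap
    ((ContinuousLinearMap.id ℝ ℝ).prodMap (r ^ 2 • ContinuousLinearMap.id ℝ ℝ)))

lemma phaseDilation_apply (r : ℝ) (x ξ : Euc n) (t τ : ℝ) :
    phaseDilation n r (x, ξ, t, τ) = (r • x, r • ξ, t, r ^ 2 * τ) := rfl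

lemma norm_phaseDilation_le {r : ℝ} (hr : 0 ≤ r) (hr1 : r ≤ 1) : ‖phaseDilation n r‖ ≤ 1 := by
  refine ContinuousLinearMap.opNorm_le_bound _ zero_le_one fun z => ?_
  obtain ⟨x, ξ, t, τ⟩ := z
  rw [phaseDilation_apply, one_mul]
  simp only [Prod.norm_def, norm_smul, norm_mul, norm_pow, Real.norm_of_nonneg hr]
  have h1 : r ^ 2 ≤ 1 := pow_le_one₀ hr hr1
  gcongr
  · exact mul_le_of_le_one_left (norm_nonneg _) hr1
  · exact mul_le_of_le_one_left (norm_nonneg _) hr1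
  · exact mul_le_of_le_one_left (norm_nonneg _) h1

/-- The angle is not dilated. Its dual variable is sampled at h l / 2 and therefore scales like h,
that is by r², while position and momentum scale by r each. -/
lemma weylOp_dilation {h r : ℝ} (hr : 0 < r) (b : Phase n → ℂ) (u : Euc n × ℝ → ℂ) (x : Euc n)
    (t : ℝ) : weylOp h b u (r • x, t) =
      weylOp (h / r ^ 2) (fun z => b (phaseDilation n r z)) (fun w => u (r • w.1, w.2)) (x, t) := by
  unfold weylOp
  congr 1 with l
  congr 2 with s
  congr 1
  simp only [phaseDilation_apply]
  rw [weylRn_dilation hr]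
  congr 1
  ext y ξ
  congr 4
  field_simp

lemma weylRn_const_mul (c : ℂ) (h : ℝ) (b : Euc n → Euc n → ℂ) (v : Euc n → ℂ) (x : Euc n) :
    weylRn h b (fun y => c * v y) x = c * weylRn h b v x :=
  weylPair_smul_right c (fun z => b z.1 z.2) h v x

lemma weylOp_const_mul (c : ℂ) (h : ℝ) (b : Phase n → ℂ) (u : Euc n × ℝ → ℂ) (z : Euc n × ℝ) :
    weylOp h b (fun w => c * u w) z = c * weylOp h b u z := by
  unfold weylOp
  rw [← tsum_mul_left]
  congr 1 with l
  rw [← intervalIntegral.integral_const_mul, ← intervalIntegral.integral_const_mul,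
    ← intervalIntegral.integral_const_mul]
  congr 1 with s
  rw [weylRn_const_mul]
  ring

lemma hermiteBasis_dilation {h r : ℝ} (hh : 0 < h) (hr : 0 < r) (μ : Fin n → ℕ) (m : ℤ)
    (w : Euc n × ℝ) : hermiteBasis h μ m (r • w.1, w.2) =
      ((r ^ (-(n : ℝ) / 2) : ℝ) : ℂ) * hermiteBasis (h / r ^ 2) μ m w := by
  unfold hermiteBasis
  rw [← mul_assoc, ← Complex.ofReal_mul]
  congr 2
  rw [← mul_assoc]
  have h1 : h ^ (-(n : ℝ) / 4) = r ^ (-(n : ℝ) / 2) * (h / r ^ 2) ^ (-(n : ℝ) / 4) := by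
    have : h = r ^ (2 : ℝ) * (h / r ^ 2) := by
      rw [Real.rpow_two]; field_simp
    conv_lhs => rw [this]
    rw [Real.mul_rpow (by positivity) (by positivity), ← Real.rpow_mul hr.le]
    congr 2
    ring
  rw [h1]
  congr 1
  refine Finset.prod_congr rfl fun i _ => ?_
  congr 1
  rw [Real.sqrt_div hh.le, Real.sqrt_sq hr.le]
  simp only [PiLp.smul_apply, smul_eq_mul]
  field_simp

lemma normL2_dilation {r : ℝ} (hr : 0 < r) (F : Euc n × ℝ → ℂ) :
    normL2 F = ENNReal.ofReal (r ^ ((n : ℝ) / 2)) * normL2 (fun z => F (r • z.1, z.2)) := by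
  set e : Euc n ≃ᵐ Euc n := (Homeomorph.smulOfNeZero r hr.ne').toMeasurableEquiv with he
  set Φ : Euc n × ℝ ≃ᵐ Euc n × ℝ := e.prodCongr (MeasurableEquiv.refl ℝ) with hΦ
  have h1 : (fun z : Euc n × ℝ => F (r • z.1, z.2)) = F ∘ Φ := rfl
  have h2 : Measure.map Φ ((volume : Measure (Euc n)).prod circleMeasure) =
      ENNReal.ofReal ((r ^ n)⁻¹) • ((volume : Measure (Euc n)).prod circleMeasure) := by
    have e1 : Measure.map e (volume : Measure (Euc n)) =
        ENNReal.ofReal ((r ^ n)⁻¹) • (volume : Measure (Euc n)) := by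
      have := Measure.map_addHaar_smul (volume : Measure (Euc n)) hr.ne'
      rw [finrank_euclideanSpace, Fintype.card_fin, abs_of_pos (by positivity)] at this
      exact this
    have e2 := Measure.map_prod_map (volume : Measure (Euc n)) circleMeasure
      e.measurable measurable_id
    rw [e1, Measure.map_id, Measure.prod_smul_left] at e2
    exact e2.symm
  rw [normL2, normL2, h1, ← Φ.measurableEmbedding.eLpNorm_map_measure, h2,
    eLpNorm_smul_measure_of_ne_top (by norm_num), smul_eq_mul, ← mul_assoc]
  have h3 : ENNReal.ofReal (r ^ ((n : ℝ) / 2)) *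
      ENNReal.ofReal ((r ^ n)⁻¹) ^ (1 / 2 : ℝ≥0∞).toReal = 1 := by
    have e : (1 / 2 : ℝ≥0∞).toReal = 1 / 2 := by simp
    rw [e, ENNReal.ofReal_rpow_of_pos (by positivity), ← ENNReal.ofReal_mul (by positivity),
      ENNReal.ofReal_eq_one, Real.inv_rpow (by positivity),
      ← Real.rpow_natCast, ← Real.rpow_mul hr.le, mul_one_div, mul_inv_cancel₀ (by positivity)]
  rw [h3, one_mul]

/-- The factor r^{-n/2} in the dilation of the basis cancels the Jacobian factor r^{n/2} of the
norm: the dilation is unitary. -/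
lemma normL2_weylOp_dilation {h r : ℝ} (hh : 0 < h) (hr : 0 < r) (b : Phase n → ℂ)
    (μ : Fin n → ℕ) (m : ℤ) :
    normL2 (weylOp h b (hermiteBasis h μ m)) =
      normL2 (weylOp (h / r ^ 2) (fun z => b (phaseDilation n r z))
        (hermiteBasis (h / r ^ 2) μ m)) := by
  rw [normL2_dilation hr]
  have h1 : (fun z : Euc n × ℝ => weylOp h b (hermiteBasis h μ m) (r • z.1, z.2)) =
      (((r ^ (-(n : ℝ) / 2) : ℝ) : ℂ)) • weylOp (h / r ^ 2) (fun z => b (phaseDilation n r z))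
        (hermiteBasis (h / r ^ 2) μ m) := by
    ext1 z
    rw [weylOp_dilation hr]
    simp only [hermiteBasis_dilation hh hr]
    rw [weylOp_const_mul]
    rfl
  rw [h1, normL2, eLpNorm_const_smul, ← ofReal_norm, Complex.norm_real,
    Real.norm_of_nonneg (by positivity), ← mul_assoc, ← ENNReal.ofReal_mul (by positivity),
    ← Real.rpow_add hr, neg_div, add_neg_cancel, Real.rpow_zero, ENNReal.ofReal_one, one_mul]
  rfl

end

/-! ### Flat symbols: vanishing to infinite order implies decay. -/

section
variable {n : ℕ} {ι : Type*}

/-- The size `|x| + |ξ| + |τ|` of the variables transversal to the circle `x = ξ = 0`, `τ = 0`. -/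
noncomputable def coreDist (z : Phase n) : ℝ := ‖z.1‖ + ‖z.2.1‖ + |z.2.2.2|

lemma coreDist_nonneg (z : Phase n) : 0 ≤ coreDist z := by unfold coreDist; positivity

lemma phaseWeight_eq (z : Phase n) : phaseWeight z = 1 + coreDist z := by
  unfold phaseWeight coreDist; ring

lemma phaseWeight_pos (z : Phase n) : 0 < phaseWeight z := by
  rw [phaseWeight_eq]; linarith [coreDist_nonneg z]

lemma PhaseSymbol.mono_exponent {M M' : ℕ} {b : ι → Phase n → ℂ} (hb : PhaseSymbol M b)
    (h : M ≤ M') : PhaseSymbol M' b := by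
  refine UniformSymbol.mono hb 1 (fun z => (pow_pos (phaseWeight_pos z) _).le) fun z => ?_
  rw [one_mul]
  exact pow_le_pow_right₀ (by rw [phaseWeight_eq]; linarith [coreDist_nonneg z]) h

lemma PhaseSymbol.exists_sum {σ : Type*} (s : Finset σ) {b : σ → ι → Phase n → ℂ}
    (h : ∀ a ∈ s, ∃ M, PhaseSymbol M (b a)) : ∃ M, PhaseSymbol M (fun i z => ∑ a ∈ s, b a i z) := by
  classical
  induction s using Finset.induction_on with
  | empty =>
    simp only [Finset.sum_empty]
    exact ⟨0, UniformSymbol.zero fun z => by simp⟩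
  | insert a s ha ih =>
    obtain ⟨M, hM⟩ := h a (by simp)
    obtain ⟨M', hM'⟩ := ih fun c hc => h c (by simp [hc])
    simp only [Finset.sum_insert ha]
    exact ⟨max M M', (hM.mono_exponent (le_max_left _ _)).add
      (hM'.mono_exponent (le_max_right _ _))⟩

/-- The mean value inequality along the segment from (0, 0, t, 0) to z gains one factor of the
distance to the circle at the cost of one derivative. All derivatives vanish on the circle, so this
can be repeated N times. -/
lemma PhaseSymbol.flat {M : ℕ} {f : Phase n → ℂ} (hf : PhaseSymbol M (fun _ : Unit => f))
    (h0 : ∀ (j : ℕ) (t : ℝ), iteratedFDeriv ℝ j f (0, 0, t, 0) = 0) (N : ℕ) :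
    UniformSymbol (fun z => coreDist z ^ N * phaseWeight z ^ M) (fun _ : Unit => f) := by
  have hw : ∀ N : ℕ, ∀ z : Phase n, 0 ≤ coreDist z ^ N * phaseWeight z ^ M := fun N z =>
    mul_nonneg (pow_nonneg (coreDist_nonneg z) _) (pow_nonneg (phaseWeight_pos z).le _)
  induction N with
  | zero => simpa using hf
  | succ N ih =>
    refine UniformSymbol.of_bound (hw _) hf.smooth fun j => ?_
    obtain ⟨C, hC0, hC⟩ := ih.bound (j + 1)
    refine ⟨C, fun _ z => ?_⟩
    obtain ⟨x, ξ, t, τ⟩ := z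
    set p : Phase n := (0, 0, t, 0) with hp
    set z : Phase n := (x, ξ, t, τ) with hz
    have hd : Differentiable ℝ (iteratedFDeriv ℝ j f) :=
      (hf.smooth ()).differentiable_iteratedFDeriv (m := j) (mod_cast WithTop.coe_lt_top _)
    have hseg : ∀ w ∈ segment ℝ p z, ‖fderiv ℝ (iteratedFDeriv ℝ j f) w‖ ≤
        C * (coreDist z ^ N * phaseWeight z ^ M) := by
      intro w hw
      obtain ⟨s, hs, rfl⟩ := (segment_eq_image' ℝ p z) ▸ hw
      rw [norm_fderiv_iteratedFDeriv]
      refine (hC () _).trans (mul_le_mul_of_nonneg_left ?_ hC0)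
      have e : coreDist (p + s • (z - p)) ≤ coreDist z := by
        simp only [coreDist, hp, hz, Prod.mk_sub_mk, Prod.smul_mk, Prod.mk_add_mk, sub_zero,
          zero_add, norm_smul, smul_eq_mul, abs_mul, Real.norm_eq_abs, abs_of_nonneg hs.1]
        have h1 := mul_le_of_le_one_left (norm_nonneg x) hs.2
        have h2 := mul_le_of_le_one_left (norm_nonneg ξ) hs.2
        have h3 := mul_le_of_le_one_left (abs_nonneg τ) hs.2
        linarith
      rw [phaseWeight_eq, phaseWeight_eq]
      have := coreDist_nonneg (p + s • (z - p))
      have := coreDist_nonneg z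
      gcongr
    have h1 := (convex_segment p z).norm_image_sub_le_of_norm_fderiv_le
      (fun w _ => hd w) hseg (left_mem_segment ℝ p z) (right_mem_segment ℝ p z)
    rw [hp, h0 j t, sub_zero] at h1
    refine h1.trans ?_
    have h2 : ‖z - (0, 0, t, 0)‖ ≤ coreDist z := by
      simp only [hz, Prod.mk_sub_mk, sub_zero, sub_self, Prod.norm_def, norm_zero, coreDist,
        Real.norm_eq_abs]
      have h1 := norm_nonneg x
      have h2 := norm_nonneg ξ
      have h3 := abs_nonneg τ
      refine max_le (by linarith) (max_le (by linarith) (max_le (by linarith) (by linarith)))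
    calc _ ≤ C * (coreDist z ^ N * phaseWeight z ^ M) * coreDist z :=
          mul_le_mul_of_nonneg_left h2 (mul_nonneg hC0 (hw N z))
      _ = _ := by ring

lemma IsSymbol.phaseSymbol {b : Phase n → ℂ} (hb : IsSymbol b) :
    ∃ M, PhaseSymbol M (fun _ : Unit => b) := by
  obtain ⟨M, hM⟩ := hb.growth
  refine ⟨M, UniformSymbol.of_bound (fun z => (pow_pos (phaseWeight_pos z) _).le)
    (fun _ => hb.smooth) fun j => ?_⟩
  obtain ⟨C, hC⟩ := hM j
  exact ⟨C, fun _ z => hC z⟩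

/-- The normalized remainder of the expansion of a semiclassical symbol. -/
noncomputable def symbolRemainder (a : ℝ → Phase n → ℂ) (c : ℕ → Phase n → ℂ) (K : ℕ) (ħ : ℝ) :
    Phase n → ℂ := fun z =>
  ((ħ ^ K)⁻¹ : ℝ) • (a ħ z - ∑ k ∈ Finset.range K, ((ħ ^ k : ℝ) : ℂ) * c k z)

lemma symbol_eq_sum_add_remainder (a : ℝ → Phase n → ℂ) (c : ℕ → Phase n → ℂ) (K : ℕ) {ħ : ℝ}
    (hħ : 0 < ħ) (z : Phase n) :
    a ħ z = ∑ k ∈ Finset.range K, ((ħ ^ k : ℝ) : ℂ) * c k z +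
      (ħ ^ K : ℝ) • symbolRemainder a c K ħ z := by
  rw [symbolRemainder, smul_smul, mul_inv_cancel₀ (by positivity), one_smul]
  ring

lemma IsSemiclassicalSymbol.remainder {ħ₀ : ℝ} {a : ℝ → Phase n → ℂ} {c : ℕ → Phase n → ℂ}
    (ha : IsSemiclassicalSymbol ħ₀ a c) (K : ℕ) :
    ∃ M, PhaseSymbol M (fun ħ : Set.Ioo 0 ħ₀ => symbolRemainder a c K ħ) := by
  obtain ⟨M, hM⟩ := ha.expansion K
  have hs : ∀ ħ : Set.Ioo 0 ħ₀, ContDiff ℝ ∞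
      (fun z => a ħ z - ∑ k ∈ Finset.range K, ((ħ ^ k : ℝ) : ℂ) * c k z) := fun ħ =>
    (ha.smooth ħ ħ.2).sub (ContDiff.sum fun k _ => contDiff_const.mul (ha.coeff k).smooth)
  refine ⟨M, UniformSymbol.of_bound (fun z => (pow_pos (phaseWeight_pos z) _).le)
    (fun ħ => (hs ħ).const_smul _) fun j => ?_⟩
  obtain ⟨C, hC⟩ := hM j
  refine ⟨C, fun ħ z => ?_⟩
  have hħ : (0 : ℝ) < ħ := ħ.2.1
  have h1 : iteratedFDeriv ℝ j (symbolRemainder a c K ħ) z = (((ħ : ℝ) ^ K)⁻¹ : ℝ) •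
      iteratedFDeriv ℝ j (fun z => a ħ z - ∑ k ∈ Finset.range K, (((ħ : ℝ) ^ k : ℝ) : ℂ) * c k z) z :=
    iteratedFDeriv_const_smul_apply (a := (((ħ : ℝ) ^ K)⁻¹ : ℝ))
      (f := fun z => a ħ z - ∑ k ∈ Finset.range K, (((ħ : ℝ) ^ k : ℝ) : ℂ) * c k z)
      ((hs ħ).of_le (mod_cast le_top)).contDiffAt
  rw [h1, norm_smul, Real.norm_of_nonneg (by positivity), inv_mul_le_iff₀ (by positivity)]
  exact (hC ħ ħ.2 z).trans (le_of_eq (by ring))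

/-- Only one power of r is claimed; since r ≤ 1, the faster contraction r² of τ is no obstacle. -/
lemma coreDist_dilation_le {r : ℝ} (hr : 0 ≤ r) (hr1 : r ≤ 1) (z : Phase n) :
    coreDist (phaseDilation n r z) ≤ r * coreDist z := by
  obtain ⟨x, ξ, t, τ⟩ := z
  rw [phaseDilation_apply]
  simp only [coreDist, norm_smul, Real.norm_of_nonneg hr, abs_mul, abs_pow, abs_of_nonneg hr]
  have : r ^ 2 * |τ| ≤ r * |τ| := mul_le_mul_of_nonneg_right (by nlinarith) (abs_nonneg _)
  linarith

lemma phaseWeight_dilation_le {r : ℝ} (hr : 0 ≤ r) (hr1 : r ≤ 1) (z : Phase n) :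
    phaseWeight (phaseDilation n r z) ≤ phaseWeight z := by
  rw [phaseWeight_eq, phaseWeight_eq]
  have := coreDist_dilation_le hr hr1 z
  have := coreDist_nonneg z
  nlinarith

lemma PeriodicInT.dilation {b : Phase n → ℂ} (hb : PeriodicInT b) (r : ℝ) :
    PeriodicInT (fun z => b (phaseDilation n r z)) := fun _ _ _ _ => hb _ _ _ _

/-- Dilations of a symbol vanishing to infinite order on the circle are rapidly decreasing. -/
lemma PhaseSymbol.flat_dilation {κ : Type*} {M : ℕ} {f : Phase n → ℂ}
    (hf : PhaseSymbol M (fun _ : Unit => f))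
    (h0 : ∀ (j : ℕ) (t : ℝ), iteratedFDeriv ℝ j f (0, 0, t, 0) = 0) (N : ℕ)
    (r : κ → ℝ) (hr : ∀ i, 0 < r i) (hr1 : ∀ i, r i ≤ 1) :
    PhaseSymbol (N + M) (fun i z => ((r i ^ N)⁻¹ : ℝ) • f (phaseDilation n (r i) z)) := by
  have h := ((hf.flat h0 N).reindex (fun _ : κ => ())).comp_affine_smul
    (fun i => (r i ^ N)⁻¹) (fun i => inv_nonneg.2 (pow_nonneg (hr i).le _))
    (fun i => phaseDilation n (r i)) (fun _ => 0) 1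
    (fun i => norm_phaseDilation_le (hr i).le (hr1 i)) (w' := fun z => phaseWeight z ^ (N + M)) 1
    (fun z => pow_nonneg (phaseWeight_pos z).le _) (fun i z => by
      have hri := hr i
      rw [inv_mul_le_iff₀ (by positivity), zero_add, one_mul, pow_add, ← mul_assoc, ← mul_pow]
      have h1 := coreDist_dilation_le hri.le (hr1 i) z
      have h2 := coreDist_nonneg (phaseDilation n (r i) z)
      have h3 := (phaseWeight_pos (phaseDilation n (r i) z)).le
      have h4 := phaseWeight_dilation_le hri.le (hr1 i) z
      have h5 : coreDist (phaseDilation n (r i) z) ≤ r i * phaseWeight z :=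
        h1.trans (mul_le_mul_of_nonneg_left (by rw [phaseWeight_eq]; linarith) hri.le)
      gcongr
      exact pow_nonneg (mul_nonneg hri.le (phaseWeight_pos z).le) _)
  simpa only [zero_add] using h

lemma PhaseSymbol.dilation {κ : Type*} {M : ℕ} {b : ι → Phase n → ℂ} (hb : PhaseSymbol M b)
    (f : κ → ι) (r : κ → ℝ) (hr : ∀ i, 0 < r i) (hr1 : ∀ i, r i ≤ 1) :
    PhaseSymbol M (fun i z => b (f i) (phaseDilation n (r i) z)) := by
  have h := (hb.reindex f).comp_affine
    (fun i => phaseDilation n (r i)) (fun _ => 0) 1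
    (fun i => norm_phaseDilation_le (hr i).le (hr1 i)) (w' := fun z => phaseWeight z ^ M) 1
    (fun z => pow_nonneg (phaseWeight_pos z).le _) (fun i z => by
      rw [zero_add, one_mul]
      exact pow_le_pow_left₀ (phaseWeight_pos _).le (phaseWeight_dilation_le (hr i).le (hr1 i) z) _)
  simpa only [zero_add] using h

/-- Pairs `(ħ, r)` of a semiclassical parameter and a dilation factor with `ħ ≤ r² ≤ 1`. -/
abbrev DilationScale (ħ₀ : ℝ) : Type :=
  {p : ℝ × ℝ // p.1 ∈ Set.Ioo 0 ħ₀ ∧ p.1 ≤ p.2 ^ 2 ∧ 0 < p.2 ∧ p.2 ≤ 1}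

/-- The N coefficients that are kept gain r ^ (2N) from flatness. The remainder needs no flatness:
its factor ħ ^ N is at most r ^ (2N). -/
lemma IsSemiclassicalSymbol.dilation_decay {ħ₀ : ℝ} {a : ℝ → Phase n → ℂ} {c : ℕ → Phase n → ℂ}
    (ha : IsSemiclassicalSymbol ħ₀ a c) (h0 : VanishesToInfiniteOrder c) (N : ℕ) :
    ∃ M, PhaseSymbol M (fun (p : DilationScale ħ₀) z =>
      ((p.1.2 ^ (2 * N))⁻¹ : ℝ) • a p.1.1 (phaseDilation n p.1.2 z)) := by
  obtain ⟨M, hM⟩ := ha.remainder N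
  have h1 : ∀ k ∈ Finset.range N, ∃ M, PhaseSymbol M (fun (p : DilationScale ħ₀) z =>
      ((p.1.1 ^ k : ℝ) : ℂ) •
        (((p.1.2 ^ (2 * N))⁻¹ : ℝ) • c k (phaseDilation n p.1.2 z))) := by
    intro k _
    obtain ⟨M, hM⟩ := (ha.coeff k).phaseSymbol
    refine ⟨2 * N + M, (hM.flat_dilation (h0 k) (2 * N) (fun p : DilationScale ħ₀ => p.1.2)
      (fun p => p.2.2.2.1) (fun p => p.2.2.2.2)).const_smul _ 1 fun p => ?_⟩
    have hp := p.2.1.1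
    rw [Complex.norm_real, Real.norm_of_nonneg (by positivity)]
    refine pow_le_one₀ hp.le (p.2.2.1.trans ?_)
    exact pow_le_one₀ p.2.2.2.1.le p.2.2.2.2
  have h2 : PhaseSymbol M (fun (p : DilationScale ħ₀) z =>
      (p.1.1 ^ N * (p.1.2 ^ (2 * N))⁻¹ : ℝ) • symbolRemainder a c N p.1.1
        (phaseDilation n p.1.2 z)) := by
    refine (hM.dilation (fun p : DilationScale ħ₀ => ⟨p.1.1, p.2.1⟩) (fun p => p.1.2)
      (fun p => p.2.2.2.1) (fun p => p.2.2.2.2)).const_smul _ 1 fun p => ?_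
    have hp := p.2.1.1
    have hr := p.2.2.2.1
    rw [Real.norm_of_nonneg (by positivity), ← div_eq_mul_inv, div_le_one (by positivity), pow_mul]
    exact pow_le_pow_left₀ hp.le p.2.2.1 N
  obtain ⟨M', hM'⟩ := PhaseSymbol.exists_sum (Finset.range N) h1
  refine ⟨max M' M, ?_⟩
  have h3 := (hM'.mono_exponent (le_max_left M' M)).add (h2.mono_exponent (le_max_right M' M))
  convert h3 using 3 with p z
  rw [symbol_eq_sum_add_remainder a c N p.2.1.1, smul_add, smul_smul, Finset.smul_sum,
    mul_comm (p.1.1 ^ N)]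
  congr 1
  refine Finset.sum_congr rfl fun k _ => ?_
  simp only [Complex.real_smul, smul_eq_mul]
  ring

lemma weylOp_smul_left (s : ℝ) (h : ℝ) (b : Phase n → ℂ) (u : Euc n × ℝ → ℂ) :
    weylOp h (fun z => s • b z) u = (s : ℂ) • weylOp h b u := by
  ext1 z
  simp only [weylOp, Pi.smul_apply, smul_eq_mul, Complex.real_smul]
  rw [← tsum_mul_left]
  congr 1 with l
  rw [mul_left_comm (s : ℂ), ← intervalIntegral.integral_const_mul (s : ℂ)]
  congr 2 with t
  rw [mul_left_comm (s : ℂ)]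
  congr 1
  exact weylPair_smul_left (s : ℂ) (phaseSlice b (z.2 - t / 2) (h * l / 2)) h _ z.1

/-- The quantization of a symbol vanishing to infinite order decays on basis functions of small
energy. -/
theorem IsSemiclassicalSymbol.normL2_le_of_vanishes {ħ₀ : ℝ} {a : ℝ → Phase n → ℂ}
    {c : ℕ → Phase n → ℂ} (ha : IsSemiclassicalSymbol ħ₀ a c) (h0 : VanishesToInfiniteOrder c)
    (N : ℕ) : ∃ C : ℝ≥0, ∀ ħ ∈ Set.Ioo 0 ħ₀, ∀ (μ : Fin n → ℕ) (m : ℤ) (E : ℝ), ħ ≤ E → E ≤ 1 →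
      (∀ i, ħ * μ i ≤ E) → ħ * |(m : ℝ)| ≤ E →
      normL2 (weylOp ħ (a ħ) (hermiteBasis ħ μ m)) ≤ ENNReal.ofReal (C * E ^ N) := by
  obtain ⟨M, hM⟩ := ha.dilation_decay h0 N
  have hper : ∀ p : DilationScale ħ₀, PeriodicInT (fun z =>
      ((p.1.2 ^ (2 * N))⁻¹ : ℝ) • a p.1.1 (phaseDilation n p.1.2 z)) := fun p x ξ t τ =>
    congrArg (fun w => ((p.1.2 ^ (2 * N))⁻¹ : ℝ) • w)
      ((ha.periodic p.1.1 p.2.1).dilation p.1.2 x ξ t τ)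
  -- The energy bound R = n suffices: after rescaling by E each of the n products (ħ / E) μ_i is at
  -- most one.
  obtain ⟨C, hC⟩ := hM.normL2_weylOp_bounded hper n
  · refine ⟨C, fun ħ hħ μ m E hE hE1 hμ hm => ?_⟩
    have hE0 : 0 < E := hħ.1.trans_le hE
    -- With r² = E the rescaled parameter is ħ / E ≤ 1 and r ^ (2N) is exactly E ^ N.
    set r := Real.sqrt E with hr
    have hr0 : 0 < r := Real.sqrt_pos.2 hE0
    have hr2 : r ^ 2 = E := Real.sq_sqrt hE0.le
    have hr1 : r ≤ 1 := Real.sqrt_le_one.2 hE1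
    let p : DilationScale ħ₀ := ⟨(ħ, r), hħ, by rw [hr2]; exact hE, hr0, hr1⟩
    have hh0 : 0 < ħ / r ^ 2 := div_pos hħ.1 (by positivity)
    have h1 := hC p (ħ / r ^ 2) μ m ⟨hh0, by rw [hr2]; exact (div_le_one hE0).2 hE, ?_⟩ ?_
    · rw [normL2_weylOp_dilation hħ.1 hr0]
      have h2 : (fun z => a ħ (phaseDilation n r z)) = fun z => (r ^ (2 * N) : ℝ) •
          (((r ^ (2 * N))⁻¹ : ℝ) • a ħ (phaseDilation n r z)) := by
        ext1 z
        rw [smul_smul, mul_inv_cancel₀ (by positivity), one_smul]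
      rw [h2, weylOp_smul_left, normL2, eLpNorm_const_smul, ← ofReal_norm, Complex.norm_real,
        Real.norm_of_nonneg (by positivity)]
      have h3 : ENNReal.ofReal (C * E ^ N) = ENNReal.ofReal (r ^ (2 * N)) * C := by
        rw [pow_mul, hr2, mul_comm (C : ℝ), ENNReal.ofReal_mul (by positivity),
          ENNReal.ofReal_coe_nnreal]
      rw [h3]
      exact mul_le_mul' le_rfl h1
    · rw [hr2, Finset.mul_sum]
      calc ∑ i, ħ / E * (μ i : ℝ) ≤ ∑ _i : Fin n, (1 : ℝ) := by
            refine Finset.sum_le_sum fun i _ => ?_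
            rw [div_mul_eq_mul_div, div_le_one hE0]
            exact hμ i
        _ = n := by simp
    · rw [hr2, div_mul_eq_mul_div, div_le_one hE0]
      exact hm

lemma le_indexNorm (μ : Fin n → ℕ) (m : ℤ) (i : Fin n) : (μ i : ℝ) ≤ indexNorm μ m := by
  refine Real.le_sqrt_of_sq_le ?_
  have := Finset.single_le_sum (f := fun i => (μ i : ℝ) ^ 2) (fun _ _ => sq_nonneg _)
    (Finset.mem_univ i)
  nlinarith [sq_nonneg (m : ℝ)]

lemma abs_le_indexNorm (μ : Fin n → ℕ) (m : ℤ) : |(m : ℝ)| ≤ indexNorm μ m := by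
  refine Real.le_sqrt_of_sq_le ?_
  rw [sq_abs]
  have := Finset.sum_nonneg (s := Finset.univ) (f := fun i => (μ i : ℝ) ^ 2)
    (fun _ _ => sq_nonneg _)
  linarith

/-- The squared length is an integer. Hence ħ ≤ |(μ, m)| ħ for a nonzero index, which the rescaling
needs; index zero uses E = ħ instead. -/
lemma one_le_indexNorm {μ : Fin n → ℕ} {m : ℤ} (h : 0 < indexNorm μ m) : 1 ≤ indexNorm μ m := by
  have h1 := Real.sqrt_pos.1 h
  refine Real.le_sqrt_of_sq_le ?_
  have h2 : (∑ i, (μ i : ℝ) ^ 2) + (m : ℝ) ^ 2 = (((∑ i, (μ i : ℤ) ^ 2) + m ^ 2 : ℤ) : ℝ) := by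
    push_cast; rfl
  rw [h2] at h1 ⊢
  have h3 : 0 < (∑ i, (μ i : ℤ) ^ 2) + m ^ 2 := by exact_mod_cast h1
  rw [one_pow]
  exact_mod_cast h3

theorem IsSemiclassicalSymbol.hermiteDecay {ħ₀ : ℝ} {a : ℝ → Phase n → ℂ}
    {c : ℕ → Phase n → ℂ} (ha : IsSemiclassicalSymbol ħ₀ a c) (h0 : VanishesToInfiniteOrder c) :
    HermiteDecay ħ₀ a := by
  intro N
  obtain ⟨C, hC⟩ := ha.normL2_le_of_vanishes h0 N
  refine ⟨C, 1, one_pos, fun ħ hħ μ m hpos hle => hC ħ hħ μ m _ ?_ hle (fun i => ?_) ?_⟩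
  · exact le_mul_of_one_le_left hħ.1.le (one_le_indexNorm hpos)
  · rw [mul_comm]
    exact mul_le_mul_of_nonneg_right (le_indexNorm μ m i) hħ.1.le
  · rw [mul_comm]
    exact mul_le_mul_of_nonneg_right (abs_le_indexNorm μ m) hħ.1.le

theorem IsSemiclassicalSymbol.groundStateDecay {ħ₀ : ℝ} {a : ℝ → Phase n → ℂ}
    {c : ℕ → Phase n → ℂ} (ha : IsSemiclassicalSymbol ħ₀ a c) (h0 : VanishesToInfiniteOrder c) :
    GroundStateDecay ħ₀ a := by
  intro N
  obtain ⟨C, hC⟩ := ha.normL2_le_of_vanishes h0 N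
  refine ⟨C, 1, one_pos, fun ħ hħ hle => hC ħ hħ _ _ _ le_rfl hle (fun i => ?_) ?_⟩
  · simpa using hħ.1.le
  · simpa using hħ.1.le

end

/-! ### Symmetry, polarization and Taylor expansion of iterated derivatives. -/

section IteratedDerivative
variable {V F : Type*} [NormedAddCommGroup V] [NormedSpace ℝ V]
  [NormedAddCommGroup F] [NormedSpace ℝ F]

lemma iteratedFDeriv_succ_eq_fderiv {f : V → F} (hf : ContDiff ℝ ∞ f) {j : ℕ} (x : V)
    (v : Fin (j + 1) → V) :
    iteratedFDeriv ℝ (j + 1) f x v =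
      fderiv ℝ (fun x => iteratedFDeriv ℝ j f x (Fin.tail v)) x (v 0) := by
  rw [iteratedFDeriv_succ_apply_left]
  have hd : DifferentiableAt ℝ (iteratedFDeriv ℝ j f) x :=
    (hf.differentiable_iteratedFDeriv (m := j) (mod_cast WithTop.coe_lt_top _)) x
  have h1 := ((ContinuousMultilinearMap.apply ℝ (fun _ : Fin j => V) F
    (Fin.tail v)).hasFDerivAt.comp x hd.hasFDerivAt).fderiv
  have h2 : (fun x => iteratedFDeriv ℝ j f x (Fin.tail v)) =
    (ContinuousMultilinearMap.apply ℝ (fun _ : Fin j => V) F (Fin.tail v)) ∘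
      iteratedFDeriv ℝ j f := rfl
  rw [h2, h1]
  rfl

lemma contDiff_iteratedFDeriv_apply {f : V → F} (hf : ContDiff ℝ ∞ f) {j : ℕ}
    (v : Fin j → V) : ContDiff ℝ ∞ (fun x => iteratedFDeriv ℝ j f x v) :=
  (ContinuousMultilinearMap.apply ℝ (fun _ : Fin j => V) F v).contDiff.comp
    (hf.iteratedFDeriv_right (m := ∞) (by exact_mod_cast le_rfl))

lemma fderiv_fderiv_comm {g : V → F} (hg : ContDiff ℝ ∞ g) (x a b : V) :
    fderiv ℝ (fun y => fderiv ℝ g y b) x a = fderiv ℝ (fun y => fderiv ℝ g y a) x b := by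
  have hd : DifferentiableAt ℝ (fderiv ℝ g) x :=
    ((hg.fderiv_right (m := ∞) (by simp)).differentiable (by simp)) x
  have h1 : ∀ c d : V, fderiv ℝ (fun y => fderiv ℝ g y c) x d = fderiv ℝ (fderiv ℝ g) x d c := by
    intro c d
    rw [fderiv_clm_apply hd (differentiableAt_const c)]
    simp
  have hs : IsSymmSndFDerivAt ℝ g x := ((contDiff_infty.1 hg 2).contDiffAt (x := x)).isSymmSndFDerivAt (by simp)
  rw [h1, h1]
  exact hs a b

/-- Exchanging the two outermost arguments is the symmetry of second derivatives. An exchange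
further inside concerns a lower derivative, which is then differentiated once more. -/
lemma iteratedFDeriv_comp_adjacent_swap (j : ℕ) :
    ∀ {f : V → F} (_ : ContDiff ℝ ∞ f) (x : V) (v : Fin j → V) (a b : Fin j),
      a.val + 1 = b.val →
      iteratedFDeriv ℝ j f x (v ∘ Equiv.swap a b) = iteratedFDeriv ℝ j f x v := by
  induction j with
  | zero => exact fun _ _ _ a => a.elim0
  | succ j ih =>
    intro f hf x v a b hab
    rcases Fin.eq_zero_or_eq_succ a with rfl | ⟨a', rfl⟩
    · obtain ⟨i, rfl⟩ : ∃ i, j = i + 1 := ⟨j - 1, by have := b.2; simp at hab; omega⟩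
      obtain rfl : b = 1 := by
        ext; simpa using hab.symm
      have key : ∀ w : Fin (i + 2) → V, iteratedFDeriv ℝ (i + 2) f x w =
          fderiv ℝ (fun y => fderiv ℝ (fun z => iteratedFDeriv ℝ i f z
            (Fin.tail (Fin.tail w))) y (w 1)) x (w 0) := by
        intro w
        rw [iteratedFDeriv_succ_eq_fderiv hf]
        congr 2
        ext1 y
        rw [iteratedFDeriv_succ_eq_fderiv hf]
        rfl
      rw [key, key]
      have e : Fin.tail (Fin.tail (v ∘ Equiv.swap (0 : Fin (i + 2)) 1)) = Fin.tail (Fin.tail v) := by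
        ext1 l
        simp only [Fin.tail, Function.comp_apply]
        rw [Equiv.swap_apply_of_ne_of_ne]
        · exact Fin.succ_ne_zero _
        · intro h
          have := congrArg Fin.val h
          simp at this
      rw [e, fderiv_fderiv_comm (contDiff_iteratedFDeriv_apply hf _)]
      simp
    · rcases Fin.eq_zero_or_eq_succ b with rfl | ⟨b', rfl⟩
      · simp at hab
      rw [iteratedFDeriv_succ_eq_fderiv hf, iteratedFDeriv_succ_eq_fderiv hf]
      have e0 : (v ∘ Equiv.swap a'.succ b'.succ) 0 = v 0 := by
        simp only [Function.comp_apply]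
        rw [Equiv.swap_apply_of_ne_of_ne (Fin.succ_ne_zero _).symm (Fin.succ_ne_zero _).symm]
      have e1 : Fin.tail (v ∘ Equiv.swap a'.succ b'.succ) = Fin.tail v ∘ Equiv.swap a' b' := by
        ext1 l
        simp only [Fin.tail, Function.comp_apply]
        rw [(Fin.succ_injective _).swap_apply]
      rw [e0, e1]
      congr 2
      ext1 y
      exact ih hf y (Fin.tail v) a' b' (by simpa using hab)

/-- Iterated derivatives of smooth functions are symmetric. -/
lemma ContDiff.iteratedFDeriv_comp_perm {f : V → F} (hf : ContDiff ℝ ∞ f) {j : ℕ} (x : V)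
    (v : Fin j → V) (σ : Equiv.Perm (Fin j)) :
    iteratedFDeriv ℝ j f x (v ∘ σ) = iteratedFDeriv ℝ j f x v := by
  rcases j with _ | j
  · congr 1
    exact Subsingleton.elim _ _
  · have hσ : σ ∈ Submonoid.closure (Set.range fun i : Fin j => Equiv.swap i.castSucc i.succ) := by
      rw [Equiv.Perm.mclosure_swap_castSucc_succ]
      trivial
    induction hσ using Submonoid.closure_induction generalizing v with
    | mem τ hτ =>
      obtain ⟨i, rfl⟩ := hτ
      exact iteratedFDeriv_comp_adjacent_swap _ hf x v _ _ (by simp)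
    | one => rfl
    | mul σ τ _ _ h1 h2 =>
      rw [Equiv.Perm.coe_mul, ← Function.comp_assoc, h2, h1]

/-- A derivative which vanishes on the diagonal of an open set vanishes. -/
lemma ContDiff.iteratedFDeriv_eq_zero_of_diagonal {f : V → F} (hf : ContDiff ℝ ∞ f) {j : ℕ} (x : V)
    {U : Set V} (hU : IsOpen U) (hne : U.Nonempty)
    (h : ∀ v ∈ U, iteratedFDeriv ℝ j f x (fun _ => v) = 0) : iteratedFDeriv ℝ j f x = 0 := by
  obtain ⟨v₀, hv₀⟩ := hne
  ext v
  -- Polarization: the j-th derivative of the diagonal y ↦ T(y, …, y) is the sum of T over all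
  -- permutations of v, that is j! T(v) by symmetry. Only the germ at v₀ enters, so an open set is
  -- enough.
  have h1 := (iteratedFDeriv ℝ j f x).iteratedFDeriv_comp_diagonal v₀ v
  have h2 : (fun y => iteratedFDeriv ℝ j f x (fun _ => y)) =ᶠ[𝓝 v₀] fun _ => 0 := by
    filter_upwards [hU.mem_nhds hv₀] with y hy using h y hy
  rw [(h2.iteratedFDeriv ℝ j).eq_of_nhds, iteratedFDeriv_fun_zero] at h1
  have h3 : ∀ σ : Equiv.Perm (Fin j), iteratedFDeriv ℝ j f x (fun i => v (σ i)) =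
      iteratedFDeriv ℝ j f x v := fun σ => hf.iteratedFDeriv_comp_perm x v σ
  simp only [h3, Finset.sum_const, Finset.card_univ, Fintype.card_perm, Fintype.card_fin] at h1
  have h4 : (j.factorial : ℝ) • iteratedFDeriv ℝ j f x v = 0 := by
    rw [Nat.cast_smul_eq_nsmul, ← h1]; rfl
  simpa using (smul_eq_zero.1 h4).resolve_left (by positivity)

lemma iteratedDeriv_comp_line {f : V → F} (hf : ContDiff ℝ ∞ f) (p v : V) (j : ℕ) (s : ℝ) :
    iteratedDeriv j (fun s : ℝ => f (p + s • v)) s =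
      iteratedFDeriv ℝ j f (p + s • v) (fun _ => v) := by
  have hs : ContDiff ℝ ∞ (fun z => f (p + z)) := hf.comp (contDiff_const.add contDiff_id)
  have h1 : (fun s : ℝ => f (p + s • v)) =
      (fun z => f (p + z)) ∘ ContinuousLinearMap.toSpanSingleton ℝ v := by
    ext1 s; simp
  rw [iteratedDeriv, h1, (ContinuousLinearMap.toSpanSingleton ℝ v).iteratedFDeriv_comp_right hs s
    (mod_cast le_top), iteratedFDeriv_comp_add_left]
  simp

/-- The leading Taylor coefficient as a limit. -/
lemma tendsto_taylor_leading {f : V → F} (hf : ContDiff ℝ ∞ f) (p v : V) (J : ℕ)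
    (h : ∀ j < J, iteratedFDeriv ℝ j f p = 0) :
    Tendsto (fun s : ℝ => (s ^ J)⁻¹ • f (p + s • v)) (𝓝[>] 0)
      (𝓝 ((J.factorial : ℝ)⁻¹ • iteratedFDeriv ℝ J f p (fun _ => v))) := by
  set φ : ℝ → F := fun s => f (p + s • v) with hφ
  have hφs : ContDiff ℝ ∞ φ := hf.comp (contDiff_const.add (contDiff_id.smul contDiff_const))
  have h1 := taylor_tendsto (n := J) (f := φ) convex_univ (Set.mem_univ (0 : ℝ))
    ((hφs.of_le (mod_cast le_top)).contDiffOn)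
  have h2 : ∀ s, taylorWithinEval φ J Set.univ 0 s =
      ((J.factorial : ℝ)⁻¹ * s ^ J) • iteratedFDeriv ℝ J f p (fun _ => v) := by
    intro s
    rw [taylor_within_apply, Finset.sum_range_succ, Finset.sum_eq_zero]
    · rw [iteratedDerivWithin_univ, iteratedDeriv_comp_line hf]
      simp
    · intro j hj
      rw [iteratedDerivWithin_univ, iteratedDeriv_comp_line hf, zero_smul, add_zero,
        h j (Finset.mem_range.1 hj)]
      simp
  rw [nhdsWithin_univ] at h1
  have h3 := (h1.mono_left (nhdsWithin_le_nhds (s := Set.Ioi 0))).add_const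
    ((J.factorial : ℝ)⁻¹ • iteratedFDeriv ℝ J f p (fun _ => v))
  rw [zero_add] at h3
  refine h3.congr' ?_
  filter_upwards [self_mem_nhdsWithin] with s hs
  have hs' : (s : ℝ) ^ J ≠ 0 := pow_ne_zero _ (ne_of_gt hs)
  rw [h2, sub_zero, smul_sub, smul_smul, mul_left_comm, inv_mul_cancel₀ hs', mul_one,
    sub_add_cancel]

/-- Derivatives of a uniformly smooth family which vanishes to order `J` at the origin. -/
lemma UniformSymbol.flat_origin {κ : Type*} {M : ℕ} {f : κ → V → F}
    (hf : UniformSymbol (fun v => (1 + ‖v‖) ^ M) f) (J : ℕ)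
    (h0 : ∀ j < J, ∀ i, iteratedFDeriv ℝ j (f i) 0 = 0) (j : ℕ) :
    ∃ C : ℝ, 0 ≤ C ∧ ∀ i v, ‖iteratedFDeriv ℝ j (f i) v‖ ≤ C * (‖v‖ ^ (J - j) * (1 + ‖v‖) ^ M) := by
  induction h : J - j generalizing j with
  | zero => simpa using hf.bound j
  | succ N ih =>
    obtain ⟨C, hC0, hC⟩ := ih (j + 1) (by omega)
    refine ⟨C, hC0, fun i v => ?_⟩
    have hd : Differentiable ℝ (iteratedFDeriv ℝ j (f i)) :=
      (hf.smooth i).differentiable_iteratedFDeriv (m := j) (mod_cast WithTop.coe_lt_top _)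
    have hseg : ∀ w ∈ segment ℝ 0 v, ‖fderiv ℝ (iteratedFDeriv ℝ j (f i)) w‖ ≤
        C * (‖v‖ ^ N * (1 + ‖v‖) ^ M) := by
      intro w hw
      rw [segment_eq_image'] at hw
      obtain ⟨s, hs, rfl⟩ := hw
      rw [norm_fderiv_iteratedFDeriv]
      refine (hC i _).trans (mul_le_mul_of_nonneg_left ?_ hC0)
      have e : ‖0 + s • (v - 0)‖ ≤ ‖v‖ := by
        rw [zero_add, sub_zero, norm_smul, Real.norm_of_nonneg hs.1]
        exact mul_le_of_le_one_left (norm_nonneg _) hs.2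
      gcongr
    have h1 := (convex_segment 0 v).norm_image_sub_le_of_norm_fderiv_le
      (fun w _ => hd w) hseg (left_mem_segment ℝ 0 v) (right_mem_segment ℝ 0 v)
    rw [h0 j (by omega) i, sub_zero, sub_zero] at h1
    exact h1.trans (le_of_eq (by ring))

end IteratedDerivative

/-! ### Transversal variables, rescaled families and polynomial symbols. -/

section
variable {n : ℕ} {ι : Type*}

/-- The variables `(x, ξ, τ)` transversal to the circle. -/
abbrev TransSpace (n : ℕ) : Type := Euc n × Euc n × ℝ

/-- The restriction of a function on phase space to a fixed angle. -/
def transSlice (b : Phase n → ℂ) (t : ℝ) : TransSpace n → ℂ := fun v => b (v.1, v.2.1, t, v.2.2)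

lemma PhaseSymbol.transSlice {M : ℕ} {b : ι → Phase n → ℂ} (hb : PhaseSymbol M b) :
    UniformSymbol (fun v => (1 + ‖v‖) ^ M) (fun p : ι × ℝ => transSlice (b p.1) p.2) := by
  set A : TransSpace n →L[ℝ] Phase n := (ContinuousLinearMap.fst ℝ _ _).prod
    (((ContinuousLinearMap.fst ℝ _ _).comp (ContinuousLinearMap.snd ℝ _ _)).prod
      ((0 : TransSpace n →L[ℝ] ℝ).prod
        ((ContinuousLinearMap.snd ℝ _ _).comp (ContinuousLinearMap.snd ℝ _ _)))) with hA
  have hAa : ∀ v, A v = (v.1, v.2.1, 0, v.2.2) := fun v => rfl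
  have h := (hb.reindex (Prod.fst : ι × ℝ → ι)).comp_affine
    (fun _ => A) (fun p => (0, 0, p.2, 0)) ‖A‖ (fun _ => le_rfl)
    (w' := fun v => (1 + ‖v‖) ^ M) (3 ^ M) (fun v => by positivity) (fun p v => by
      rw [hAa, ← mul_pow]
      refine pow_le_pow_left₀ (phaseWeight_pos _).le ?_ M
      simp only [phaseWeight, Prod.mk_add_mk, zero_add]
      have h1 : ‖v.1‖ ≤ ‖v‖ := norm_fst_le v
      have h2 : ‖v.2.1‖ ≤ ‖v‖ := (norm_fst_le v.2).trans (norm_snd_le v)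
      have h3 : ‖v.2.2‖ ≤ ‖v‖ := (norm_snd_le v.2).trans (norm_snd_le v)
      rw [Real.norm_eq_abs] at h3
      linarith)
  simp only [hAa, Prod.mk_add_mk, zero_add, add_zero] at h
  exact h

/-- The inclusion of `T^*ℝⁿ` into the transversal space. -/
noncomputable def transIncl (n : ℕ) : Euc n × Euc n →L[ℝ] TransSpace n :=
  (ContinuousLinearMap.fst ℝ _ _).prod ((ContinuousLinearMap.snd ℝ _ _).prod 0)

lemma transIncl_apply (z : Euc n × Euc n) : transIncl n z = (z.1, z.2, 0) := rfl

lemma norm_transIncl_le : ‖transIncl n‖ ≤ 1 := by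
  refine ContinuousLinearMap.opNorm_le_bound _ zero_le_one fun z => ?_
  rw [transIncl_apply, one_mul]
  simp only [Prod.norm_def, norm_zero]
  exact max_le (le_max_left _ _) (max_le (le_max_right _ _) (le_max_of_le_left (norm_nonneg _)))

lemma one_add_norm_trans_le (z : Euc n × Euc n) (s : ℝ) :
    1 + ‖((z.1, z.2, s) : TransSpace n)‖ ≤ (1 + |s|) * ((1 + ‖z.1‖) * (1 + ‖z.2‖)) := by
  have h1 := norm_nonneg z.1
  have h2 := norm_nonneg z.2
  have h3 := abs_nonneg s
  have h : ‖((z.1, z.2, s) : TransSpace n)‖ ≤ ‖z.1‖ + ‖z.2‖ + |s| := by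
    simp only [Prod.norm_def, Real.norm_eq_abs]
    refine max_le (by linarith) (max_le (by linarith) (by linarith))
  nlinarith [mul_nonneg h1 h2, mul_nonneg h1 h3, mul_nonneg h2 h3,
    mul_nonneg h3 (mul_nonneg h1 h2)]

lemma one_add_norm_trans_pow_le (z : Euc n × Euc n) (s : ℝ) (J : ℕ) :
    (1 + ‖((z.1, z.2, s) : TransSpace n)‖) ^ J ≤ (1 + |s|) ^ J * pairWeight J J z := by
  unfold pairWeight
  rw [zpow_natCast, ← mul_pow, ← mul_pow]
  exact pow_le_pow_left₀ (by positivity) (one_add_norm_trans_le z s) J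

/-- A j-th derivative of f (r ·) gains r ^ j from the chain rule and r ^ (J - j) from vanishing to
order J, which compensates r ^ (-J). For j > J the truncated J - j is zero, and r ^ j ≤ r ^ J still
suffices. -/
lemma UniformSymbol.scaled {κ : Type*} {M J : ℕ} {f : κ → TransSpace n → ℂ}
    (hf : UniformSymbol (fun v => (1 + ‖v‖) ^ M) f)
    (h0 : ∀ j < J, ∀ i, iteratedFDeriv ℝ j (f i) 0 = 0) (s : ℝ) :
    UniformSymbol (pairWeight (J + M) (J + M : ℕ)) (fun (p : κ × Set.Ioc (0 : ℝ) 1) z =>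
      (((p.2 : ℝ) ^ J)⁻¹ : ℝ) • f p.1 ((p.2 : ℝ) • (z.1, z.2, s))) := by
  have e : ∀ (r : ℝ) (z : Euc n × Euc n), r • ((z.1, z.2, s) : TransSpace n) =
      r • ((0, 0, s) : TransSpace n) + (r • transIncl n) z := by
    intro r z
    rw [smul_apply, transIncl_apply, ← smul_add]
    simp
  refine UniformSymbol.of_bound (pairWeight_nonneg _ _) (fun p => ?_) fun j => ?_
  · simp only [e]
    exact ((hf.smooth p.1).comp (contDiff_const.add
      ((p.2 : ℝ) • transIncl n).contDiff)).const_smul _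
  · obtain ⟨C, hC0, hC⟩ := hf.flat_origin J h0 j
    refine ⟨C * (1 + |s|) ^ (J + M), fun p z => ?_⟩
    set r : ℝ := p.2.val with hr
    have hr0 : 0 < r := p.2.2.1
    have hr1 : r ≤ 1 := p.2.2.2
    have h1 := norm_iteratedFDeriv_comp_affine_smul_le (hf.smooth p.1)
      (c := (r ^ J)⁻¹) (by positivity) (r • transIncl n) (r • ((0, 0, s) : TransSpace n)) j z
    simp only [← e] at h1
    refine h1.trans ?_
    set v : TransSpace n := (z.1, z.2, s) with hv
    have h2 : ‖r • v‖ = r * ‖v‖ := by rw [norm_smul, Real.norm_of_nonneg hr0.le]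
    have h3 : ‖r • transIncl n‖ ≤ r := by
      rw [norm_smul, Real.norm_of_nonneg hr0.le]
      exact mul_le_of_le_one_right hr0.le norm_transIncl_le
    have hv0 := norm_nonneg v
    calc _ ≤ (r ^ J)⁻¹ * (C * ((r * ‖v‖) ^ (J - j) * (1 + 1 * ‖v‖) ^ M) * r ^ j) := by
          have := hC p.1 (r • v)
          rw [h2] at this
          gcongr
          refine this.trans ?_
          gcongr
      _ = C * ((r ^ J)⁻¹ * r ^ (J - j + j)) * (‖v‖ ^ (J - j) * (1 + ‖v‖) ^ M) := by
          rw [mul_pow, pow_add, one_mul]; ring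
      _ ≤ C * 1 * ((1 + ‖v‖) ^ J * (1 + ‖v‖) ^ M) := by
          gcongr
          · rw [inv_mul_le_iff₀ (by positivity), mul_one]
            exact pow_le_pow_of_le_one hr0.le hr1 (by omega)
          · calc ‖v‖ ^ (J - j) ≤ (1 + ‖v‖) ^ (J - j) := by gcongr; linarith
              _ ≤ (1 + ‖v‖) ^ J := pow_le_pow_right₀ (by linarith) (Nat.sub_le _ _)
      _ = C * (1 + ‖v‖) ^ (J + M) := by rw [pow_add]; ring
      _ ≤ C * ((1 + |s|) ^ (J + M) * pairWeight (J + M) (J + M : ℕ) z) := by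
          gcongr
          exact one_add_norm_trans_pow_le z s (J + M)
      _ = _ := by ring

/-- The polynomial on `T^*ℝⁿ` defined by a multilinear form on the transversal space. -/
noncomputable def diagForm {J : ℕ} (T : ContinuousMultilinearMap ℝ (fun _ : Fin J => TransSpace n) ℂ) (s : ℝ)
    (z : Euc n × Euc n) : ℂ := T fun _ => (z.1, z.2, s)

/-- The descending factorial is kept in the bound because it vanishes for j > J, and so records that
the form is a polynomial of degree at most J in z. -/
lemma norm_iteratedFDeriv_diagForm_le {J : ℕ}
    (T : ContinuousMultilinearMap ℝ (fun _ : Fin J => TransSpace n) ℂ) (s : ℝ) (j : ℕ)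
    (z : Euc n × Euc n) :
    ContDiff ℝ ∞ (diagForm T s) ∧ ‖iteratedFDeriv ℝ j (diagForm T s) z‖ ≤
      J.descFactorial j * ‖T‖ * (1 + ‖((z.1, z.2, s) : TransSpace n)‖) ^ J := by
  set A : Euc n × Euc n →L[ℝ] (Fin J → TransSpace n) :=
    ContinuousLinearMap.pi fun _ => transIncl n with hA
  have e : diagForm T s = fun z => (1 : ℝ) • T ((fun _ => ((0, 0, s) : TransSpace n)) + A z) := by
    ext1 z
    rw [one_smul, diagForm]
    congr 1
    ext1 i
    simp [hA, transIncl_apply]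
  have hAn : ‖A‖ ≤ 1 := ContinuousLinearMap.opNorm_le_bound _ zero_le_one fun z => by
    rw [one_mul]
    refine (pi_norm_le_iff_of_nonneg (norm_nonneg _)).2 fun i => ?_
    exact ((transIncl n).le_of_opNorm_le norm_transIncl_le z).trans_eq (one_mul _)
  have hx : ‖(fun _ : Fin J => ((0, 0, s) : TransSpace n)) + A z‖ ≤
      ‖((z.1, z.2, s) : TransSpace n)‖ := by
    refine (pi_norm_le_iff_of_nonneg (norm_nonneg _)).2 fun i => ?_
    simp [hA, transIncl_apply]
  constructor
  · rw [e]
    exact (T.contDiff.comp (contDiff_const.add A.contDiff)).const_smul _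
  · rw [e]
    refine (norm_iteratedFDeriv_comp_affine_smul_le T.contDiff zero_le_one A _ j z).trans ?_
    rw [one_mul]
    have h1 := T.norm_iteratedFDeriv_le j ((fun _ => ((0, 0, s) : TransSpace n)) + A z)
    rw [Fintype.card_fin] at h1
    set y := ‖((z.1, z.2, s) : TransSpace n)‖ with hy
    have hy0 : 0 ≤ y := norm_nonneg _
    calc _ ≤ (J.descFactorial j * ‖T‖ * (1 + y) ^ J) * 1 ^ j := by
          gcongr
          refine h1.trans ?_
          gcongr
          calc _ ≤ y ^ (J - j) := by gcongr
            _ ≤ (1 + y) ^ (J - j) := by gcongr; linarith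
            _ ≤ (1 + y) ^ J := pow_le_pow_right₀ (by linarith) (Nat.sub_le _ _)
      _ = _ := by rw [one_pow, mul_one]

lemma uniformSymbol_diagForm {κ : Type*} {J : ℕ}
    {T : κ → ContinuousMultilinearMap ℝ (fun _ : Fin J => TransSpace n) ℂ} {B : ℝ}
    (hT : ∀ i, ‖T i‖ ≤ B) (s : ℝ) :
    UniformSymbol (pairWeight J J) (fun i => diagForm (T i) s) := by
  refine UniformSymbol.of_bound (pairWeight_nonneg _ _)
    (fun i => (norm_iteratedFDeriv_diagForm_le (T i) s 0 0).1) fun j => ?_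
  refine ⟨J.descFactorial j * B * (1 + |s|) ^ J, fun i z => ?_⟩
  refine (norm_iteratedFDeriv_diagForm_le (T i) s j z).2.trans ?_
  have hB : 0 ≤ B := (norm_nonneg _).trans (hT i)
  calc _ ≤ J.descFactorial j * B * ((1 + |s|) ^ J * pairWeight J J z) := by
        gcongr
        · exact hT i
        · exact one_add_norm_trans_pow_le z s J
    _ = _ := by ring

lemma iteratedFDeriv_diagForm_eq_zero {J j : ℕ} (hj : J < j)
    (T : ContinuousMultilinearMap ℝ (fun _ : Fin J => TransSpace n) ℂ) (s : ℝ)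
    (z : Euc n × Euc n) : iteratedFDeriv ℝ j (diagForm T s) z = 0 := by
  have := (norm_iteratedFDeriv_diagForm_le T s j z).2
  rw [Nat.descFactorial_eq_zero_iff_lt.2 hj, Nat.cast_zero, zero_mul, zero_mul] at this
  exact norm_le_zero_iff.1 this

/-- The quantization of `q` annihilates all Hermite functions. -/
def WeylNull (q : Euc n × Euc n → ℂ) : Prop :=
  ∀ μ : Fin n → ℕ, ∀ᵐ x, weylPair 1 q (hermiteSchwartz 1 μ) x = 0

/-- Up to a constant the quantization of ∂q/∂ξ_j is the commutator of x_j with that of q, and x_j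
maps a Hermite function to a combination of its neighbours, all annihilated by hypothesis. -/
lemma WeylNull.fderiv {M : ℕ} {L : ℤ} {q : Euc n × Euc n → ℂ}
    (hq : UniformSymbol (pairWeight M L) (fun _ : Unit => q)) (h : WeylNull q) (j : Fin n) :
    WeylNull (fun z => fderiv ℝ q z (0, EuclideanSpace.single j (1 : ℝ))) := by
  intro μ
  set e : Euc n := EuclideanSpace.single j (1 : ℝ) with he
  filter_upwards [h μ, h (raiseIndex μ j), h (lowerIndex μ j)] with x h1 h2 h3
  rw [weylPair_commutator one_ne_zero hq, h1]
  have e1 : weylPair 1 q (mulInner e (hermiteSchwartz 1 μ)) x = 0 := by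
    have e2 : (mulInner e (hermiteSchwartz 1 μ) : Euc n → ℂ) = fun y =>
        (((Real.sqrt 1 * Real.sqrt (((μ j : ℝ) + 1) / 2) : ℝ) : ℂ) •
          hermiteSchwartz 1 (raiseIndex μ j)) y +
        (((Real.sqrt 1 * Real.sqrt ((μ j : ℝ) / 2) : ℝ) : ℂ) •
          hermiteSchwartz 1 (lowerIndex μ j)) y := by
      ext1 y
      have := coord_mul_hermiteSchwartz one_pos μ j y
      rw [mulInner_apply, he, EuclideanSpace.inner_single_left, map_one, one_mul, this]
      rfl
    rw [e2, weylPair_add_right one_ne_zero hq _ _ _ ()]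
    have e3 := weylPair_smul_right (((Real.sqrt 1 * Real.sqrt (((μ j : ℝ) + 1) / 2) : ℝ) : ℂ))
      q 1 (hermiteSchwartz 1 (raiseIndex μ j)) x
    have e4 := weylPair_smul_right (((Real.sqrt 1 * Real.sqrt ((μ j : ℝ) / 2) : ℝ) : ℂ))
      q 1 (hermiteSchwartz 1 (lowerIndex μ j)) x
    rw [h2, mul_zero] at e3
    rw [h3, mul_zero] at e4
    calc _ = (0 : ℂ) + 0 := congrArg₂ (· + ·) e3 e4
      _ = 0 := add_zero 0
  rw [e1]
  simp

lemma hermiteSchwartz_zero_ne_zero (x : Euc n) : hermiteSchwartz 1 (fun _ => 0) x ≠ 0 := by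
  rw [hermiteSchwartz_apply one_pos, Complex.ofReal_ne_zero, hermiteProd]
  refine mul_ne_zero (by simp) (Finset.prod_ne_zero_iff.2 fun i _ => ?_)
  unfold hermiteFun
  simp only [Polynomial.hermite_zero, map_one, mul_one]
  positivity

/-- A polynomial symbol is determined by the action of its quantization on Hermite functions. -/
lemma WeylNull.eq_zero (D : ℕ) : ∀ {M : ℕ} {L : ℤ} {q : Euc n × Euc n → ℂ}
    (_ : UniformSymbol (pairWeight M L) (fun _ : Unit => q)) (_ : WeylNull q)
    (_ : ∀ z, iteratedFDeriv ℝ D q z = 0), q = 0 := by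
  induction D with
  | zero =>
    intro M L q _ _ h
    ext1 z
    have h1 : ‖q z‖ = 0 := by rw [← norm_iteratedFDeriv_zero (𝕜 := ℝ), h z, norm_zero]
    exact norm_eq_zero.1 h1
  | succ D ih =>
    intro M L q hq hn h
    have hs := hq.smooth ()
    -- The momentum derivatives are again null and of lower degree, hence zero by induction. So q
    -- depends on position alone and its quantization is multiplication by q.
    have h1 : ∀ (j : Fin n) z, _root_.fderiv ℝ q z (0, EuclideanSpace.single j (1 : ℝ)) = 0 := by
      intro j z
      refine congrFun (ih (hq.fderiv_apply _) (hn.fderiv hq j) fun z => ?_) z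
      have h2 := norm_iteratedFDeriv_clm_apply_const (𝕜 := ℝ) (f := _root_.fderiv ℝ q)
        (c := ((0, EuclideanSpace.single j (1 : ℝ)) : Euc n × Euc n)) (x := z) (n := D) (N := ∞)
        (hs.fderiv_right (m := ∞) (by simp)).contDiffAt (mod_cast le_top)
      rw [norm_iteratedFDeriv_fderiv, h z, norm_zero, mul_zero] at h2
      exact norm_le_zero_iff.1 h2
    have h2 : ∀ z (w : Euc n), _root_.fderiv ℝ q z (0, w) = 0 := by
      intro z w
      have e : ((0, w) : Euc n × Euc n) = ∑ j, w j •
          ((0, EuclideanSpace.single j (1 : ℝ)) : Euc n × Euc n) := by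
        have e1 : w = ∑ j, w j • (EuclideanSpace.single j (1 : ℝ) : Euc n) := by
          ext i
          simp [Finset.sum_apply, Pi.single_apply]
        refine Prod.ext ?_ ?_
        · simp [Prod.fst_sum]
        · rw [Prod.snd_sum]
          simpa using e1
      rw [e, map_sum]
      exact Finset.sum_eq_zero fun j _ => by rw [map_smul, h1, smul_zero]
    have h3 : ∀ z, q z = q (z.1, 0) := by
      intro z
      have hd : ∀ ξ, HasFDerivAt (fun ξ : Euc n => q (z.1, ξ))
          ((_root_.fderiv ℝ q (z.1, ξ)).comp (ContinuousLinearMap.inr ℝ (Euc n) (Euc n))) ξ := by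
        intro ξ
        exact ((hs.differentiable (by simp)) _).hasFDerivAt.comp ξ (hasFDerivAt_prodMk_right _ _)
      refine is_const_of_fderiv_eq_zero (𝕜 := ℝ) (f := fun ξ : Euc n => q (z.1, ξ))
        (fun ξ => (hd ξ).differentiableAt) (fun ξ => ?_) z.2 0
      rw [(hd ξ).fderiv]
      ext1 w
      exact h2 _ w
    set f : Euc n → ℂ := fun y => q (y, 0) with hf
    have hft : f.HasTemperateGrowth := (hq.pair_temperate ()).comp
      (ContinuousLinearMap.inl ℝ (Euc n) (Euc n)).hasTemperateGrowth
    have h4 : q = fun z => f z.1 := by ext1 z; exact h3 z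
    -- The Gaussian has no zeros, so the one index μ = 0 already forces f = 0.
    have h5 : f =ᵐ[volume] 0 := by
      filter_upwards [hn fun _ => 0] with x hx
      rw [h4, weylPair_fst hft] at hx
      exact (mul_eq_zero.1 hx).resolve_right (hermiteSchwartz_zero_ne_zero x)
    have h6 : f = 0 := (Continuous.ae_eq_iff_eq volume hft.1.continuous continuous_zero).1 h5
    rw [h4, h6]
    rfl

end

/-! ### Blow-up of the symbol at the circle. -/

section
variable {n : ℕ} {ι : Type*}

/-- The inclusion of the transversal space into phase space. -/
noncomputable def transLift (n : ℕ) : TransSpace n →L[ℝ] Phase n :=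
  (ContinuousLinearMap.fst ℝ _ _).prod
    (((ContinuousLinearMap.fst ℝ _ _).comp (ContinuousLinearMap.snd ℝ _ _)).prod
      ((0 : TransSpace n →L[ℝ] ℝ).prod
        ((ContinuousLinearMap.snd ℝ _ _).comp (ContinuousLinearMap.snd ℝ _ _))))

lemma transLift_apply (v : TransSpace n) : transLift n v = (v.1, v.2.1, 0, v.2.2) := rfl

lemma iteratedFDeriv_transSlice {b : Phase n → ℂ} (hb : ContDiff ℝ ∞ b) (j : ℕ) (t : ℝ) :
    iteratedFDeriv ℝ j (transSlice b t) 0 =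
      (iteratedFDeriv ℝ j b (0, 0, t, 0)).compContinuousLinearMap fun _ => transLift n := by
  have e : transSlice b t = (fun z => b (((0, 0, t, 0) : Phase n) + z)) ∘ transLift n := by
    ext1 v
    simp [transSlice, transLift_apply]
  have hs : ContDiff ℝ ∞ (fun z => b (((0, 0, t, 0) : Phase n) + z)) :=
    hb.comp (contDiff_const.add contDiff_id)
  rw [e, (transLift n).iteratedFDeriv_comp_right hs 0 (i := j) (mod_cast le_top), map_zero,
    iteratedFDeriv_comp_add_left, add_zero]

lemma continuous_iteratedFDeriv_transSlice {b : Phase n → ℂ} (hb : ContDiff ℝ ∞ b) (j : ℕ)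
    (w : Fin j → TransSpace n) :
    Continuous fun t => iteratedFDeriv ℝ j (transSlice b t) 0 w := by
  simp only [iteratedFDeriv_transSlice hb, ContinuousMultilinearMap.compContinuousLinearMap_apply]
  exact (contDiff_iteratedFDeriv_apply hb _).continuous.comp (by fun_prop)

lemma PeriodicInT.transSlice {b : Phase n → ℂ} (hb : PeriodicInT b) :
    Function.Periodic (transSlice b) (2 * Real.pi) := fun t => by
  ext1 v
  exact hb v.1 v.2.1 t v.2.2

lemma UniformSymbol.exists_pair_sum {σ : Type*} (s : Finset σ)
    {b : σ → ι → Euc n × Euc n → ℂ}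
    (hb : ∀ k ∈ s, ∃ M : ℕ, UniformSymbol (pairWeight M M) (b k)) :
    ∃ M : ℕ, UniformSymbol (pairWeight M M) (fun i z => ∑ k ∈ s, b k i z) := by
  choose! M hM using hb
  refine ⟨s.sup M, UniformSymbol.sum s b (pairWeight_nonneg _ _) fun k hk => ?_⟩
  have h := Finset.le_sup (f := M) hk
  exact (hM k hk).pair_mono h (mod_cast h)

/-- The symbol with semiclassical parameter `ε ^ 2` seen at distance `ε` from the circle. -/
noncomputable def blowup (a : ℝ → Phase n → ℂ) (L : ℕ) (s ε t : ℝ) (z : Euc n × Euc n) : ℂ :=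
  ((ε ^ L)⁻¹ : ℝ) • transSlice (a (ε ^ 2)) t (ε • ((z.1, z.2, s) : TransSpace n))

/-- The leading term of `blowup a L s ε` as `ε` tends to zero. -/
noncomputable def leadingForm (c : ℕ → Phase n → ℂ) (L : ℕ) (s t : ℝ) (z : Euc n × Euc n) : ℂ :=
  ∑ k ∈ Finset.range (L / 2 + 1), (((L - 2 * k).factorial : ℝ)⁻¹ : ℝ) •
    diagForm (iteratedFDeriv ℝ (L - 2 * k) (transSlice (c k) t) 0) s z

/-- Transversal vanishing of the coefficients below the weight `L`, where `ħ` has weight two. -/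
def VanishesBelow (c : ℕ → Phase n → ℂ) (L : ℕ) : Prop :=
  ∀ k j, j + 2 * k < L → ∀ t, iteratedFDeriv ℝ j (transSlice (c k) t) 0 = 0

/-- Admissible scales `ε`, for which `ε ^ 2` is an admissible semiclassical parameter. -/
abbrev BlowupScale (ħ₀ : ℝ) : Type := {ε : ℝ // ε ∈ Set.Ioc 0 1 ∧ ε ^ 2 ∈ Set.Ioo 0 ħ₀}

/-- With ħ = ε² the k-th term keeps the factor ε ^ (-(L - 2k)), matching its Taylor order at weight
L. Expanding up to L / 2 + 1 makes the remainder negligible, since 2 (L / 2 + 1) > L under integer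
division. -/
lemma blowup_eq (a : ℝ → Phase n → ℂ) (c : ℕ → Phase n → ℂ) (L : ℕ) (s t : ℝ) {ε : ℝ}
    (hε : 0 < ε) (z : Euc n × Euc n) :
    blowup a L s ε t z =
      ∑ k ∈ Finset.range (L / 2 + 1), ((ε ^ (L - 2 * k))⁻¹ : ℝ) •
        transSlice (c k) t (ε • ((z.1, z.2, s) : TransSpace n)) +
      (ε ^ (2 * (L / 2 + 1) - L) : ℝ) •
        transSlice (symbolRemainder a c (L / 2 + 1) (ε ^ 2)) t
          (ε • ((z.1, z.2, s) : TransSpace n)) := by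
  have h1 : ∀ k, 2 * k ≤ L → (ε ^ L)⁻¹ * (ε ^ 2) ^ k = (ε ^ (L - 2 * k))⁻¹ := by
    intro k hk
    obtain ⟨m, rfl⟩ := Nat.exists_eq_add_of_le hk
    rw [Nat.add_sub_cancel_left, pow_add, ← pow_mul]
    field_simp
  have h2 : (ε ^ L)⁻¹ * (ε ^ 2) ^ (L / 2 + 1) = ε ^ (2 * (L / 2 + 1) - L) := by
    obtain ⟨m, hm⟩ := Nat.exists_eq_add_of_le (show L ≤ 2 * (L / 2 + 1) by omega)
    rw [← pow_mul, hm, Nat.add_sub_cancel_left, pow_add]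
    field_simp
  unfold blowup transSlice
  rw [symbol_eq_sum_add_remainder a c (L / 2 + 1) (by positivity : 0 < ε ^ 2), smul_add, smul_smul,
    h2, Finset.smul_sum]
  congr 1
  refine Finset.sum_congr rfl fun k hk => ?_
  have hk' : 2 * k ≤ L := by have := Finset.mem_range.1 hk; omega
  rw [← h1 k hk', ← smul_smul]
  simp only [Complex.real_smul]

variable {ħ₀ : ℝ} {a : ℝ → Phase n → ℂ} {c : ℕ → Phase n → ℂ}

lemma IsSemiclassicalSymbol.blowup_remainder (ha : IsSemiclassicalSymbol ħ₀ a c) (K : ℕ) (s : ℝ) :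
    ∃ M : ℕ, UniformSymbol (pairWeight M M) (fun (p : BlowupScale ħ₀ × ℝ) z =>
      transSlice (symbolRemainder a c K ((p.1 : ℝ) ^ 2)) p.2
        ((p.1 : ℝ) • ((z.1, z.2, s) : TransSpace n))) := by
  obtain ⟨M, hM⟩ := ha.remainder K
  have h := ((hM.transSlice).scaled (J := 0) (fun j hj => absurd hj (Nat.not_lt_zero j)) s).reindex
    (fun p : BlowupScale ħ₀ × ℝ => ((⟨(p.1 : ℝ) ^ 2, p.1.2.2⟩, p.2), ⟨p.1, p.1.2.1⟩))
  simp only [pow_zero, inv_one, one_smul, zero_add] at h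
  exact ⟨M, h⟩

/-- Vanishing below weight L says exactly that each c k with 2k ≤ L vanishes transversally to order
L - 2k, which compensates its negative power of ε. -/
lemma IsSemiclassicalSymbol.uniformSymbol_blowup (ha : IsSemiclassicalSymbol ħ₀ a c) {L : ℕ}
    (hL : VanishesBelow c L) (s : ℝ) :
    ∃ M : ℕ, UniformSymbol (pairWeight M M)
      (fun p : BlowupScale ħ₀ × ℝ => blowup a L s p.1 p.2) := by
  obtain ⟨M, hM⟩ := ha.blowup_remainder (L / 2 + 1) s
  have h1 : ∀ k ∈ Finset.range (L / 2 + 1), ∃ M : ℕ, UniformSymbol (pairWeight M M)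
      (fun (p : BlowupScale ħ₀ × ℝ) z => (((p.1 : ℝ) ^ (L - 2 * k))⁻¹ : ℝ) •
        transSlice (c k) p.2 ((p.1 : ℝ) • ((z.1, z.2, s) : TransSpace n))) := by
    intro k hk
    have hk' : 2 * k ≤ L := by have := Finset.mem_range.1 hk; omega
    obtain ⟨M, hM⟩ := (ha.coeff k).phaseSymbol
    have h := ((hM.transSlice).scaled (J := L - 2 * k)
      (fun j hj p => hL k j (by omega) p.2) s).reindex
      (fun p : BlowupScale ħ₀ × ℝ => (((), p.2), ⟨p.1, p.1.2.1⟩))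
    exact ⟨_, h⟩
  obtain ⟨M', hM'⟩ := UniformSymbol.exists_pair_sum _ h1
  have h2 := hM.const_smul (fun p => (p.1 : ℝ) ^ (2 * (L / 2 + 1) - L)) 1 fun p => by
    rw [Real.norm_of_nonneg (pow_nonneg p.1.2.1.1.le _)]
    exact pow_le_one₀ p.1.2.1.1.le p.1.2.1.2
  refine ⟨max M' M, ?_⟩
  have h3 := (hM'.pair_mono (L' := (max M' M : ℕ)) (le_max_left M' M) (mod_cast le_max_left M' M)).add
    (h2.pair_mono (L' := (max M' M : ℕ)) (le_max_right M' M) (mod_cast le_max_right M' M))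
  convert h3 using 3 with p z
  exact blowup_eq a c L s p.2 p.1.2.1.1 z

/-- Each coefficient contributes its leading Taylor term at the origin of the transversal space, and
the remainder is a positive power of ε times a bounded quantity. -/
lemma IsSemiclassicalSymbol.tendsto_blowup (ha : IsSemiclassicalSymbol ħ₀ a c) {L : ℕ}
    (hL : VanishesBelow c L) (s t : ℝ) (z : Euc n × Euc n) (ε : ℕ → BlowupScale ħ₀)
    (hε : Tendsto (fun i => (ε i : ℝ)) atTop (𝓝 0)) :
    Tendsto (fun i => blowup a L s (ε i) t z) atTop (𝓝 (leadingForm c L s t z)) := by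
  have hε' : Tendsto (fun i => (ε i : ℝ)) atTop (𝓝[>] 0) :=
    tendsto_nhdsWithin_iff.2 ⟨hε, Eventually.of_forall fun i => (ε i).2.1.1⟩
  have e : (fun i => blowup a L s (ε i) t z) = _ :=
    funext fun i => blowup_eq a c L s t (ε i).2.1.1 z
  rw [e, ← add_zero (leadingForm c L s t z)]
  refine Tendsto.add (tendsto_finsetSum _ fun k hk => ?_) ?_
  · have hk' : 2 * k ≤ L := by have := Finset.mem_range.1 hk; omega
    obtain ⟨M, hM⟩ := (ha.coeff k).phaseSymbol
    have h := tendsto_taylor_leading (hM.transSlice.smooth ((), t)) 0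
      ((z.1, z.2, s) : TransSpace n) (L - 2 * k) (fun j hj => hL k j (by omega) t)
    simp only [zero_add] at h
    exact h.comp hε'
  · obtain ⟨M, hM⟩ := ha.blowup_remainder (L / 2 + 1) s
    obtain ⟨C, -, hC⟩ := hM.norm_le
    have h1 : Tendsto (fun i => (ε i : ℝ) ^ (2 * (L / 2 + 1) - L)) atTop (𝓝 0) := by
      have := hε.pow (2 * (L / 2 + 1) - L)
      rwa [zero_pow (by omega)] at this
    exact h1.zero_smul_isBoundedUnder_le (isBoundedUnder_of ⟨_, fun i => hC (ε i, t) z⟩)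

lemma IsSemiclassicalSymbol.uniformSymbol_leadingForm (ha : IsSemiclassicalSymbol ħ₀ a c) (L : ℕ)
    (s : ℝ) : ∃ M : ℕ, UniformSymbol (pairWeight M M) (leadingForm c L s) := by
  refine UniformSymbol.exists_pair_sum _ fun k _ => ?_
  obtain ⟨M, hM⟩ := (ha.coeff k).phaseSymbol
  obtain ⟨C, -, hC⟩ := hM.transSlice.bound (L - 2 * k)
  refine ⟨L - 2 * k, UniformSymbol.const_smul (uniformSymbol_diagForm (B := C * (1 + 0) ^ M)
    (fun t => ?_) s) _ _ fun _ => le_rfl⟩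
  simpa using hC ((), t) 0

lemma IsSemiclassicalSymbol.continuous_weylPair_leadingForm (ha : IsSemiclassicalSymbol ħ₀ a c)
    (L : ℕ) (s : ℝ) (v : 𝓢(Euc n, ℂ)) (x : Euc n) :
    Continuous fun t => weylPair 1 (leadingForm c L s t) v x := by
  obtain ⟨M, hM⟩ := ha.uniformSymbol_leadingForm L s
  refine continuous_iff_seqContinuous.2 fun u t hu => ?_
  refine tendsto_weylPair one_ne_zero (hM.reindex u) (fun z => ?_) v x
  refine tendsto_finsetSum _ fun k _ => Tendsto.const_smul ?_ _
  exact ((continuous_iteratedFDeriv_transSlice (ha.coeff k).smooth _ _).tendsto t).comp hu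

lemma IsSemiclassicalSymbol.leadingForm_periodic (ha : IsSemiclassicalSymbol ħ₀ a c) (L : ℕ)
    (s : ℝ) : Function.Periodic (leadingForm c L s) (2 * Real.pi) := fun t => by
  ext1 z
  unfold leadingForm
  exact Finset.sum_congr rfl fun k _ => by rw [(ha.coeff k).periodic.transSlice t]

lemma iteratedFDeriv_leadingForm (c : ℕ → Phase n → ℂ) (L : ℕ)
    (s t : ℝ) (z : Euc n × Euc n) : iteratedFDeriv ℝ (L + 1) (leadingForm c L s t) z = 0 := by
  set D : ℕ → Euc n × Euc n → ℂ := fun k =>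
    diagForm (iteratedFDeriv ℝ (L - 2 * k) (transSlice (c k) t) 0) s with hD
  have hs : ∀ k, ContDiff ℝ (L + 1 : ℕ) (D k) := fun k =>
    (norm_iteratedFDeriv_diagForm_le _ s 0 0).1.of_le (mod_cast le_top)
  have e : leadingForm c L s t = ∑ k ∈ Finset.range (L / 2 + 1),
      (((L - 2 * k).factorial : ℝ)⁻¹ : ℝ) • D k := by
    ext1 z
    simp [leadingForm, hD]
  have hs' : ∀ k ∈ Finset.range (L / 2 + 1), ContDiffAt ℝ (L + 1 : ℕ)
      ((((L - 2 * k).factorial : ℝ)⁻¹ : ℝ) • D k) z := fun k _ =>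
    (ContDiff.const_smul (R := ℝ) _ (hs k)).contDiffAt
  rw [e, iteratedFDeriv_sum_apply hs']
  refine Finset.sum_eq_zero fun k _ => ?_
  rw [iteratedFDeriv_const_smul_apply (hs k).contDiffAt,
    iteratedFDeriv_diagForm_eq_zero (by omega), smul_zero]

end

/-! ### From decay on the Hermite basis to flatness. -/

/-- Zero Fourier coefficients are summable, so the Fourier series of the continuous function
converges to it at every point. -/
lemma eq_zero_of_integral_angleExp_mul_eq_zero {g : ℝ → ℂ} (hg : Continuous g)
    (hp : Function.Periodic g (2 * Real.pi))
    (h : ∀ k : ℤ, ∫ t, angleExp k t * g t ∂circleMeasure = 0) (t : ℝ) : g t = 0 := by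
  have : Fact (0 < 2 * Real.pi) := ⟨by positivity⟩
  let f : C(AddCircle (2 * Real.pi), ℂ) := ⟨hp.lift, by
    exact continuous_coinduced_dom.2 (by exact hg)⟩
  have hf : ∀ t : ℝ, f (t : AddCircle (2 * Real.pi)) = g t := fun t => hp.lift_coe t
  have h1 : fourierCoeff (f : AddCircle (2 * Real.pi) → ℂ) = fun _ => 0 := by
    ext1 k
    rw [fourierCoeff_eq_intervalIntegral _ k 0, zero_add,
      intervalIntegral.integral_of_le (by positivity)]
    have h2 : ∀ x : ℝ, (fourier (-k) (x : AddCircle (2 * Real.pi)) : ℂ) • f x =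
        angleExp k x * g x := by
      intro x
      rw [hf, fourier_coe_apply, smul_eq_mul, angleExp]
      congr 2
      push_cast
      field_simp
    simp only [h2]
    rw [h k, smul_zero]
  have h3 := has_pointwise_sum_fourier_series_of_summable (f := f) (by rw [h1]; exact summable_zero)
    (t : AddCircle (2 * Real.pi))
  rw [h1] at h3
  simp only [zero_smul] at h3
  rw [← hf]
  exact h3.unique hasSum_zero

section
variable {n : ℕ} {ħ₀ : ℝ} {a : ℝ → Phase n → ℂ} {c : ℕ → Phase n → ℂ}

lemma indexNorm_le (μ : Fin n → ℕ) (m : ℤ) : indexNorm μ m ≤ indexNorm μ 0 + |(m : ℝ)| := by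
  have h0 : 0 ≤ indexNorm μ 0 := Real.sqrt_nonneg _
  refine Real.sqrt_le_iff.2 ⟨by positivity, ?_⟩
  have h1 : indexNorm μ 0 ^ 2 = ∑ i, (μ i : ℝ) ^ 2 := by
    rw [indexNorm, Real.sq_sqrt (by positivity)]
    simp
  rw [add_sq, h1, sq_abs]
  have := mul_nonneg h0 (abs_nonneg (m : ℝ))
  linarith

/-- Frequencies and scales tending to zero along which the classical momentum is fixed. -/
lemma exists_blowup_sequence (hħ₀ : 0 < ħ₀) {s : ℝ} (hs : 0 < s) (k : ℤ) {B δ : ℝ} (hδ : 0 < δ) :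
    ∃ (m : ℕ → ℤ) (ε : ℕ → BlowupScale ħ₀), Tendsto (fun i => (ε i : ℝ)) atTop (𝓝 0) ∧
      ∀ i, (ε i : ℝ) * (k + 2 * m i) / 2 = s ∧ 0 < m i ∧ B * (ε i : ℝ) ≤ δ := by
  -- This solves ε (k + 2m) / 2 = s with m = i. The frequency is an integer, so ε runs through a
  -- discrete sequence; discarding the first N terms secures admissibility and m > 0.
  set r : ℕ → ℝ := fun i => 2 * s / (k + 2 * i) with hr
  have hden : Tendsto (fun i : ℕ => (k : ℝ) + 2 * i) atTop atTop :=
    tendsto_atTop_add_const_left _ _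
      (tendsto_natCast_atTop_atTop.const_mul_atTop (by norm_num))
  have hr0 : Tendsto r atTop (𝓝 0) := tendsto_const_nhds.div_atTop hden
  have hr2 : Tendsto (fun i => r i ^ 2) atTop (𝓝 0) := by simpa using hr0.pow 2
  have hrB : Tendsto (fun i => B * r i) atTop (𝓝 0) := by simpa using hr0.const_mul B
  obtain ⟨N, hN⟩ := eventually_atTop.1 ((hden.eventually_gt_atTop 0).and
    ((hr0.eventually (ge_mem_nhds one_pos)).and ((hr2.eventually (gt_mem_nhds hħ₀)).and
      ((hrB.eventually (ge_mem_nhds hδ)).and (eventually_gt_atTop 0)))))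
  have hpos : ∀ i, 0 < r (i + N) := fun i =>
    div_pos (by positivity) (hN (i + N) (by omega)).1
  refine ⟨fun i => ((i + N : ℕ) : ℤ), fun i => ⟨r (i + N), ⟨hpos i, (hN (i + N) (by omega)).2.1⟩,
    pow_pos (hpos i) 2, (hN (i + N) (by omega)).2.2.1⟩, (tendsto_add_atTop_iff_nat N).2 hr0,
    fun i => ⟨?_, ?_, (hN (i + N) (by omega)).2.2.2.1⟩⟩
  · have := (hN (i + N) (by omega)).1.ne'
    simp only [hr, Int.cast_natCast]
    field_simp
  · have := (hN (i + N) (by omega)).2.2.2.2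
    exact Int.natCast_pos.2 this

/-- The dilation shrinks τ by ε² but x and ξ by ε only, so τ must be taken at s / ε for all three to
lie at scale ε. -/
lemma weylPair_blowup (a : ℝ → Phase n → ℂ) (L : ℕ) (s t : ℝ) {ε : ℝ} (hε : 0 < ε)
    (v : Euc n → ℂ) (x : Euc n) :
    weylPair 1 (blowup a L s ε t) v x = (((ε ^ L)⁻¹ : ℝ) : ℂ) *
      weylPair 1 (phaseSlice (fun z => a (ε ^ 2) (phaseDilation n ε z)) t (s / ε)) v x := by
  rw [← weylPair_smul_left]
  congr 1
  ext1 z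
  have e : ε ^ 2 * (s / ε) = ε * s := by field_simp
  simp only [blowup, transSlice, phaseSlice, phaseDilation_apply, e, Complex.real_smul]
  rfl

lemma IsSemiclassicalSymbol.phaseSymbol_dilation (ha : IsSemiclassicalSymbol ħ₀ a c)
    (ε : BlowupScale ħ₀) :
    ∃ M, PhaseSymbol M (fun _ : Unit => fun z => a ((ε : ℝ) ^ 2) (phaseDilation n ε z)) := by
  obtain ⟨M, hM⟩ := ha.remainder 0
  have h := hM.dilation (fun _ : Unit => ⟨(ε : ℝ) ^ 2, ε.2.2⟩) (fun _ => (ε : ℝ))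
    (fun _ => ε.2.1.1) (fun _ => ε.2.1.2)
  simp only [symbolRemainder, pow_zero, inv_one, Finset.range_zero, Finset.sum_empty, sub_zero,
    one_smul] at h
  exact ⟨M, h⟩

/-- The Fourier coefficient of a rescaled quantization is a matrix entry of the operator. -/
lemma circle_average_blowup (a : ℝ → Phase n → ℂ) (L : ℕ) {s ε : ℝ} (hε : 0 < ε) {k m : ℤ}
    (hm : ε * (k + 2 * m) / 2 = s) (v : Euc n → ℂ) (x : Euc n) :
    (((2 * Real.pi)⁻¹ : ℝ) : ℂ) *
        ∫ t, angleExp k t * weylPair 1 (blowup a L s ε t) v x ∂circleMeasure =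
      (((ε ^ L)⁻¹ : ℝ) : ℂ) *
        weylCoeff 1 (fun z => a (ε ^ 2) (phaseDilation n ε z)) v m (k + 2 * m) x := by
  have e : (1 : ℝ) * ((k + 2 * m : ℤ) : ℝ) / 2 = s / ε := by
    rw [← hm]
    push_cast
    field_simp
  rw [weylCoeff_eq, e, add_sub_cancel_right, mul_left_comm]
  congr 1
  rw [← integral_const_mul]
  refine integral_congr_ae (Eventually.of_forall fun t => ?_)
  simp only [weylPair_blowup a L s t hε]
  ring

/-- Decay on Hermite functions bounds the rescaled matrix entries. -/
lemma IsSemiclassicalSymbol.eLpNorm_blowup_le (ha : IsSemiclassicalSymbol ħ₀ a c) (L : ℕ)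
    {μ : Fin n → ℕ} {s B C δ : ℝ} (hs : 0 < s) {k m : ℤ} {ε : BlowupScale ħ₀}
    (hB : indexNorm μ 0 + |(k : ℝ)| + s ≤ B)
    (hC : ∀ ħ ∈ Set.Ioo 0 ħ₀, 0 < indexNorm μ m → indexNorm μ m * ħ ≤ δ →
        normL2 (weylOp ħ (a ħ) (hermiteBasis ħ μ m))
          ≤ ENNReal.ofReal (C * (indexNorm μ m * ħ) ^ (L + 1)))
    (hm : (ε : ℝ) * (k + 2 * m) / 2 = s) (hm0 : 0 < m) (hδ : B * (ε : ℝ) ≤ δ) :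
    eLpNorm (fun x => (((2 * Real.pi)⁻¹ : ℝ) : ℂ) * ∫ t, angleExp k t *
      weylPair 1 (blowup a L s ε t) (hermiteSchwartz 1 μ) x ∂circleMeasure) 2 volume ≤
      ENNReal.ofReal (|C| * B ^ (L + 1) * ε) := by
  obtain ⟨⟨hε0, hε1⟩, hεħ⟩ := ε.2
  set r : ℝ := (ε : ℝ) with hr
  -- Since m r is s up to k r / 2, the index length grows only like 1 / r. Hence |(μ, m)| ħ with ħ =
  -- r² is O(r), and decay of order L + 1 outweighs the factor r ^ (-L) with one power to spare.
  have hI : indexNorm μ m * r ^ 2 ≤ B * r := by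
    have h1 := indexNorm_le μ m
    have h2 : |(m : ℝ)| * r ≤ s + |(k : ℝ)| * r := by
      have e : (m : ℝ) * r = s - k * r / 2 := by rw [← hm]; ring
      have h3 : |(m : ℝ) * r| ≤ |s| + |k * r / 2| := by rw [e]; exact abs_sub _ _
      rw [abs_mul, abs_of_pos hε0, abs_of_pos hs, abs_div, abs_mul, abs_of_pos hε0, abs_two] at h3
      have : 0 ≤ |(k : ℝ)| * r := by positivity
      linarith
    have h4 : 0 ≤ indexNorm μ 0 := Real.sqrt_nonneg _
    have h5 : indexNorm μ m * r ≤ B := by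
      calc indexNorm μ m * r ≤ (indexNorm μ 0 + |(m : ℝ)|) * r := by gcongr
        _ = indexNorm μ 0 * r + |(m : ℝ)| * r := by ring
        _ ≤ indexNorm μ 0 * 1 + (s + |(k : ℝ)| * 1) := by
            refine add_le_add (by gcongr) (h2.trans ?_)
            gcongr
        _ ≤ B := by linarith
    calc indexNorm μ m * r ^ 2 = indexNorm μ m * r * r := by ring
      _ ≤ B * r := by gcongr
  have hI0 : 0 < indexNorm μ m := by
    refine lt_of_lt_of_le ?_ (abs_le_indexNorm μ m)
    exact abs_pos.2 (Int.cast_ne_zero.2 hm0.ne')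
  have h1 := hC (r ^ 2) hεħ hI0 (hI.trans hδ)
  rw [normL2_weylOp_dilation hεħ.1 hε0, div_self (by positivity), hermiteBasis_eq one_pos] at h1
  obtain ⟨M, hM⟩ := ha.phaseSymbol_dilation ε
  have hp : PeriodicInT (fun z => a (r ^ 2) (phaseDilation n r z)) :=
    (ha.periodic _ hεħ).dilation r
  have h2 := (eLpNorm_weylCoeff_le_normL2 1 (hM.smooth ()).continuous hp
    (hermiteSchwartz 1 μ).continuous m (k + 2 * m)
    (summable_weylCoeff hM hp one_pos (hermiteSchwartz 1 μ) m)).trans h1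
  simp only [circle_average_blowup a L hε0 hm]
  have h3 := eLpNorm_const_smul (((r ^ L)⁻¹ : ℝ) : ℂ) (weylCoeff 1
    (fun z => a (r ^ 2) (phaseDilation n r z)) (hermiteSchwartz 1 μ) m (k + 2 * m)) 2 volume
  refine h3.trans_le ?_
  rw [← ofReal_norm, Complex.norm_real, Real.norm_of_nonneg (by positivity)]
  refine (mul_le_mul' le_rfl h2).trans ?_
  rw [← ENNReal.ofReal_mul (by positivity)]
  refine ENNReal.ofReal_le_ofReal ?_
  calc (r ^ L)⁻¹ * (C * (indexNorm μ m * r ^ 2) ^ (L + 1))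
      ≤ (r ^ L)⁻¹ * (|C| * (B * r) ^ (L + 1)) := by
        gcongr
        exact le_abs_self C
    _ = |C| * B ^ (L + 1) * r := by
        rw [mul_pow, pow_succ r]
        field_simp

/-- Along the sequence of scales the k-th Fourier coefficient of the rescaled quantization has L²
norm O(ε), while it converges pointwise to that of the leading form by dominated convergence. Lower
semicontinuity of the L² norm under pointwise limits makes the limit zero. -/
lemma IsSemiclassicalSymbol.leadingForm_fourier (ha : IsSemiclassicalSymbol ħ₀ a c) (hħ₀ : 0 < ħ₀)
    (hd : HermiteDecay ħ₀ a) {L : ℕ} (hL : VanishesBelow c L) {s : ℝ} (hs : 0 < s)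
    (μ : Fin n → ℕ) (k : ℤ) : ∀ᵐ x, ∫ t, angleExp k t *
      weylPair 1 (leadingForm c L s t) (hermiteSchwartz 1 μ) x ∂circleMeasure = 0 := by
  obtain ⟨C, δ, hδ, hC⟩ := hd (L + 1)
  obtain ⟨m, ε, hε, hm⟩ := exists_blowup_sequence hħ₀ hs k hδ
    (B := indexNorm μ 0 + |(k : ℝ)| + s)
  set v := hermiteSchwartz 1 μ with hv
  set F : ℕ → Euc n → ℂ := fun i x => (((2 * Real.pi)⁻¹ : ℝ) : ℂ) *
    ∫ t, angleExp k t * weylPair 1 (blowup a L s (ε i) t) v x ∂circleMeasure with hF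
  set F' : Euc n → ℂ := fun x => (((2 * Real.pi)⁻¹ : ℝ) : ℂ) *
    ∫ t, angleExp k t * weylPair 1 (leadingForm c L s t) v x ∂circleMeasure with hF'
  have hbound : ∀ i, eLpNorm (F i) 2 volume ≤ _ := fun i =>
    ha.eLpNorm_blowup_le L hs le_rfl (fun ħ hħ => hC ħ hħ μ (m i)) (hm i).1 (hm i).2.1 (hm i).2.2
  have hmeas : ∀ i, AEStronglyMeasurable (F i) volume := by
    intro i
    obtain ⟨M, hM⟩ := ha.phaseSymbol_dilation (ε i)
    have e : F i = fun x => _ := funext fun x =>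
      circle_average_blowup a L (ε i).2.1.1 (hm i).1 v x
    rw [e]
    exact ((stronglyMeasurable_weylCoeff (hM.smooth ()).continuous v.continuous 1 (m i)
      (k + 2 * m i)).const_mul _).aestronglyMeasurable
  have hlim : ∀ x, Tendsto (fun i => F i x) atTop (𝓝 (F' x)) := by
    intro x
    obtain ⟨M, hM⟩ := ha.uniformSymbol_blowup hL s
    obtain ⟨D, hD0, hD⟩ := weylPair_bounded one_ne_zero hM v x
    refine Tendsto.const_mul _ (tendsto_integral_of_dominated_convergence (fun _ => D) (fun i => ?_)
      (integrable_const D) (fun i => Eventually.of_forall fun t => ?_)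
      (Eventually.of_forall fun t => ?_))
    · obtain ⟨M, hM⟩ := ha.phaseSymbol_dilation (ε i)
      simp only [weylPair_blowup a L s _ (ε i).2.1.1]
      exact ((continuous_angleExp k).mul (continuous_const.mul
        (continuous_weylPair_slice hM one_ne_zero _ v x))).aestronglyMeasurable
    · rw [norm_mul, norm_angleExp, one_mul]
      exact hD (ε i, t)
    · exact (tendsto_weylPair one_ne_zero (hM.reindex fun i => (ε i, t))
        (fun z => ha.tendsto_blowup hL s t z ε hε) v x).const_mul _
  have hzero : eLpNorm F' 2 volume = 0 := by
    refine le_antisymm ?_ zero_le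
    refine (Lp.eLpNorm_lim_le_liminf_eLpNorm hmeas F' (Eventually.of_forall hlim)).trans ?_
    refine (liminf_le_liminf (Eventually.of_forall hbound)).trans (le_of_eq ?_)
    have h1 := ENNReal.tendsto_ofReal
      (hε.const_mul (|C| * (indexNorm μ 0 + |(k : ℝ)| + s) ^ (L + 1)))
    rw [mul_zero, ENNReal.ofReal_zero] at h1
    exact h1.liminf_eq
  have hF'm : AEStronglyMeasurable F' volume :=
    aestronglyMeasurable_of_tendsto_ae atTop hmeas (Eventually.of_forall hlim)
  filter_upwards [(eLpNorm_eq_zero_iff hF'm two_ne_zero).1 hzero] with x hx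
  refine (mul_eq_zero.1 hx).resolve_left ?_
  exact Complex.ofReal_ne_zero.2 (by positivity)

/-- There are countably many k, so outside one null set of x all Fourier coefficients vanish
together. Continuity in t then gives vanishing at every angle, and the leading form is a polynomial
null symbol. -/
lemma IsSemiclassicalSymbol.leadingForm_eq_zero (ha : IsSemiclassicalSymbol ħ₀ a c) (hħ₀ : 0 < ħ₀)
    (hd : HermiteDecay ħ₀ a) {L : ℕ} (hL : VanishesBelow c L) {s : ℝ} (hs : 0 < s) (t : ℝ) :
    leadingForm c L s t = 0 := by
  obtain ⟨M, hM⟩ := ha.uniformSymbol_leadingForm L s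
  refine WeylNull.eq_zero (L + 1) (hM.reindex fun _ : Unit => t) (fun μ => ?_)
    (iteratedFDeriv_leadingForm c L s t)
  filter_upwards [ae_all_iff.2 (ha.leadingForm_fourier hħ₀ hd hL hs μ)] with x hx
  exact eq_zero_of_integral_angleExp_mul_eq_zero
    (ha.continuous_weylPair_leadingForm L s (hermiteSchwartz 1 μ) x)
    (fun t => congrArg (fun q => weylPair 1 q (hermiteSchwartz 1 μ) x)
      (ha.leadingForm_periodic L s t)) hx t

/-- The leading form mixes Taylor terms of different coefficients c k, but their degrees L - 2k in
(x, ξ, s) are distinct. Evaluation along a ray separates them, and polarization passes from the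
diagonal to the full derivative. -/
lemma IsSemiclassicalSymbol.vanishesBelow_succ (ha : IsSemiclassicalSymbol ħ₀ a c) (hħ₀ : 0 < ħ₀)
    (hd : HermiteDecay ħ₀ a) {L : ℕ} (hL : VanishesBelow c L) : VanishesBelow c (L + 1) := by
  intro k j hkj t
  rcases Nat.lt_or_ge (j + 2 * k) L with h | h
  · exact hL k j h t
  obtain rfl : j = L - 2 * k := by omega
  have hk : k ∈ Finset.range (L / 2 + 1) := Finset.mem_range.2 (by omega)
  obtain ⟨M, hM⟩ := (ha.coeff k).phaseSymbol
  -- The leading form is known to vanish only for s > 0; this half-space is open, which is enough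
  -- for polarization.
  refine (hM.transSlice.smooth ((), t)).iteratedFDeriv_eq_zero_of_diagonal 0
    (U := {v : TransSpace n | 0 < v.2.2}) (isOpen_lt continuous_const (by fun_prop))
    ⟨(0, 0, 1), Set.mem_ofPred.2 one_pos⟩ fun v hv => ?_
  set T : ℕ → ℂ := fun k => (((L - 2 * k).factorial : ℝ)⁻¹ : ℝ) •
    iteratedFDeriv ℝ (L - 2 * k) (transSlice (c k) t) 0 (fun _ => v) with hT
  -- P (r) is the leading form at r v, a polynomial in r with infinitely many positive roots.
  set P : Polynomial ℂ := ∑ k ∈ Finset.range (L / 2 + 1), Polynomial.monomial (L - 2 * k) (T k)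
    with hP
  have hroot : ∀ r : ℝ, 0 < r → P.IsRoot (r : ℂ) := by
    intro r hr
    have h1 := congrFun (ha.leadingForm_eq_zero hħ₀ hd hL (mul_pos hr hv) t) (r • (v.1, v.2.1))
    rw [Polynomial.IsRoot, hP, Polynomial.eval_finsetSum]
    refine Eq.trans ?_ h1
    unfold leadingForm
    refine Finset.sum_congr rfl fun k _ => ?_
    have h2 := (iteratedFDeriv ℝ (L - 2 * k) (transSlice (c k) t) 0).map_smul_univ
      (fun _ => r) (fun _ => v)
    rw [Finset.prod_const, Finset.card_univ, Fintype.card_fin] at h2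
    have h3 : diagForm (iteratedFDeriv ℝ (L - 2 * k) (transSlice (c k) t) 0) (r * v.2.2)
        (r • (v.1, v.2.1)) = iteratedFDeriv ℝ (L - 2 * k) (transSlice (c k) t) 0
          (fun _ => r • v) := rfl
    rw [h3, h2, Polynomial.eval_monomial, hT]
    simp only [Complex.real_smul]
    push_cast
    ring
  have hP0 : P = 0 := by
    refine Polynomial.eq_zero_of_infinite_isRoot P (Set.Infinite.mono (s := Complex.ofReal '' Set.Ioi 0)
      ?_ ((Set.Ioi_infinite 0).image Complex.ofReal_injective.injOn))
    rintro _ ⟨r, hr, rfl⟩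
    exact hroot r hr
  have hc : P.coeff (L - 2 * k) = T k := by
    rw [hP, Polynomial.finsetSum_coeff, Finset.sum_eq_single k]
    · rw [Polynomial.coeff_monomial, if_pos rfl]
    -- Truncated subtraction stays injective here because 2l ≤ L and 2k ≤ L.
    · intro l hl hlk
      rw [Polynomial.coeff_monomial, if_neg]
      have := Finset.mem_range.1 hl
      omega
    · exact fun h => absurd hk h
  rw [hP0, Polynomial.coeff_zero] at hc
  exact (smul_eq_zero.1 hc.symm).resolve_left (by positivity)

theorem IsSemiclassicalSymbol.vanishesBelow (ha : IsSemiclassicalSymbol ħ₀ a c) (hħ₀ : 0 < ħ₀)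
    (hd : HermiteDecay ħ₀ a) (L : ℕ) : VanishesBelow c L := by
  induction L with
  | zero => exact fun k j h => absurd h (Nat.not_lt_zero _)
  | succ L ih => exact ha.vanishesBelow_succ hħ₀ hd ih

/-- A symbol whose derivatives transversal to the circle vanish there is flat on the circle. -/
lemma PhaseSymbol.flat_of_transversal {M : ℕ} {f : Phase n → ℂ}
    (hf : PhaseSymbol M (fun _ : Unit => f))
    (h0 : ∀ j t, iteratedFDeriv ℝ j (_root_.transSlice f t) 0 = 0) (j : ℕ) (t : ℝ) :
    iteratedFDeriv ℝ j f (0, 0, t, 0) = 0 := by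
  have hs := hf.smooth ()
  induction j using Nat.strong_induction_on generalizing t with
  | _ j ih =>
    refine hs.iteratedFDeriv_eq_zero_of_diagonal _ isOpen_univ Set.univ_nonempty fun v _ => ?_
    -- With the lower derivatives zero by induction, the j-th one on the diagonal is j! times the
    -- limit of r ^ (-j) f (p + r v). Moving along v also shifts the angle, but transversal flatness
    -- is uniform in the angle, so f (p + r v) = O(r ^ (j + 1)) and the limit is zero.
    have h1 := tendsto_taylor_leading hs ((0, 0, t, 0) : Phase n) v j fun i hi => ih i hi t
    obtain ⟨C, hC0, hC⟩ := hf.transSlice.flat_origin (j + 1) (fun i _ p => h0 i p.2) 0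
    set w : TransSpace n := (v.1, v.2.1, v.2.2.2) with hw
    have h2 : ∀ r : ℝ, f (((0, 0, t, 0) : Phase n) + r • v) =
        _root_.transSlice f (t + r * v.2.2.1) (r • w) := by
      intro r
      obtain ⟨x, ξ, u, τ⟩ := v
      simp only [_root_.transSlice, hw, Prod.smul_mk, Prod.mk_add_mk, zero_add, smul_eq_mul]
    have h3 : Tendsto (fun r : ℝ => (r ^ j)⁻¹ • f (((0, 0, t, 0) : Phase n) + r • v))
        (𝓝[>] 0) (𝓝 0) := by
      have h4 : Tendsto (fun r : ℝ => r * (C * (‖w‖ ^ (j + 1) * (1 + r * ‖w‖) ^ M)))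
          (𝓝[>] 0) (𝓝 0) := by
        have : Continuous fun r : ℝ => r * (C * (‖w‖ ^ (j + 1) * (1 + r * ‖w‖) ^ M)) := by fun_prop
        have h5 := this.tendsto 0
        rw [zero_mul] at h5
        exact h5.mono_left nhdsWithin_le_nhds
      refine squeeze_zero_norm' ?_ h4
      filter_upwards [self_mem_nhdsWithin] with r hr
      have hr' : (0 : ℝ) < r := hr
      have h6 := hC ((), t + r * v.2.2.1) (r • w)
      rw [norm_iteratedFDeriv_zero, ← h2, norm_smul, Real.norm_of_nonneg hr'.le, Nat.sub_zero] at h6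
      rw [norm_smul, Real.norm_of_nonneg (by positivity), inv_mul_le_iff₀ (by positivity)]
      refine h6.trans (le_of_eq ?_)
      rw [mul_pow, pow_succ]
      ring
    have h7 := tendsto_nhds_unique h1 h3
    exact (smul_eq_zero.1 h7).resolve_left (by positivity)

theorem IsSemiclassicalSymbol.vanishesToInfiniteOrder (ha : IsSemiclassicalSymbol ħ₀ a c)
    (hħ₀ : 0 < ħ₀) (hd : HermiteDecay ħ₀ a) : VanishesToInfiniteOrder c := by
  intro k j t
  obtain ⟨M, hM⟩ := (ha.coeff k).phaseSymbol
  exact hM.flat_of_transversal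
    -- The weight of the i-th derivative of c k is i + 2k, so vanishing below i + 2k + 1 covers it.
    (fun i u => ha.vanishesBelow hħ₀ hd (i + 2 * k + 1) k i (by omega) u) j t

end

theorem proposition4 (n : ℕ) (ħ₀ : ℝ) (hħ₀ : 0 < ħ₀)
    (a : ℝ → Phase n → ℂ) (c : ℕ → Phase n → ℂ)
    (ha : IsSemiclassicalSymbol ħ₀ a c) :
    (VanishesToInfiniteOrder c ↔ HermiteDecay ħ₀ a) ∧
      (VanishesToInfiniteOrder c → GroundStateDecay ħ₀ a) :=
  ⟨⟨ha.hermiteDecay, ha.vanishesToInfiniteOrder hħ₀⟩, ha.groundStateDecay⟩
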